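/- **Definitions.** All graphs are finite, simple and undirected. A *split partition* of $G=(V,E)$ is a partition $V=K\sqcup I$ with $K$ a clique and $I$ an independent set. For a set $X=\{v_1,\dots,v_k\}$ of $k$ distinct vertices, the ordering $(v_1,\dots,v_k)$ is a *nested neighborhood ordering* if $N(v_1)\setminus X\subseteq N(v_2)\setminus X\subseteq\dots\subseteq N(v_k)\setminus X$. $G$ is a *threshold graph* if it has a split partition $(K,I)$ such that $I$ has a nested neighborhood ordering. *Model (Aggarwal–Vitter I/O model).* External memory is partitioned into blocks of $B$ elements, main memory holds $M$ elements, $1\le B\le M/2$. An I/O transfers one block between external and main memory, or moves at most $B$ elements from main memory to the output. Computation in main memory is free and unrestricted; between I/Os an algorithm remembers only the contents of main memory and a control state from a finite set that does not depend on $M$, $B$ or the input. On a graph with $n$ vertices and $m$ edges, elements and block addresses are nonnegative integers of size at most $(n+m+2)^{d}$, with $d$ a constant of the algorithm. We put $$\mathrm{scan}(N)=\lceil N/B\rceil,\qquad \mathrm{sort}(N)=\lceil N/B\rceil\cdot\max\{1,\log_{M/B}(N/B)\}.$$ The graph, with vertex set $\{0,\dots,n-1\}$, is stored in external memory in adjacency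 row representation: an array $P$ of length $n+1$ followed by an array $E$ of length $2m$, where the neighbors of $v$ are listed, each once and in arbitrary order, in $E$ at positions $P[v],\dots,P[v+1]-1$. Initially main memory contains $n$ and $m$ and is zero otherwise. **Lemma.** There are a single deterministic algorithm in this model and constants $C,d$ such that for all $M,B$ with $1\le B\le M/2$, every graph $G$ with $n\ge 0$ vertices and $m$ edges, and every adjacency row representation of $G$, the algorithm halts after at most $C\cdot\mathrm{sort}(n+m)$ I/Os in total, and: * if $G$ is a threshold graph, it answers YES and thereafter outputs, with at most $C\cdot\mathrm{scan}(|\beta|)$ further I/Os, an ordering $\beta=(v_1,\dots,v_k)$ of distinct vertices such that $I=\{v_1,\dots,v_k\}$ is an independent set, $V\setminus I$ is a clique, and $\beta$ is a nested neighborhood ordering (the YES-certificate); * if $G$ is not a threshold graph, it answers NO and thereafter outputs four vertices $(w_0,w_1,w_2,w_3)$ that induce a $2K_2$, a $P_4$ or a $C_4$ in $G$, listed as the image of $(0,1,2,3)$ under an isomorphism from the graph with edges $01,23$, the path $0\,1\,2\,3$, or the cycle $0\,1\,2\,3$, respectively, onto the induced subgraph (the NO-certificate). -/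

import Mathlib

/-! ### Threshold graphs and their certificates -/

namespace ThresholdCert

/-- `(K, I)` is a split partition: the vertex set is the disjoint union of the clique `K` and the
independent set `I`. -/
structure IsSplitPartition {V : Type*} (G : SimpleGraph V) (K I : Set V) : Prop where
  cover : K ∪ I = Set.univ
  disj : Disjoint K I
  clique : G.IsClique K
  indep : G.IsIndepSet I

/-- `β = (v₁, …, v_k)`, a sequence of distinct vertices with underlying set `X`, is a nested
neighborhood ordering: `N(v₁) \ X ⊆ N(v₂) \ X ⊆ … ⊆ N(v_k) \ X`. -/
def IsNestedNbhdOrdering {V : Type*} (G : SimpleGraph V) (β : List V) : Prop :=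
  β.Nodup ∧
    β.Pairwise (fun u v => G.neighborSet u \ {x | x ∈ β} ⊆ G.neighborSet v \ {x | x ∈ β})

/-- A threshold graph: it has a split partition `(K, I)` such that `I` has a nested neighborhood
ordering. -/
def IsThreshold {V : Type*} (G : SimpleGraph V) : Prop :=
  ∃ K I : Set V, IsSplitPartition G K I ∧
    ∃ β : List V, {x | x ∈ β} = I ∧ IsNestedNbhdOrdering G β

/-- YES-certificate: a nested neighborhood ordering `β` of the independent side of a split
partition (the clique side is the complement of `β`). -/
def IsYesCertificate {V : Type*} (G : SimpleGraph V) (β : List V) : Prop :=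
  IsSplitPartition G {x | x ∉ β} {x | x ∈ β} ∧ IsNestedNbhdOrdering G β

/-- The graph `2K₂`: edges `01` and `23`. -/
def twoK2 : SimpleGraph (Fin 4) := SimpleGraph.fromEdgeSet {s(0, 1), s(2, 3)}

/-- NO-certificate: four vertices, in order the images of `0, 1, 2, 3` under an embedding of
`2K₂`, `P₄` or `C₄` into `G` as an induced subgraph. -/
def IsNoCertificate {V : Type*} (G : SimpleGraph V) (w : List V) : Prop :=
  ∃ H : SimpleGraph (Fin 4),
    (H = twoK2 ∨ H = SimpleGraph.pathGraph 4 ∨ H = SimpleGraph.cycleGraph 4) ∧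
      ∃ f : H ↪g G, w = List.ofFn f

/-! ### Adjacency row representation -/

/-- `adj v` lists the neighbors of `v`, each exactly once, in an arbitrary order. -/
def IsAdjacencyLists {n : ℕ} (G : SimpleGraph (Fin n)) (adj : Fin n → List (Fin n)) : Prop :=
  ∀ v, (adj v).Nodup ∧ ∀ w, w ∈ adj v ↔ G.Adj v w

/-- The array `E`: the concatenation of the adjacency lists of the vertices `0, …, n - 1`. -/
def rowE {n : ℕ} (adj : Fin n → List (Fin n)) : List ℕ :=
  ((List.ofFn adj).flatten).map Fin.val

/-- The array `P` of length `n + 1`: `P[i]` is the number of entries of the first `i` adjacency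
lists, so that the neighbors of `v` are stored in `E` at positions `P[v], …, P[v + 1] - 1`. -/
def rowP {n : ℕ} (adj : Fin n → List (Fin n)) : List ℕ :=
  List.ofFn (fun i : Fin (n + 1) => (((List.ofFn adj).take (i : ℕ)).flatten).length)

/-! ### The external memory model

External memory is an infinite array of elements, partitioned into blocks of `B` consecutive
elements. Main memory has `M` cells, one element each. Elements are natural numbers; a word bound
`W` is imposed on all elements and block addresses that occur in a run. Computation inside main
memory is free, a block transfer costs one. -/

/-- The instructions of an external memory machine. -/
inductive Instr where
  /-- load block `a` of external memory into the main memory cells `s, …, s + B - 1` -/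
  | read (a s : ℕ)
  /-- store the main memory cells `s, …, s + B - 1` into block `a` of external memory -/
  | write (a s : ℕ)
  /-- append the main memory cells `s, …, s + k - 1`, where `k ≤ B`, to the output -/
  | emit (s k : ℕ)
  /-- announce the answer; this ends the decision phase and starts the output phase -/
  | answer (b : Bool)
  /-- stop -/
  | halt

/-- An external memory algorithm: a finite control, independent of `M`, `B` and the input, and a
rule that, from the control state and the contents of main memory only, computes the next
instruction, control state and main memory contents (the latter before the instruction is
executed). -/
structure Machine where
  State : Type
  finite : Finite State
  start : State
  next : (M B : ℕ) → State → (Fin M → ℕ) → Instr × State × (Fin M → ℕ)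

/-- A configuration of a machine with `M` cells of main memory. -/
structure Config (Q : Type) (M : ℕ) where
  state : Q
  mem : Fin M → ℕ
  disk : ℕ → ℕ
  verdict : Option Bool
  out : List ℕ

/-- The content of main memory cell `i` (`0` if there is no such cell). -/
def cell {M : ℕ} (μ : Fin M → ℕ) (i : ℕ) : ℕ := if h : i < M then μ ⟨i, h⟩ else 0

/-- Main memory after block `a` was loaded into the cells `s, …, s + B - 1`. -/
def loadBlock {M : ℕ} (B : ℕ) (disk : ℕ → ℕ) (a s : ℕ) (μ : Fin M → ℕ) : Fin M → ℕ :=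
  fun i => if s ≤ (i : ℕ) ∧ (i : ℕ) < s + B then disk (a * B + ((i : ℕ) - s)) else μ i

/-- External memory after the cells `s, …, s + B - 1` were stored into block `a`. -/
def storeBlock {M : ℕ} (B : ℕ) (disk : ℕ → ℕ) (a s : ℕ) (μ : Fin M → ℕ) : ℕ → ℕ :=
  fun j => if a * B ≤ j ∧ j < a * B + B then cell μ (s + (j - a * B)) else disk j

/-- `Step A M B W c t c'`: the machine moves from `c` to `c'`, performing `t` block transfers.
Output is possible only after the answer, and the answer is given once. -/
inductive Step (A : Machine) (M B W : ℕ) :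
    Config A.State M → ℕ → Config A.State M → Prop
  | read {c : Config A.State M} {a s : ℕ} {q : A.State} {μ : Fin M → ℕ}
      (h : A.next M B c.state c.mem = (Instr.read a s, q, μ))
      (hμ : ∀ i, μ i ≤ W) (ha : a ≤ W) (hs : s + B ≤ M) :
      Step A M B W c 1 ⟨q, loadBlock B c.disk a s μ, c.disk, c.verdict, c.out⟩
  | write {c : Config A.State M} {a s : ℕ} {q : A.State} {μ : Fin M → ℕ}
      (h : A.next M B c.state c.mem = (Instr.write a s, q, μ))
      (hμ : ∀ i, μ i ≤ W) (ha : a ≤ W) (hs : s + B ≤ M) :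
      Step A M B W c 1 ⟨q, μ, storeBlock B c.disk a s μ, c.verdict, c.out⟩
  | emit {c : Config A.State M} {s k : ℕ} {q : A.State} {μ : Fin M → ℕ}
      (h : A.next M B c.state c.mem = (Instr.emit s k, q, μ))
      (hμ : ∀ i, μ i ≤ W) (hk : k ≤ B) (hs : s + k ≤ M) (hv : c.verdict ≠ none) :
      Step A M B W c 1
        ⟨q, μ, c.disk, c.verdict, c.out ++ (List.range k).map (fun i => cell μ (s + i))⟩
  | answer {c : Config A.State M} {b : Bool} {q : A.State} {μ : Fin M → ℕ}
      (h : A.next M B c.state c.mem = (Instr.answer b, q, μ))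
      (hμ : ∀ i, μ i ≤ W) (hv : c.verdict = none) :
      Step A M B W c 0 ⟨q, μ, c.disk, some b, c.out⟩

/-- `Run A M B W c t c'`: finitely many steps lead from `c` to `c'`, with `t` block transfers in
total. -/
inductive Run (A : Machine) (M B W : ℕ) :
    Config A.State M → ℕ → Config A.State M → Prop
  | refl (c : Config A.State M) : Run A M B W c 0 c
  | head {c c' c'' : Config A.State M} {t t' : ℕ}
      (h : Step A M B W c t c') (h' : Run A M B W c' t' c'') : Run A M B W c (t + t') c''

/-- `Returns A M B W c b out t s`: started in `c`, the machine announces the answer `b` after `t`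
block transfers and then halts, after `s` further block transfers, with output `out`. -/
def Returns (A : Machine) (M B W : ℕ) (c : Config A.State M) (b : Bool) (out : List ℕ)
    (t s : ℕ) : Prop :=
  ∃ c₁ c₂ : Config A.State M,
    Run A M B W c t c₁ ∧ c₁.verdict = none ∧
    (A.next M B c₁.state c₁.mem).1 = Instr.answer b ∧
    Run A M B W c₁ s c₂ ∧ c₂.verdict = some b ∧
    (A.next M B c₂.state c₂.mem).1 = Instr.halt ∧ c₂.out = out

/-- The initial configuration: external memory holds the array `P` followed by the array `E`, main
memory holds the numbers `n` of vertices and `m` of edges, and everything else is `0`. -/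
def initConfig (A : Machine) (M m : ℕ) {n : ℕ} (adj : Fin n → List (Fin n)) :
    Config A.State M where
  state := A.start
  mem := fun i => if (i : ℕ) = 0 then n else if (i : ℕ) = 1 then m else 0
  disk := fun i => (rowP adj ++ rowE adj).getD i 0
  verdict := none
  out := []

/-- `scan(N) = ⌈N / B⌉`. -/
noncomputable def scanCost (B N : ℕ) : ℝ := (⌈(N : ℝ) / B⌉₊ : ℝ)

/-- `sort(N) = ⌈N / B⌉ · max (1, log_{M/B} (N / B))`. -/
noncomputable def sortCost (M B N : ℕ) : ℝ :=
  (⌈(N : ℝ) / B⌉₊ : ℝ) * max 1 (Real.logb ((M : ℝ) / B) ((N : ℝ) / B))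

end ThresholdCert

/-! Combinatorial core. Say that `u` lies below `v` if every neighbor of `u` other than `v` is a
neighbor of `v` (`Nested`). List the vertices by nondecreasing degree and test only consecutive
pairs. If all tests succeed, transitivity makes the whole list a chain
(`pairwise_nested_of_isChain`), and comparing the degree of each vertex with its index splits the
list into an independent set and a clique (`isYesCertificate_select`). If the test of `u`, `v` fails
at a neighbor `x` of `u`, then `deg u ≤ deg v` forces a neighbor `y` of `v` that `u` lacks
(`exists_alternating`). The edges `ux`, `vy` and the non-edges `vx`, `uy` exclude a nested split
partition (`IsAlternating.not_isThreshold`), and the adjacencies of `uv` and `xy` decide which of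
`2K₂`, `P₄`, `C₄` is induced.

Algorithm. Every vertex gets a record `(degree, vertex, 0)` and every adjacency a record `(degree,
vertex, neighbor + 1)`. Lexicographic sorting arranges the adjacency lists by degree and each list
by neighbors, so that two cursors compare consecutive lists in one scan. After a failure, the same
comparison with exchanged roles finds `y`, and two scans look up `uv` and `xy`. Thus one sort and a
bounded number of scans suffice.

Costs. A scan is a transducer with `k` block buffers for reading and one for writing; amortization
over the offsets inside the buffers bounds its transfers (`pass_evals`). Merging `M / B` runs at a
time gives the sorting bound (`mergeSort_evals`).

Finite control. Between transfers, main memory has to hold the whole state of the computation. No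
memory layout is designed for this. The algorithm is a tree of transfers (`Prog`), and it suffices
to count its residual subtrees: if there are at most `K ^ (M - B)` of them, with `K` polynomial in
`n + m`, then the current one is coded by `M - B` cells, and the other `B` cells serve as transfer
buffer (`Family.returns`). A merge with `M / B` buffers of `B` words has `(n + m + 2) ^ O(M)`
residual programs, and since `M - B ≥ M / 2`, the constant is absorbed by the exponent of the word
size (`thresholdFamily_good`). -/

namespace ThresholdCert

/-! ### Block-level programs -/

/-- Programs for the external memory model: trees of block transfers with unrestricted internal
computation. -/
inductive Prog (B : ℕ) (α ρ : Type) : Type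
  | ret (x : ρ)
  | read (a : ℕ) (k : (Fin B → α) → Prog B α ρ)
  | write (a : ℕ) (x : Fin B → α) (k : Prog B α ρ)
  | emit (l : List α) (k : Prog B α ρ)
  | answer (b : Bool) (k : Prog B α ρ)

namespace Prog

variable {B : ℕ} {α ρ τ : Type}

/-- Sequential composition. -/
def bind : Prog B α ρ → (ρ → Prog B α τ) → Prog B α τ
  | ret x, f => f x
  | read a k, f => read a (fun r => (k r).bind f)
  | write a x k, f => write a x (k.bind f)
  | emit l k, f => emit l (k.bind f)
  | answer b k, f => answer b (k.bind f)

/-- `loop body i n x` runs `body i`, …, `body (i + n - 1)`, passing on a value. -/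
def loop (body : ℕ → ρ → Prog B α ρ) : ℕ → ℕ → ρ → Prog B α ρ
  | _, 0, x => ret x
  | i, n + 1, x => (body i x).bind (loop body (i + 1) n)

/-- The children of a node lie in `S`, its address is at most `A`, its result lies in `R`. -/
def Node (A : ℕ) (R : Set ρ) (S : Set (Prog B α ρ)) : Prog B α ρ → Prop
  | ret x => x ∈ R
  | read a k => a ≤ A ∧ ∀ r, k r ∈ S
  | write a _ k => a ≤ A ∧ k ∈ S
  | emit l k => l.length ≤ B ∧ k ∈ S
  | answer _ k => k ∈ S

theorem Node.mono {A A' : ℕ} {R R' : Set ρ} {S S' : Set (Prog B α ρ)} (hA : A ≤ A') (hR : R ⊆ R')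
    (hS : S ⊆ S') {p : Prog B α ρ} (h : p.Node A R S) : p.Node A' R' S' := by
  cases p with
  | ret x => exact hR h
  | read a k => exact ⟨h.1.trans hA, fun r => hS (h.2 r)⟩
  | write a x k => exact ⟨h.1.trans hA, hS h.2⟩
  | emit l k => exact ⟨h.1, hS h.2⟩
  | answer b k => exact hS h

/-- The programs in `P` have altogether at most `N` residual programs, use addresses up to `A`,
and return values in `R`. -/
def FitsSet (A N : ℕ) (R : Set ρ) (P : Set (Prog B α ρ)) : Prop :=
  ∃ S : Finset (Prog B α ρ), S.card ≤ N ∧ P ⊆ ↑S ∧ ∀ q ∈ S, q.Node A R ↑S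

/-- The program `p` has at most `N` residual programs, uses addresses up to `A`, and returns values
in `R`. -/
def Fits (A N : ℕ) (R : Set ρ) (p : Prog B α ρ) : Prop := FitsSet A N R {p}

theorem FitsSet.mono {A N A' N' : ℕ} {R R' : Set ρ} {P P' : Set (Prog B α ρ)}
    (h : FitsSet A N R P) (hA : A ≤ A') (hN : N ≤ N') (hR : R ⊆ R') (hP : P' ⊆ P) :
    FitsSet A' N' R' P' := by
  obtain ⟨S, h1, h2, h3⟩ := h
  exact ⟨S, h1.trans hN, hP.trans h2, fun q hq => (h3 q hq).mono hA hR subset_rfl⟩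

theorem Fits.mono {A N A' N' : ℕ} {R R' : Set ρ} {p : Prog B α ρ}
    (h : Fits A N R p) (hA : A ≤ A') (hN : N ≤ N') (hR : R ⊆ R') : Fits A' N' R' p :=
  FitsSet.mono h hA hN hR subset_rfl

theorem FitsSet.biUnion {ι : Type} {A N c : ℕ} {R : Set ρ} {I : Set ι} {F : Finset ι}
    (hF : F.card ≤ c) (hI : I ⊆ ↑F) {f : ι → Prog B α ρ} (h : ∀ x ∈ I, Fits A N R (f x)) :
    FitsSet A (c * N) R (f '' I) := by
  classical
  choose! S h1 h2 h3 using h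
  refine ⟨(F.filter (· ∈ I)).biUnion S, ?_, ?_, ?_⟩
  · refine (Finset.card_biUnion_le_card_mul _ _ N ?_).trans ?_
    · intro x hx
      exact h1 x (Finset.mem_filter.1 hx).2
    · exact Nat.mul_le_mul_right _ ((Finset.card_filter_le _ _).trans hF)
  · rintro _ ⟨x, hx, rfl⟩
    simp only [Finset.coe_biUnion, Set.mem_iUnion]
    exact ⟨x, by simpa using ⟨hI hx, hx⟩, h2 x hx rfl⟩
  · intro q hq
    obtain ⟨x, hx, hq⟩ := Finset.mem_biUnion.1 hq
    refine (h3 x (Finset.mem_filter.1 hx).2 q hq).mono le_rfl subset_rfl ?_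
    exact_mod_cast Finset.subset_biUnion_of_mem S hx

theorem Fits.ret {A : ℕ} {R : Set ρ} {x : ρ} (h : x ∈ R) : Fits A 1 R (ret x : Prog B α ρ) :=
  ⟨{Prog.ret x}, by simp, by simp, by simpa [Node] using h⟩

theorem FitsSet.cons {A N : ℕ} {R : Set ρ} {P : Set (Prog B α ρ)} (h : FitsSet A N R P)
    {p : Prog B α ρ} (hp : p.Node A R P) : Fits A (N + 1) R p := by
  classical
  obtain ⟨S, h1, h2, h3⟩ := h
  have hS : (↑S : Set (Prog B α ρ)) ⊆ ↑(insert p S) := by simp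
  refine ⟨insert p S, (Finset.card_insert_le _ _).trans (by omega), by simp, ?_⟩
  intro q hq
  rcases Finset.mem_insert.1 hq with rfl | hq
  · exact hp.mono le_rfl subset_rfl (h2.trans hS)
  · exact (h3 q hq).mono le_rfl subset_rfl hS

/-- The contents of the block are unknown, so each of the `Fintype.card α ^ B` possible responses
may have a continuation of its own. -/
theorem Fits.read [Fintype α] {A N a : ℕ} {R : Set ρ} {k : (Fin B → α) → Prog B α ρ}
    (ha : a ≤ A) (h : ∀ r, Fits A N R (k r)) :
    Fits A (Fintype.card α ^ B * N + 1) R (read a k) := by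
  classical
  refine (FitsSet.biUnion (F := Finset.univ) (I := Set.univ) (c := Fintype.card α ^ B) ?_
    (by simp) (fun x _ => h x)).cons ?_
  · simp
  · exact ⟨ha, fun r => ⟨r, trivial, rfl⟩⟩

theorem Fits.write {A N a : ℕ} {R : Set ρ} {x : Fin B → α} {k : Prog B α ρ}
    (ha : a ≤ A) (h : Fits A N R k) : Fits A (N + 1) R (write a x k) :=
  h.cons ⟨ha, rfl⟩

theorem Fits.emit {A N : ℕ} {R : Set ρ} {l : List α} {k : Prog B α ρ}
    (hl : l.length ≤ B) (h : Fits A N R k) : Fits A (N + 1) R (emit l k) :=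
  h.cons ⟨hl, rfl⟩

theorem Fits.answer {A N : ℕ} {R : Set ρ} {b : Bool} {k : Prog B α ρ}
    (h : Fits A N R k) : Fits A (N + 1) R (answer b k) :=
  FitsSet.cons (p := Prog.answer b k) h rfl

/-- A residual program of `p.bind f` is `r.bind f` for a residual `r` of `p`, or a residual of some
`f x` with `x` a possible result. Hence the numbers add up. -/
theorem FitsSet.bind {A N N' : ℕ} {R : Set ρ} {R' : Set τ} {P : Set (Prog B α ρ)}
    {f : ρ → Prog B α τ} (h : FitsSet A N R P) (h' : FitsSet A N' R' (f '' R)) :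
    FitsSet A (N + N') R' ((fun p => p.bind f) '' P) := by
  classical
  obtain ⟨S, h1, h2, h3⟩ := h
  obtain ⟨S', h1', h2', h3'⟩ := h'
  have hS' : (↑S' : Set (Prog B α τ)) ⊆ ↑(S.image (fun p => p.bind f) ∪ S') := by simp
  refine ⟨S.image (fun p => p.bind f) ∪ S', ?_, ?_, ?_⟩
  · exact (Finset.card_union_le _ _).trans (Nat.add_le_add (Finset.card_image_le.trans h1) h1')
  · rintro _ ⟨p, hp, rfl⟩
    simp only [Finset.coe_union, Finset.coe_image, Set.mem_union, Set.mem_image]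
    exact Or.inl ⟨p, h2 hp, rfl⟩
  · intro q hq
    rcases Finset.mem_union.1 hq with hq | hq
    · obtain ⟨p, hp, rfl⟩ := Finset.mem_image.1 hq
      have key : ∀ r, r ∈ (↑S : Set (Prog B α ρ)) →
          r.bind f ∈ (↑(S.image (fun p => p.bind f) ∪ S') : Set (Prog B α τ)) := by
        intro r hr
        simp only [Finset.coe_union, Finset.coe_image, Set.mem_union, Set.mem_image]
        exact Or.inl ⟨r, hr, rfl⟩
      have hn := h3 p hp
      cases p with
      | ret x => exact (h3' (f x) (h2' ⟨x, hn, rfl⟩)).mono le_rfl subset_rfl hS'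
      | read a k => exact ⟨hn.1, fun r => key _ (hn.2 r)⟩
      | write a x k => exact ⟨hn.1, key _ hn.2⟩
      | emit l k => exact ⟨hn.1, key _ hn.2⟩
      | answer b k => exact key _ hn
    · exact (h3' q hq).mono le_rfl subset_rfl hS'

/-- The continuation depends on the first program through its result only. This is why the set `R`
of results is tracked: the second size is multiplied by the number of results, not by the number of
leaves. -/
theorem Fits.bind {A N N' c : ℕ} {R : Set ρ} {R' : Set τ} {p : Prog B α ρ}
    {f : ρ → Prog B α τ} (h : Fits A N R p) {F : Finset ρ} (hF : F.card ≤ c) (hR : R ⊆ ↑F)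
    (h' : ∀ x ∈ R, Fits A N' R' (f x)) : Fits A (N + c * N') R' (p.bind f) :=
  (FitsSet.bind h (FitsSet.biUnion hF hR h')).mono le_rfl le_rfl subset_rfl (by simp)

/-- Sequential composition after a program without result. -/
theorem Fits.seq {A N N' : ℕ} {R : Set Unit} {R' : Set τ} {p : Prog B α Unit}
    {f : Unit → Prog B α τ} (h : Fits A N R p) (h' : Fits A N' R' (f ())) :
    Fits A (N + N') R' (p.bind f) :=
  (Fits.bind (c := 1) h (F := Finset.univ) (by simp) (by simp) (fun _ _ => h')).mono le_rfl
    (by simp) subset_rfl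

theorem Fits.loop {A N c n i : ℕ} {R : ℕ → Set ρ} {F : Finset ρ} (hF : F.card ≤ c)
    (hR : ∀ j, R j ⊆ ↑F) {body : ℕ → ρ → Prog B α ρ}
    (h : ∀ j, i ≤ j → j < i + n → ∀ x ∈ R j, Fits A N (R (j + 1)) (body j x)) {x : ρ}
    (hx : x ∈ R i) : Fits A (c * (n * N + 1)) (R (i + n)) (loop body i n x) := by
  -- The induction treats all values in `R i` together. Starting from a single value and applying
  -- `Fits.bind` would multiply the size by `c` in each iteration, whereas sharing the continuations
  -- makes it grow linearly in `n`.
  have key : FitsSet A (c * (n * N + 1)) (R (i + n)) (Prog.loop body i n '' R i) := by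
    clear hx x
    induction n generalizing i with
    | zero =>
      refine (FitsSet.biUnion (N := 1) hF (hR i) (fun x hx => ?_)).mono le_rfl (by simp)
        subset_rfl subset_rfl
      exact Fits.ret hx
    | succ n ih =>
      have h1 := ih (i := i + 1) (fun j h1 h2 => h j (by omega) (by omega))
      have h2 : FitsSet A (c * N) (R (i + 1)) (body i '' R i) :=
        FitsSet.biUnion hF (hR i) (fun x hx => h i le_rfl (by omega) x hx)
      refine (h2.bind h1).mono le_rfl (le_of_eq (by ring)) ?_ ?_
      · rw [show i + 1 + n = i + (n + 1) by ring]
      · rintro _ ⟨x, hx, rfl⟩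
        exact ⟨body i x, ⟨x, hx, rfl⟩, rfl⟩
  exact key.mono le_rfl le_rfl subset_rfl (by simpa using ⟨x, hx, rfl⟩)

/-- Loops of programs without result whose bodies have sizes `N j`. -/
theorem Fits.loop_unit {A n i : ℕ} {N : ℕ → ℕ} {body : ℕ → Unit → Prog B α Unit}
    (h : ∀ j, i ≤ j → j < i + n → Fits A (N j) Set.univ (body j ())) :
    Fits A ((∑ j ∈ Finset.range n, N (i + j)) + 1) Set.univ (Prog.loop body i n ()) := by
  induction n generalizing i with
  | zero => exact (Fits.ret (Set.mem_univ _)).mono le_rfl (by simp) subset_rfl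
  | succ n ih =>
    have h1 := ih (i := i + 1) (fun j h1 h2 => h j (by omega) (by omega))
    refine ((h i le_rfl (by omega)).seq (f := Prog.loop body (i + 1) n) h1).mono le_rfl ?_
      subset_rfl
    rw [Finset.sum_range_succ']
    simp only [Nat.add_zero, show ∀ j, i + 1 + j = i + (j + 1) from fun j => by ring]
    omega

/-! ### Execution -/

/-- Block `a` of the external memory `D`. -/
def block (B : ℕ) (D : ℕ → α) (a : ℕ) : Fin B → α := fun j => D (a * B + j)

/-- External memory after block `a` was overwritten by `x`. -/
def setBlock (D : ℕ → α) (a : ℕ) (x : Fin B → α) : ℕ → α :=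
  fun j => if h : a * B ≤ j ∧ j < a * B + B then x ⟨j - a * B, by omega⟩ else D j

/-- `p.Evals D x D' t`: the program turns the external memory `D` into `D'` with `t` block transfers
and no output, and returns `x`. -/
inductive Evals : Prog B α ρ → (ℕ → α) → ρ → (ℕ → α) → ℕ → Prop
  | ret {x : ρ} {D : ℕ → α} : Evals (ret x) D x D 0
  | read {a : ℕ} {k : (Fin B → α) → Prog B α ρ} {D : ℕ → α} {x : ρ} {D' : ℕ → α} {t : ℕ}
      (h : Evals (k (block B D a)) D x D' t) : Evals (read a k) D x D' (t + 1)
  | write {a : ℕ} {b : Fin B → α} {k : Prog B α ρ} {D : ℕ → α} {x : ρ} {D' : ℕ → α} {t : ℕ}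
      (h : Evals k (setBlock D a b) x D' t) : Evals (write a b k) D x D' (t + 1)

theorem Evals.bind {p : Prog B α ρ} {f : ρ → Prog B α τ} {D D' D'' : ℕ → α} {x : ρ} {y : τ}
    {t t' : ℕ} (h : p.Evals D x D' t) (h' : (f x).Evals D' y D'' t') :
    (p.bind f).Evals D y D'' (t + t') := by
  induction h with
  | ret => simpa [Prog.bind] using h'
  | read h ih => rw [Nat.add_right_comm]; exact Evals.read (ih h')
  | write h ih => rw [Nat.add_right_comm]; exact Evals.write (ih h')

theorem Evals.loop {body : ℕ → ρ → Prog B α ρ} {n : ℕ} (Inv : ℕ → ρ → (ℕ → α) → ℕ → Prop)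
    (step : ∀ i x D c, i < n → Inv i x D c →
      ∃ x' D' t, (body i x).Evals D x' D' t ∧ Inv (i + 1) x' D' (c + t))
    {x : ρ} {D : ℕ → α} (h : Inv 0 x D 0) :
    ∃ x' D' t, (Prog.loop body 0 n x).Evals D x' D' t ∧ Inv n x' D' t := by
  have key : ∀ k i x D c, i + k = n → Inv i x D c →
      ∃ x' D' t, (Prog.loop body i k x).Evals D x' D' t ∧ Inv n x' D' (c + t) := by
    intro k
    induction k with
    | zero =>
      intro i x D c hi h
      obtain rfl : i = n := by omega
      exact ⟨x, D, 0, Evals.ret, h⟩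
    | succ k ih =>
      intro i x D c hi h
      obtain ⟨x', D', t, h1, h2⟩ := step i x D c (by omega) h
      obtain ⟨x'', D'', t', h3, h4⟩ := ih (i + 1) x' D' (c + t) (by omega) h2
      exact ⟨x'', D'', t + t', h1.bind h3, by rwa [← Nat.add_assoc]⟩
  simpa using key n 0 x D 0 (by omega) h

/-- `p.Prints D out t`: the program outputs `out` and stops after `t` block transfers, without
changing the external memory `D`. -/
inductive Prints : Prog B α ρ → (ℕ → α) → List α → ℕ → Prop
  | ret {x : ρ} {D : ℕ → α} : Prints (ret x) D [] 0
  | read {a : ℕ} {k : (Fin B → α) → Prog B α ρ} {D : ℕ → α} {out : List α} {t : ℕ}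
      (h : Prints (k (block B D a)) D out t) : Prints (read a k) D out (t + 1)
  | emit {l : List α} {k : Prog B α ρ} {D : ℕ → α} {out : List α} {t : ℕ}
      (h : Prints k D out t) : Prints (emit l k) D (l ++ out) (t + 1)

end Prog

/-! ### Compilation of block-level programs -/

namespace Prog

/-- The program that remains after an instruction with response `r`. -/
def resume {B : ℕ} {α ρ : Type} : Prog B α ρ → (Fin B → α) → Prog B α ρ
  | ret x, _ => ret x
  | read _ k, r => k r
  | write _ _ k, _ => k
  | emit _ k, _ => k
  | answer _ k, _ => k

/-- A set of programs that contains `p` and is closed under residual programs; it has at most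
`K ^ c` elements if there is such a set. -/
noncomputable def residuals {B : ℕ} {α ρ : Type} (K c : ℕ) (p : Prog B α ρ) :
    Set (Prog B α ρ) :=
  open Classical in if h : Fits K (K ^ c) Set.univ p then ↑h.choose else {p}

/-- A code of the residual programs of `p` by words of length `c` over `{0, …, K - 1}`. -/
noncomputable def code {B : ℕ} {α ρ : Type} (K c : ℕ) (p : Prog B α ρ) :
    Prog B α ρ → Fin c → ℕ :=
  open Classical in
  if h : ∃ f : Prog B α ρ → Fin c → ℕ, Set.InjOn f (residuals K c p) ∧ ∀ q i, f q i < K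
  then h.choose else fun _ _ => 0

/-- The inverse of `code`. -/
noncomputable def decode {B : ℕ} {α ρ : Type} (K c : ℕ) (p : Prog B α ρ) (w : Fin c → ℕ) :
    Prog B α ρ :=
  open Classical in
  if h : ∃ q ∈ residuals K c p, code K c p q = w then h.choose else p

section

variable {B K c : ℕ} {α ρ : Type} {p : Prog B α ρ}

theorem mem_residuals (h : Fits K (K ^ c) Set.univ p) : p ∈ residuals K c p := by
  classical
  rw [residuals, dif_pos h]
  exact h.choose_spec.2.1 rfl

theorem node_of_mem_residuals (h : Fits K (K ^ c) Set.univ p) {q : Prog B α ρ}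
    (hq : q ∈ residuals K c p) : q.Node K Set.univ (residuals K c p) := by
  classical
  rw [residuals, dif_pos h] at hq ⊢
  exact h.choose_spec.2.2 q hq

/-- There are at most `K ^ c` residual programs, and exactly `K ^ c` words of length `c` over `K`
letters. -/
theorem exists_code (h : Fits K (K ^ c) Set.univ p) (hK : 0 < K) :
    ∃ f : Prog B α ρ → Fin c → ℕ, Set.InjOn f (residuals K c p) ∧ ∀ q i, f q i < K := by
  classical
  rw [residuals, dif_pos h]
  obtain ⟨g, hg⟩ := Function.Embedding.exists_of_card_le_finset
    (α := h.choose) (s := (Finset.univ : Finset (Fin c → Fin K)))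
    (by simpa using h.choose_spec.1)
  refine ⟨fun q i => if hq : q ∈ h.choose then (g ⟨q, hq⟩ i : ℕ) else 0, ?_, ?_⟩
  · intro q hq r hr hqr
    have hq' : q ∈ h.choose := hq
    have hr' : r ∈ h.choose := hr
    simp only [hq', hr', dif_pos] at hqr
    have : g ⟨q, hq'⟩ = g ⟨r, hr'⟩ := by
      funext i
      exact Fin.ext (congrFun hqr i)
    simpa using g.injective this
  · intro q i
    dsimp only
    split_ifs
    · exact (g _ i).2
    · exact hK

theorem code_lt (h : Fits K (K ^ c) Set.univ p) (hK : 0 < K) (q : Prog B α ρ) (i : Fin c) :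
    code K c p q i < K := by
  classical
  rw [code, dif_pos (exists_code h hK)]
  exact (exists_code h hK).choose_spec.2 q i

theorem decode_code (h : Fits K (K ^ c) Set.univ p) (hK : 0 < K) {q : Prog B α ρ}
    (hq : q ∈ residuals K c p) : decode K c p (code K c p q) = q := by
  classical
  have hinj : Set.InjOn (code K c p) (residuals K c p) := by
    rw [code, dif_pos (exists_code h hK)]
    exact (exists_code h hK).choose_spec.1
  have hex : ∃ q' ∈ residuals K c p, code K c p q' = code K c p q := ⟨q, hq, rfl⟩
  rw [decode, dif_pos hex]
  exact hinj hex.choose_spec.1 hq hex.choose_spec.2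

end

end Prog

/-- A family of block-level programs, for all `M`, `B`, `n` and `m`, with words from `α n m`
represented by natural numbers. -/
structure Family where
  α (_n _m : ℕ) : Type
  inst : ∀ n m : ℕ, Nonempty (α n m)
  enc : ∀ n m, α n m → ℕ
  enc_inj : ∀ n m, Function.Injective (enc n m)
  main : ∀ _M B n m : ℕ, Prog B (α n m) Unit
  exponent : ℕ

namespace Family

variable (F : Family)

/-- The size of the words that code a residual program. -/
def base (n m : ℕ) : ℕ := (n + m + 2) ^ F.exponent

/-- Main memory that holds the residual program `p` of `F.main M B n m` and the buffer `b`. -/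
noncomputable def memory (M B n m : ℕ) (p : Prog B (F.α n m) Unit) (b : ℕ → ℕ) : Fin M → ℕ :=
  fun i => if h : (i : ℕ) < M - B then
    -- Every cell repeats `n` and `m`, so that cell `0` alone tells which program is being executed.
    Nat.pair (Nat.pair n m) ((F.main M B n m).code (F.base n m) (M - B) p ⟨i, h⟩)
    else b (i - (M - B))

/-- The machine step that issues the first instruction of `p`. -/
noncomputable def issue (M B n m : ℕ) (p : Prog B (F.α n m) Unit) :
    Instr × Bool × (Fin M → ℕ) :=
  match p with
  | .ret _ => (Instr.halt, true, F.memory M B n m p (fun _ => 0))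
  | .read a _ => (Instr.read a (M - B), true, F.memory M B n m p (fun _ => 0))
  | .write a x _ => (Instr.write a (M - B), true,
      F.memory M B n m p (fun j => if h : j < B then F.enc n m (x ⟨j, h⟩) else 0))
  | .emit l _ => (Instr.emit (M - B) l.length, true,
      F.memory M B n m p (fun j => (l.map (F.enc n m)).getD j 0))
  | .answer b _ => (Instr.answer b, true, F.memory M B n m p (fun _ => 0))

/-- The residual program after the last instruction, where the words from cell `M - B` on are the
response. -/
noncomputable def resumed (M B n m : ℕ) (μ : Fin M → ℕ) : Prog B (F.α n m) Unit :=
  ((F.main M B n m).decode (F.base n m) (M - B) fun i => (Nat.unpair (cell μ i)).2).resume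
    fun j => haveI := F.inst n m; Function.invFun (F.enc n m) (cell μ (M - B + j))

/-- The external memory algorithm that executes the programs of the family. -/
noncomputable def machine : Machine where
  State := Bool
  finite := inferInstance
  start := false
  next M B q μ :=
    -- The control state is `false` only at the start, when cells `0` and `1` hold `n` and `m` in
    -- plain form.
    if q then
      F.issue M B (Nat.unpair (Nat.unpair (cell μ 0)).1).1 (Nat.unpair (Nat.unpair (cell μ 0)).1).2
        (F.resumed M B (Nat.unpair (Nat.unpair (cell μ 0)).1).1
          (Nat.unpair (Nat.unpair (cell μ 0)).1).2 μ)
    else F.issue M B (cell μ 0) (cell μ 1) (F.main M B (cell μ 0) (cell μ 1))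

/-- The configuration `c` is about to execute `p` on the external memory `D`. -/
structure Ready (M B n m : ℕ) (c : Config F.machine.State M) (p : Prog B (F.α n m) Unit)
    (D : ℕ → F.α n m) (v : Option Bool) (out : List ℕ) : Prop where
  next : F.machine.next M B c.state c.mem = F.issue M B n m p
  mem : p ∈ (F.main M B n m).residuals (F.base n m) (M - B)
  disk : c.disk = fun i => F.enc n m (D i)
  verdict : c.verdict = v
  out : c.out = out

variable {F} {M B n m : ℕ}

/-- The conditions under which the machine can execute `F.main M B n m`. -/
structure Good (F : Family) (M B n m : ℕ) : Prop where
  one_le : 1 ≤ B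
  two_mul_le : 2 * B ≤ M
  exponent : 2 ≤ F.exponent
  enc_le : ∀ x, F.enc n m x ≤ F.base n m
  fits : Prog.Fits (F.base n m) (F.base n m ^ (M - B)) Set.univ (F.main M B n m)

theorem base_pos : 0 < F.base n m := by unfold base; positivity

theorem cell_memory_of_lt {p : Prog B (F.α n m) Unit} {b : ℕ → ℕ} {i : ℕ} (hi : i < M - B) :
    cell (F.memory M B n m p b) i =
      Nat.pair (Nat.pair n m) ((F.main M B n m).code (F.base n m) (M - B) p ⟨i, hi⟩) := by
  rw [cell, dif_pos (by omega), memory, dif_pos hi]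

theorem cell_memory_add {p : Prog B (F.α n m) Unit} {b : ℕ → ℕ} {j : ℕ} (hj : j < B)
    (hB : B ≤ M) : cell (F.memory M B n m p b) (M - B + j) = b j := by
  rw [cell, dif_pos (by omega), memory, dif_neg (by simp)]
  simp

/-- Exponent at least `2` puts `Nat.pair n m` below the base. A cell then pairs two numbers below
the base, so it is bounded by the square of the base; this doubles the exponent of the word bound.
-/
theorem memory_le (hF : Good F M B n m) {p : Prog B (F.α n m) Unit} {b : ℕ → ℕ}
    (hb : ∀ j, b j ≤ F.base n m) (i : Fin M) :
    F.memory M B n m p b i ≤ (n + m + 2) ^ (2 * F.exponent) := by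
  have hK : 1 ≤ F.base n m := base_pos
  have hsq : (n + m + 2) ^ (2 * F.exponent) = F.base n m ^ 2 := by
    rw [base, ← pow_mul, mul_comm]
  rw [hsq, memory]
  split_ifs with h
  · have h1 : Nat.pair n m + 1 ≤ F.base n m := by
      have h2 := Nat.pair_lt_max_add_one_sq n m
      have h3 : (n + m + 2) ^ 2 ≤ F.base n m := Nat.pow_le_pow_right (by omega) hF.exponent
      have h4 : (max n m + 1) ^ 2 ≤ (n + m + 2) ^ 2 := Nat.pow_le_pow_left (by omega) 2
      omega
    have h2 := Prog.code_lt hF.fits base_pos p ⟨i, h⟩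
    refine (Nat.pair_lt_max_add_one_sq _ _).le.trans (Nat.pow_le_pow_left ?_ 2)
    omega
  · exact (hb _).trans (by nlinarith)

/-- Main memory still holds the code of the program `p` whose instruction has just been executed,
and only the buffer may differ from what was written. The response enters through `p.resume`, so
that the buffer is relevant after a read and arbitrary after any other instruction. -/
theorem issue_resumed (hF : Good F M B n m) {p : Prog B (F.α n m) Unit}
    (hp : p ∈ (F.main M B n m).residuals (F.base n m) (M - B)) {μ : Fin M → ℕ} {b : ℕ → ℕ}
    (hμ : ∀ i, i < M - B → cell μ i = cell (F.memory M B n m p b) i) {r : Fin B → F.α n m}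
    (hr : p.resume (fun j => haveI := F.inst n m;
      Function.invFun (F.enc n m) (cell μ (M - B + j))) = p.resume r) :
    F.machine.next M B true μ = F.issue M B n m (p.resume r) := by
  have h1 := hF.one_le
  have h2 := hF.two_mul_le
  have h0 : Nat.unpair (Nat.unpair (cell μ 0)).1 = (n, m) := by
    rw [hμ 0 (by omega), cell_memory_of_lt (by omega), Nat.unpair_pair, Nat.unpair_pair]
  have hres : F.resumed M B n m μ = p.resume r := by
    rw [← hr, resumed]
    congr 1
    convert Prog.decode_code hF.fits base_pos hp using 2
    funext i
    rw [hμ i i.2, cell_memory_of_lt i.2, Nat.unpair_pair]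
  -- The types depend on `n` and `m`, so the decoded pair is generalized before it is replaced by
  -- `(n, m)`.
  have key : ∀ nm : ℕ × ℕ, nm = (n, m) →
      F.issue M B nm.1 nm.2 (F.resumed M B nm.1 nm.2 μ) = F.issue M B n m (p.resume r) := by
    rintro _ rfl
    exact congrArg _ hres
  exact key _ h0

theorem next_memory (hF : Good F M B n m) {p : Prog B (F.α n m) Unit}
    (hp : p ∈ (F.main M B n m).residuals (F.base n m) (M - B)) {b : ℕ → ℕ} {r : Fin B → F.α n m}
    (hr : ∀ r', p.resume r' = p.resume r) :
    F.machine.next M B true (F.memory M B n m p b) = F.issue M B n m (p.resume r) :=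
  issue_resumed hF hp (b := b) (fun _ _ => rfl) (hr _)

theorem Ready.read (hF : Good F M B n m) {c : Config F.machine.State M} {a : ℕ}
    {k : (Fin B → F.α n m) → Prog B (F.α n m) Unit} {D : ℕ → F.α n m} {v : Option Bool}
    {out : List ℕ} (h : F.Ready M B n m c (.read a k) D v out) :
    ∃ c', Step F.machine M B ((n + m + 2) ^ (2 * F.exponent)) c 1 c' ∧
      F.Ready M B n m c' (k (Prog.block B D a)) D v out := by
  have h1 := hF.one_le
  have h2 := hF.two_mul_le
  have hn := Prog.node_of_mem_residuals hF.fits h.mem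
  have hW : F.base n m ≤ (n + m + 2) ^ (2 * F.exponent) :=
    Nat.pow_le_pow_right (by omega) (by omega)
  refine ⟨_, Step.read h.next (memory_le hF (by simp)) (hn.1.trans hW) (by omega), ?_⟩
  refine ⟨?_, hn.2 _, h.disk, h.verdict, h.out⟩
  -- A read overwrites exactly the last `B` cells and so leaves the code of the program intact.
  refine issue_resumed hF h.mem (b := fun _ => 0) ?_ (r := Prog.block B D a) ?_
  · intro i hi
    have hi' : i < M := by omega
    simp only [cell, dif_pos hi', loadBlock]
    rw [if_neg (by omega)]
  · simp only [Prog.resume]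
    congr 1
    funext j
    have hj := j.2
    have := F.inst n m
    have hi' : M - B + j < M := by omega
    simp only [cell, dif_pos hi', loadBlock]
    rw [if_pos (by omega), h.disk]
    simp only [Nat.add_sub_cancel_left]
    exact Function.leftInverse_invFun (F.enc_inj n m) _

theorem Ready.write (hF : Good F M B n m) {c : Config F.machine.State M} {a : ℕ}
    {x : Fin B → F.α n m} {k : Prog B (F.α n m) Unit} {D : ℕ → F.α n m} {v : Option Bool}
    {out : List ℕ} (h : F.Ready M B n m c (.write a x k) D v out) :
    ∃ c', Step F.machine M B ((n + m + 2) ^ (2 * F.exponent)) c 1 c' ∧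
      F.Ready M B n m c' k (Prog.setBlock D a x) v out := by
  have h1 := hF.one_le
  have h2 := hF.two_mul_le
  have hn := Prog.node_of_mem_residuals hF.fits h.mem
  have hW : F.base n m ≤ (n + m + 2) ^ (2 * F.exponent) :=
    Nat.pow_le_pow_right (by omega) (by omega)
  have hb : ∀ j, (if h : j < B then F.enc n m (x ⟨j, h⟩) else 0) ≤ F.base n m := by
    intro j
    split_ifs
    · exact hF.enc_le _
    · simp
  have hstep := Step.write (A := F.machine) (c := c) h.next (memory_le hF hb) (hn.1.trans hW)
    (by omega)
  refine ⟨_, hstep, ?_⟩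
  have hnext := fun b => next_memory hF h.mem (b := b) (r := x) fun _ => rfl
  refine ⟨?_, hn.2, ?_, h.verdict, h.out⟩
  · dsimp only
    exact hnext _
  funext j
  simp only [storeBlock, Prog.setBlock]
  split_ifs with hj
  · rw [cell_memory_add (by omega) (by omega), dif_pos (by omega)]
  · rw [h.disk]

theorem Ready.emit (hF : Good F M B n m) {c : Config F.machine.State M}
    {l : List (F.α n m)} {k : Prog B (F.α n m) Unit} {D : ℕ → F.α n m} {b : Bool}
    {out : List ℕ} (h : F.Ready M B n m c (.emit l k) D (some b) out) :
    ∃ c', Step F.machine M B ((n + m + 2) ^ (2 * F.exponent)) c 1 c' ∧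
      F.Ready M B n m c' k D (some b) (out ++ l.map (F.enc n m)) := by
  have h1 := hF.one_le
  have h2 := hF.two_mul_le
  have hn := Prog.node_of_mem_residuals hF.fits h.mem
  have hl : l.length ≤ B := hn.1
  have hb : ∀ j, (l.map (F.enc n m)).getD j 0 ≤ F.base n m := by
    intro j
    rw [List.getD_eq_getElem?_getD, List.getElem?_map]
    cases l[j]? with
    | none => simp
    | some x => exact hF.enc_le _
  have hstep := Step.emit (A := F.machine) (c := c) h.next (memory_le hF hb) hl (by omega)
    (by simp [h.verdict])
  refine ⟨_, hstep, ?_⟩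
  have hB : 0 < B := hF.one_le
  have := F.inst n m
  have hnext := fun b => next_memory hF h.mem (b := b) (r := fun _ => Classical.arbitrary _)
    fun _ => rfl
  refine ⟨?_, hn.2, h.disk, h.verdict, ?_⟩
  · dsimp only
    exact hnext _
  dsimp only
  rw [h.out]
  congr 1
  refine List.ext_getElem (by simp) ?_
  intro i hi hi'
  have hi2 : i < l.length := by simpa using hi
  simp only [List.getElem_map, List.getElem_range]
  rw [cell_memory_add (by omega) (by omega)]
  simp [hi2]

theorem Ready.answer (hF : Good F M B n m) {c : Config F.machine.State M} {b : Bool}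
    {k : Prog B (F.α n m) Unit} {D : ℕ → F.α n m}
    {out : List ℕ} (h : F.Ready M B n m c (.answer b k) D none out) :
    ∃ c', Step F.machine M B ((n + m + 2) ^ (2 * F.exponent)) c 0 c' ∧
      F.Ready M B n m c' k D (some b) out := by
  have hn := Prog.node_of_mem_residuals hF.fits h.mem
  have hstep := Step.answer (A := F.machine) (c := c) h.next (memory_le hF (by simp)) h.verdict
  refine ⟨_, hstep, ?_⟩
  have := F.inst n m
  have hnext := fun b => next_memory hF h.mem (b := b) (r := fun _ => Classical.arbitrary _)
    fun _ => rfl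
  refine ⟨?_, hn, h.disk, rfl, h.out⟩
  dsimp only
  exact hnext _

theorem Ready.evals (hF : Good F M B n m) {ρ : Type} {p : Prog B (F.α n m) ρ}
    {D D' : ℕ → F.α n m} {x : ρ} {t : ℕ} (hp : p.Evals D x D' t)
    {f : ρ → Prog B (F.α n m) Unit} {c : Config F.machine.State M} {v : Option Bool}
    {out : List ℕ} (h : F.Ready M B n m c (p.bind f) D v out) :
    ∃ c', Run F.machine M B ((n + m + 2) ^ (2 * F.exponent)) c t c' ∧
      F.Ready M B n m c' (f x) D' v out := by
  induction hp generalizing c with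
  | ret => exact ⟨c, Run.refl c, h⟩
  | read hp ih =>
    obtain ⟨c₁, h1, h2⟩ := Ready.read hF h
    obtain ⟨c₂, h3, h4⟩ := ih h2
    exact ⟨c₂, by simpa only [Nat.add_comm] using Run.head h1 h3, h4⟩
  | write hp ih =>
    obtain ⟨c₁, h1, h2⟩ := Ready.write hF h
    obtain ⟨c₂, h3, h4⟩ := ih h2
    exact ⟨c₂, by simpa only [Nat.add_comm] using Run.head h1 h3, h4⟩

theorem Ready.prints (hF : Good F M B n m) {p : Prog B (F.α n m) Unit}
    {D : ℕ → F.α n m} {o : List (F.α n m)} {t : ℕ} (hp : p.Prints D o t)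
    {c : Config F.machine.State M} {b : Bool}
    {out : List ℕ} (h : F.Ready M B n m c p D (some b) out) :
    ∃ c', Run F.machine M B ((n + m + 2) ^ (2 * F.exponent)) c t c' ∧ c'.verdict = some b ∧
      (F.machine.next M B c'.state c'.mem).1 = Instr.halt ∧
      c'.out = out ++ o.map (F.enc n m) := by
  induction hp generalizing c out with
  | ret => exact ⟨c, Run.refl c, h.verdict, by rw [h.next]; rfl, by simpa using h.out⟩
  | read hp ih =>
    obtain ⟨c₁, h1, h2⟩ := Ready.read hF h
    obtain ⟨c₂, h3, h4⟩ := ih h2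
    exact ⟨c₂, by simpa only [Nat.add_comm] using Run.head h1 h3, h4⟩
  | emit hp ih =>
    obtain ⟨c₁, h1, h2⟩ := Ready.emit hF h
    obtain ⟨c₂, h3, h4, h5, h6⟩ := ih h2
    exact ⟨c₂, by simpa only [Nat.add_comm] using Run.head h1 h3, h4, h5, by simp [h6]⟩

/-- The machine of a family simulates its programs. -/
theorem returns (hF : Good F M B n m) (adj : Fin n → List (Fin n)) {ρ : Type}
    {p : Prog B (F.α n m) ρ} {b : ρ → Bool} {q : ρ → Prog B (F.α n m) Unit}
    (hmain : F.main M B n m = p.bind fun x => .answer (b x) (q x))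
    {D D' : ℕ → F.α n m} (hD : ∀ i, F.enc n m (D i) = (rowP adj ++ rowE adj).getD i 0)
    {x : ρ} {t s : ℕ} (hp : p.Evals D x D' t) {o : List (F.α n m)} (hq : (q x).Prints D' o s) :
    Returns F.machine M B ((n + m + 2) ^ (2 * F.exponent)) (initConfig F.machine M m adj)
      (b x) (o.map (F.enc n m)) t s := by
  have h1 := hF.one_le
  have h2 := hF.two_mul_le
  have h0 : F.Ready M B n m (initConfig F.machine M m adj)
      (p.bind fun x => .answer (b x) (q x)) D none [] := by
    refine ⟨?_, ?_, ?_, rfl, rfl⟩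
    · have c0 : cell (initConfig F.machine M m adj).mem 0 = n := by
        rw [cell, dif_pos (by omega)]; rfl
      have c1 : cell (initConfig F.machine M m adj).mem 1 = m := by
        rw [cell, dif_pos (by omega)]; rfl
      have key : ∀ n' m', n' = n → m' = m →
          F.issue M B n' m' (F.main M B n' m') = F.issue M B n m (F.main M B n m) := by
        rintro _ _ rfl rfl
        rfl
      rw [← hmain]
      exact key _ _ c0 c1
    · rw [← hmain]
      exact Prog.mem_residuals hF.fits
    · funext i
      exact (hD i).symm
  obtain ⟨c₁, r1, r2⟩ := Ready.evals hF hp h0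
  obtain ⟨c₂, r3, r4⟩ := Ready.answer hF r2
  obtain ⟨c₃, r5, r6, r7, r8⟩ := Ready.prints hF hq r4
  refine ⟨c₁, c₃, r1, r2.verdict, congrArg Prod.fst r2.next, ?_, r6, r7, by simpa using r8⟩
  · simpa only [Nat.zero_add] using Run.head r3 r5

end Family

/-! ### Streaming passes -/

namespace Prog

variable {B k : ℕ} {α σ : Type}

/-- The rule of a transducer with `k` read cursors: from the state, the cursor positions and the
words under the cursors, compute the next state, the cursor that moves on, if any, and the word that
is appended to the output, if any. -/
abbrev Rule (k : ℕ) (α σ : Type) : Type :=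
  σ → (Fin k → ℕ) → (Fin k → α) → σ × Option (Fin k) × Option α

/-- Cursor positions after one cursor moved on. -/
def advance (pos : Fin k → ℕ) : Option (Fin k) → Fin k → ℕ
  | none => pos
  | some i => Function.update pos i (pos i + 1)

/-- `Trace δ D T s pos o s' pos'`: on the external memory `D`, a transducer goes from state `s` and
positions `pos` to state `s'` and positions `pos'` in `T` steps, with output `o`. -/
inductive Trace (δ : Rule k α σ) (D : ℕ → α) :
    ℕ → σ → (Fin k → ℕ) → List α → σ → (Fin k → ℕ) → Prop
  | zero (s : σ) (pos : Fin k → ℕ) : Trace δ D 0 s pos [] s pos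
  | step {T : ℕ} {s s₁ s' : σ} {pos pos' : Fin k → ℕ} {a : Option (Fin k)} {x : Option α}
      {o : List α} (h : δ s pos (fun i => D (pos i)) = (s₁, a, x))
      (h' : Trace δ D T s₁ (advance pos a) o s' pos') :
      Trace δ D (T + 1) s pos (x.toList ++ o) s' pos'

theorem Trace.trans {δ : Rule k α σ} {D : ℕ → α} {T T' : ℕ} {s s' s'' : σ}
    {pos pos' pos'' : Fin k → ℕ} {o o' : List α} (h : Trace δ D T s pos o s' pos')
    (h' : Trace δ D T' s' pos' o' s'' pos'') :
    Trace δ D (T + T') s pos (o ++ o') s'' pos'' := by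
  induction h with
  | zero s pos => simpa using h'
  | step h _ ih =>
    rw [Nat.add_right_comm, List.append_assoc]
    exact Trace.step h (ih h')

theorem Trace.idle {δ : Rule k α σ} {D : ℕ → α} {s : σ} {pos : Fin k → ℕ}
    (h : δ s pos (fun i => D (pos i)) = (s, none, none)) (T : ℕ) :
    Trace δ D T s pos [] s pos := by
  induction T with
  | zero => exact Trace.zero s pos
  | succ T ih => exact Trace.step h ih

/-- The state of a streaming pass: transducer state, cursor positions, the blocks under the cursors,
the number of blocks written, and the output buffer with the number of words in it. -/
structure PassState (B k : ℕ) (α σ : Type) where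
  st : σ
  pos : Fin k → ℕ
  buf : Fin k → Fin B → α
  full : ℕ
  fill : ℕ
  arr : Fin B → α

/-- Load the next block if the cursor that moves reaches it. -/
def refill (pos : Fin k → ℕ) (buf : Fin k → Fin B → α) :
    Option (Fin k) → Prog B α (Fin k → Fin B → α)
  | none => ret buf
  | some i =>
    if (pos i + 1) % B = 0 then
      read ((pos i + 1) / B) fun r => ret (Function.update buf i r)
    else ret buf

/-- Append a word to the output buffer, and write the buffer to external memory if it is full. -/
def put (base full fill : ℕ) (arr : Fin B → α) :
    Option α → Prog B α (ℕ × ℕ × (Fin B → α))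
  | none => ret (full, fill, arr)
  | some x =>
    let arr' : Fin B → α := fun j => if (j : ℕ) = fill then x else arr j
    if fill + 1 = B then write (base + full) arr' (ret (full + 1, 0, arr'))
    else ret (full, fill + 1, arr')

/-- One step of a transducer. -/
def passStep (hB : 0 < B) (δ : Rule k α σ) (base : ℕ) (S : PassState B k α σ) :
    Prog B α (PassState B k α σ) :=
  let r := δ S.st S.pos (fun i => S.buf i ⟨S.pos i % B, Nat.mod_lt _ hB⟩)
  (refill S.pos S.buf r.2.1).bind fun buf =>
    (put base S.full S.fill S.arr r.2.2).bind fun c =>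
      ret ⟨r.1, advance S.pos r.2.1, buf, c.1, c.2.1, c.2.2⟩

/-- Load the blocks under all cursors. -/
def loadAll (pos : Fin k → ℕ) (buf : Fin k → Fin B → α) : Prog B α (Fin k → Fin B → α) :=
  loop (fun i buf => if h : i < k then
    read (pos ⟨i, h⟩ / B) fun r => ret (Function.update buf ⟨i, h⟩ r) else ret buf) 0 k buf

/-- Write the output buffer, filled up with `pad`, to external memory. -/
def flush (base full fill : ℕ) (arr : Fin B → α) (pad : α) : Prog B α Unit :=
  if fill = 0 then ret ()
  else write (base + full) (fun j => if (j : ℕ) < fill then arr j else pad) (ret ())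

/-- Run a transducer for `T` steps, writing the output to external memory from block `base` on.
The result is the final state and the length of the output. -/
def pass (hB : 0 < B) (δ : Rule k α σ) (T base : ℕ) (pad : α) (s : σ) (pos : Fin k → ℕ) :
    Prog B α (σ × ℕ) :=
  (loadAll pos fun _ _ => pad).bind fun buf =>
    (loop (fun _ => passStep hB δ base) 0 T ⟨s, pos, buf, 0, 0, fun _ => pad⟩).bind fun S =>
      (flush base S.full S.fill S.arr pad).bind fun _ => ret (S.st, S.full * B + S.fill)

theorem loadAll_evals (pos : Fin k → ℕ) (buf : Fin k → Fin B → α) (D : ℕ → α) :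
    (loadAll pos buf).Evals D (fun i => block B D (pos i / B)) D k := by
  obtain ⟨x, D', t, h1, h2, h3, h4⟩ := Evals.loop (n := k)
    (body := fun i buf => if h : i < k then
      read (pos ⟨i, h⟩ / B) fun r => ret (Function.update buf ⟨i, h⟩ r) else ret buf)
    (fun i buf D₁ c => (∀ j : Fin k, (j : ℕ) < i → buf j = block B D (pos j / B)) ∧
      D₁ = D ∧ c = i)
    (by
      rintro i x D₁ c hi ⟨h1, rfl, rfl⟩
      simp only [dif_pos hi]
      refine ⟨_, _, 1, Evals.read Evals.ret, ?_, rfl, rfl⟩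
      intro j hj
      by_cases hji : j = ⟨c, hi⟩
      · subst hji
        simp
      · rw [Function.update_of_ne hji]
        have : (j : ℕ) ≠ c := fun h => hji (Fin.ext h)
        exact h1 j (by omega))
    (x := buf) (D := D) ⟨fun j hj => absurd hj (by omega), rfl, rfl⟩
  have hx : x = fun i => block B D (pos i / B) := funext fun i => h2 i i.2
  rwa [hx, h3, h4] at h1

theorem mod_div_succ_of_ne {B p : ℕ} (hB : 0 < B) (h : (p + 1) % B ≠ 0) :
    (p + 1) / B = p / B ∧ (p + 1) % B = p % B + 1 := by
  have h1 := Nat.div_add_mod p B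
  have h2 := Nat.mod_lt p hB
  have h4 : p + 1 = (p % B + 1) + B * (p / B) := by omega
  have h5 : p % B + 1 < B := by
    by_contra h3
    have h6 : p % B + 1 = B := by omega
    rw [h4, h6, Nat.add_mul_mod_self_left, Nat.mod_self] at h
    exact h rfl
  constructor
  · conv_lhs => rw [h4]
    rw [Nat.add_mul_div_left _ _ hB, Nat.div_eq_of_lt h5, zero_add]
  · conv_lhs => rw [h4]
    rw [Nat.add_mul_mod_self_left, Nat.mod_eq_of_lt h5]

theorem mod_succ_of_eq {B p : ℕ} (hB : 0 < B) (h : (p + 1) % B = 0) : p % B + 1 = B := by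
  have h1 := Nat.div_add_mod p B
  have h2 := Nat.mod_lt p hB
  by_contra h3
  have h4 : p + 1 = (p % B + 1) + B * (p / B) := by omega
  rw [h4, Nat.add_mul_mod_self_left, Nat.mod_eq_of_lt (by omega)] at h
  omega

/-- The external memory `E` and the output buffer after the words `o` have been appended to the
output, starting from the external memory `D`. -/
structure OutInv (B base : ℕ) (D : ℕ → α) (o : List α) (E : ℕ → α) (full fill : ℕ)
    (arr : Fin B → α) (pad : α) : Prop where
  length : o.length = full * B + fill
  lt : fill < B
  mem : ∀ q, E q = if base * B ≤ q ∧ q < (base + full) * B then o.getD (q - base * B) pad else D q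
  arr : ∀ j : Fin B, (j : ℕ) < fill → arr j = o.getD (full * B + j) pad

/-- The fill of the output buffer pays for the writes: it grows by at most one, and a write resets
it from `B` to `0`. -/
theorem OutInv.put {base : ℕ} {D : ℕ → α} {o : List α} {E : ℕ → α} {full fill : ℕ}
    {arr : Fin B → α} {pad : α} (h : OutInv B base D o E full fill arr pad) (x : Option α) :
    ∃ full' fill' arr' E' t, (put base full fill arr x).Evals E (full', fill', arr') E' t ∧
      OutInv B base D (o ++ x.toList) E' full' fill' arr' pad ∧ B * t + fill' ≤ fill + 1 := by
  have hl := h.length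
  have hlt := h.lt
  cases x with
  | none => exact ⟨full, fill, arr, E, 0, Evals.ret, by simpa using h, by omega⟩
  | some x =>
    simp only [Prog.put, Option.toList_some]
    have harr : ∀ j : Fin B, (j : ℕ) < fill + 1 →
        (fun j : Fin B => if (j : ℕ) = fill then x else arr j) j
          = (o ++ [x]).getD (full * B + j) pad := by
      intro j hj
      dsimp only
      split_ifs with hjf
      · rw [hjf, ← hl]; simp
      · rw [h.arr j (by omega), List.getD_append _ _ _ _ (by omega)]
    split_ifs with hf
    · refine ⟨_, _, _, _, 1, Evals.write Evals.ret, ⟨?_, by omega, ?_, ?_⟩, by omega⟩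
      · simp only [List.length_append, List.length_singleton, hl]
        rw [Nat.add_mul]; omega
      · intro q
        have e1 : (base + full) * B = base * B + full * B := Nat.add_mul _ _ _
        have e2 : (base + (full + 1)) * B = base * B + full * B + B := by ring
        rw [setBlock, h.mem q]
        by_cases c1 : (base + full) * B ≤ q ∧ q < (base + full) * B + B
        · rw [dif_pos c1]
          refine (harr ⟨q - (base + full) * B, by omega⟩ (by dsimp only; omega)).trans ?_
          rw [if_pos (by omega)]
          congr 1
          dsimp only
          omega
        · rw [dif_neg c1]
          by_cases c2 : base * B ≤ q ∧ q < (base + full) * B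
          · rw [if_pos c2, if_pos (by omega), List.getD_append _ _ _ _ (by omega)]
          · rw [if_neg c2, if_neg (by omega)]
      · intro j hj; omega
    · refine ⟨_, _, _, _, 0, Evals.ret, ⟨?_, by omega, ?_, harr⟩, by omega⟩
      · simp only [List.length_append, List.length_singleton, hl]; omega
      · intro q
        have e1 : (base + full) * B = base * B + full * B := Nat.add_mul _ _ _
        rw [h.mem q]
        split_ifs with c1
        · rw [List.getD_append _ _ _ _ (by omega)]
        · rfl

theorem sum_advance_mod (pos : Fin k → ℕ) (i : Fin k) :
    (∑ j, Function.update pos i (pos i + 1) j % B) + pos i % B =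
      (∑ j, pos j % B) + (pos i + 1) % B := by
  rw [← Finset.add_sum_erase _ _ (Finset.mem_univ i),
    ← Finset.add_sum_erase (Finset.univ) (fun j => pos j % B) (Finset.mem_univ i)]
  have : ∑ x ∈ Finset.univ.erase i, Function.update pos i (pos i + 1) x % B =
      ∑ x ∈ Finset.univ.erase i, pos x % B :=
    Finset.sum_congr rfl fun x hx => by rw [Function.update_of_ne (Finset.ne_of_mem_erase hx)]
  rw [this, Function.update_self]
  omega

/-- The offset of a cursor inside its block pays for the reads: it wraps from `B - 1` to `0` exactly
if a block is loaded. As the cursors stay below the output region, the current memory `E` and the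
original `D` agree on that block. -/
theorem refill_evals (hB : 0 < B) {base : ℕ} {D E : ℕ → α} (hE : ∀ q, q < base * B → E q = D q)
    {pos : Fin k → ℕ} {buf : Fin k → Fin B → α} (hbuf : ∀ i, buf i = block B D (pos i / B))
    (a : Option (Fin k)) (hpos : ∀ i, pos i + 1 < base * B) :
    ∃ buf' t, (refill pos buf a).Evals E buf' E t ∧
      (∀ i, buf' i = block B D (advance pos a i / B)) ∧
      B * t + ∑ i, advance pos a i % B ≤ (∑ i, pos i % B) + 1 := by
  cases a with
  | none => exact ⟨buf, 0, Evals.ret, hbuf, by simp [advance]⟩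
  | some i =>
    simp only [refill, advance]
    have hs := sum_advance_mod (B := B) pos i
    split_ifs with h
    · have hm := mod_succ_of_eq hB h
      refine ⟨_, 1, Evals.read Evals.ret, ?_, by omega⟩
      intro j
      by_cases hj : j = i
      · subst hj
        simp only [Function.update_self]
        funext r
        refine hE _ ?_
        have h1 : (pos j + 1) / B < base := (Nat.div_lt_iff_lt_mul hB).2 (hpos j)
        have h2 : ((pos j + 1) / B + 1) * B ≤ base * B := Nat.mul_le_mul_right _ h1
        rw [Nat.add_mul] at h2
        have := r.2
        omega
      · rw [Function.update_of_ne hj, Function.update_of_ne hj]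
        exact hbuf j
    · obtain ⟨h1, h2⟩ := mod_div_succ_of_ne hB h
      refine ⟨buf, 0, Evals.ret, ?_, by omega⟩
      intro j
      by_cases hj : j = i
      · subst hj
        rw [Function.update_self, h1]
        exact hbuf j
      · rw [Function.update_of_ne hj]
        exact hbuf j

/-- Take as potential the sum of all cursor offsets and the fill of the output buffer. A step raises
it by at most two, once for the cursor and once for the output, and every transfer lowers it by `B`;
its initial value appears in the bound. -/
theorem passLoop_evals (hB : 0 < B) {δ : Rule k α σ} {T base : ℕ} {pad : α} {D : ℕ → α} {s s' : σ}
    {pos pos' : Fin k → ℕ} {o : List α} (h : Trace δ D T s pos o s' pos')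
    (hpos : ∀ i, pos i + T < base * B) {E : ℕ → α} {o₀ : List α} {i : ℕ}
    {S : PassState B k α σ} (hs : S.st = s) (hp : S.pos = pos)
    (hbuf : ∀ i, S.buf i = block B D (pos i / B))
    (hout : OutInv B base D o₀ E S.full S.fill S.arr pad) :
    ∃ S' E' t, (loop (fun _ => passStep hB δ base) i T S).Evals E S' E' t ∧ S'.st = s' ∧
      OutInv B base D (o₀ ++ o) E' S'.full S'.fill S'.arr pad ∧
      B * t ≤ 2 * T + (∑ j, pos j % B) + S.fill := by
  induction h generalizing E o₀ i S with
  | zero s pos => exact ⟨S, E, 0, Evals.ret, hs, by simpa using hout, by omega⟩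
  | @step T s s₁ s' pos pos' a x o h h' ih =>
    subst hs hp
    have hhead : (fun i => S.buf i ⟨S.pos i % B, Nat.mod_lt _ hB⟩) = fun i => D (S.pos i) := by
      funext j
      rw [hbuf j, block]
      congr 1
      dsimp only
      rw [Nat.mul_comm]
      exact Nat.div_add_mod _ _
    obtain ⟨buf', t₁, e1, e2, e3⟩ := refill_evals hB (base := base) (E := E)
      (fun q hq => by rw [hout.mem q, if_neg (by omega)]) hbuf a
      (fun i => by have := hpos i; omega)
    obtain ⟨full', fill', arr', E', t₂, g1, g2, g3⟩ := hout.put x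
    obtain ⟨S', E'', t₃, f1, f2, f3, f4⟩ := ih (E := E') (o₀ := o₀ ++ x.toList) (i := i + 1)
      (S := ⟨s₁, advance S.pos a, buf', full', fill', arr'⟩)
      (fun j => by
        have h1 := hpos j
        have h2 : advance S.pos a j ≤ S.pos j + 1 := by
          cases a with
          | none => simp [advance]
          | some i =>
            simp only [advance, Function.update_apply]
            split_ifs with hji
            · rw [hji]
            · omega
        omega)
      rfl rfl e2 g2
    refine ⟨S', E'', t₁ + t₂ + t₃, ?_, f2, ?_, ?_⟩
    · refine Evals.bind (x := ⟨s₁, advance S.pos a, buf', full', fill', arr'⟩) ?_ f1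
      simp only [passStep, hhead, h]
      rw [← Nat.add_zero t₂]
      exact e1.bind (g1.bind Evals.ret)
    · rwa [← List.append_assoc]
    · dsimp only at f4
      rw [Nat.mul_add, Nat.mul_add]
      omega

/-- External memory `D` with the list `l` written at position `p`. -/
def overwrite (D : ℕ → α) (p : ℕ) (l : List α) : ℕ → α :=
  fun q => if p ≤ q then l.getD (q - p) (D q) else D q

/-- The list `o`, filled up with `pad` to a multiple of `B`. -/
def padded (B : ℕ) (o : List α) (pad : α) : List α :=
  o ++ List.replicate ((B - o.length % B) % B) pad

/-- The loop contributes `2 * T + k * B`, the initial loading of `k` buffers another `k * B`, and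
the final flush at most `B`. -/
theorem pass_evals (hB : 0 < B) {δ : Rule k α σ} {T base : ℕ} (pad : α) {D : ℕ → α} {s s' : σ}
    {pos pos' : Fin k → ℕ} {o : List α} (h : Trace δ D T s pos o s' pos')
    (hpos : ∀ i, pos i + T < base * B) :
    ∃ t, (pass hB δ T base pad s pos).Evals D (s', o.length)
        (overwrite D (base * B) (padded B o pad)) t ∧
      B * t ≤ 2 * T + 2 * k * B + B := by
  have e1 := loadAll_evals (B := B) pos (fun _ _ => pad) D
  obtain ⟨S, E, t, f1, f2, f3, f4⟩ := passLoop_evals hB (pad := pad) h hpos (E := D) (o₀ := [])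
    (i := 0) (S := ⟨s, pos, fun i => block B D (pos i / B), 0, 0, fun _ => pad⟩) rfl rfl
    (fun i => rfl)
    ⟨by simp, hB, fun q => by rw [if_neg (by rw [Nat.add_zero]; omega)], fun j hj => by
      simp at hj⟩
  have hsum : ∑ j, pos j % B ≤ k * B := by
    refine (Finset.sum_le_card_nsmul _ _ B fun j _ => (Nat.mod_lt _ hB).le).trans ?_
    simp
  have hl := f3.length
  have hlt := f3.lt
  simp only [List.nil_append] at f3 hl
  have hmod : o.length % B = S.fill := by
    rw [hl, Nat.add_comm, Nat.add_mul_mod_self_right, Nat.mod_eq_of_lt hlt]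
  have key : ∃ t', (flush base S.full S.fill S.arr pad).Evals E ()
      (overwrite D (base * B) (padded B o pad)) t' ∧ t' ≤ 1 := by
    have e0 : (base + S.full) * B = base * B + S.full * B := Nat.add_mul _ _ _
    unfold flush
    split_ifs with hf
    · refine ⟨0, ?_, by omega⟩
      have hE : overwrite D (base * B) (padded B o pad) = E := by
        funext q
        rw [f3.mem q, overwrite, padded, hmod, hf]
        simp only [Nat.sub_zero, Nat.mod_self, List.replicate_zero, List.append_nil]
        by_cases c1 : base * B ≤ q
        · rw [if_pos c1]
          by_cases c2 : q < (base + S.full) * B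
          · rw [if_pos ⟨c1, c2⟩, List.getD_eq_getElem _ _ (by omega), List.getD_eq_getElem]
          · rw [if_neg (by omega), List.getD_eq_default _ _ (by omega)]
        · rw [if_neg c1, if_neg (by omega)]
      rw [hE]
      exact Evals.ret
    · refine ⟨1, ?_, le_rfl⟩
      have hE : overwrite D (base * B) (padded B o pad) = setBlock E (base + S.full)
          (fun j : Fin B => if (j : ℕ) < S.fill then S.arr j else pad) := by
        funext q
        rw [setBlock, f3.mem q, overwrite, padded, hmod, Nat.mod_eq_of_lt (by omega)]
        by_cases c1 : (base + S.full) * B ≤ q ∧ q < (base + S.full) * B + B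
        · rw [dif_pos c1, if_pos (by omega)]
          dsimp only
          by_cases c2 : q - (base + S.full) * B < S.fill
          · rw [if_pos c2, f3.arr _ c2, List.getD_append _ _ _ _ (by omega),
              List.getD_eq_getElem _ _ (by omega), List.getD_eq_getElem _ _ (by dsimp only; omega)]
            congr 1
            dsimp only
            omega
          · rw [if_neg c2, List.getD_eq_getElem _ _ (by simp; omega),
              List.getElem_append_right (by omega)]
            simp
        · rw [dif_neg c1]
          by_cases c2 : base * B ≤ q ∧ q < (base + S.full) * B
          · rw [if_pos c2, if_pos c2.1, List.getD_append _ _ _ _ (by omega),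
              List.getD_eq_getElem _ _ (by omega), List.getD_eq_getElem _ _ (by omega)]
          · rw [if_neg c2]
            by_cases c3 : base * B ≤ q
            · rw [if_pos c3, List.getD_eq_default _ _ (by simp; omega)]
            · rw [if_neg c3]
      rw [hE]
      exact Evals.write Evals.ret
  obtain ⟨t', g1, g2⟩ := key
  refine ⟨k + (t + (t' + 0)), ?_, ?_⟩
  · refine e1.bind (f1.bind (g1.bind ?_))
    rw [f2, ← hl]
    exact Evals.ret
  · have : B * t' ≤ B * 1 := Nat.mul_le_mul_left _ g2
    dsimp only at f4
    rw [Nat.mul_add, Nat.mul_add, Nat.add_zero, Nat.mul_comm B k]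
    have : 2 * k * B = 2 * (k * B) := by ring
    omega

/-- The result is a single value `c`, so the continuation is counted only once. -/
theorem put_fits {A base full fill : ℕ} {arr : Fin B → α} (x : Option α)
    (hA : fill + 1 = B → base + full ≤ A) :
    ∃ c : ℕ × ℕ × (Fin B → α), Fits A 2 {c} (put base full fill arr x) ∧
      c.1 * B + c.2.1 ≤ full * B + fill + 1 ∧ c.1 ≤ full + 1 ∧ c.2.1 ≤ fill + 1 := by
  cases x with
  | none =>
    exact ⟨(full, fill, arr), (Fits.ret (Set.mem_singleton _)).mono le_rfl (by omega) subset_rfl, by simp⟩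
  | some x =>
    simp only [put]
    split_ifs with h
    · exact ⟨_, Fits.write (hA h) (Fits.ret (Set.mem_singleton _)), by dsimp only; rw [Nat.add_mul]; omega⟩
    · refine ⟨_, (Fits.ret (Set.mem_singleton _)).mono le_rfl (by omega) subset_rfl, ?_⟩
      dsimp only
      omega

/-- The number of residual programs of a streaming pass, in terms of the numbers `s` of transducer
states, `X` of contents of a block, `k` of cursors and `T` of steps. -/
def passSize (s X k T : ℕ) : ℕ :=
  20 * (k + 1) * s * (T + 1) ^ (k + 4) * X ^ (3 * k + 2)

/-- Cursor positions and output length are unbounded a priori, but within `T` steps each takes at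
most `T + 1` values. With `k` input buffers and one output buffer this leaves `|σ| * (T + 1) ^ (k +
2) * X ^ (k + 1)` pass states, to which `Fits.loop` applies. -/
theorem pass_fits [Fintype α] [Fintype σ] [Nonempty σ] [Nonempty α] (hB : 0 < B)
    {δ : Rule k α σ} {T base A : ℕ} {pad : α} {s : σ} {pos : Fin k → ℕ}
    (hpos : ∀ i, pos i + T < base * B) (hA : base + T / B + 1 ≤ A) :
    Fits A (passSize (Fintype.card σ) (Fintype.card α ^ B) k T) {r | r.2 ≤ T}
      (pass hB δ T base pad s pos) := by
  classical
  set X := Fintype.card α ^ B with hX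
  have hX1 : 1 ≤ X := Nat.one_le_pow _ _ Fintype.card_pos
  have hs1 : 1 ≤ Fintype.card σ := Fintype.card_pos
  have hbufs : (Finset.univ : Finset (Fin k → Fin B → α)).card ≤ X ^ k := by simp [hX]
  have haddr : ∀ p, p < base * B → p / B ≤ A := by
    intro p hp
    exact ((Nat.div_lt_iff_lt_mul hB).2 hp).le.trans
      ((Nat.le_add_right _ _).trans ((Nat.le_succ _).trans hA))
  have h1 : Fits A (X ^ k * (k * (X + 1) + 1)) Set.univ
      (loadAll (B := B) pos fun _ _ => pad) := by
    refine (Fits.loop (R := fun _ => Set.univ) hbufs (by simp) (N := X + 1) ?_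
      (Set.mem_univ _)).mono le_rfl (by simp) subset_rfl
    intro j _ _ x _
    split_ifs with hj
    · refine (Fits.read (N := 1) (haddr _ ?_) fun r => Fits.ret (Set.mem_univ _)).mono le_rfl
        (by simp [hX]) subset_rfl
      have := hpos ⟨j, hj⟩
      omega
    · exact (Fits.ret (Set.mem_univ _)).mono le_rfl (by omega) subset_rfl
  -- This parametrizes the reachable pass states by a finite type, with cursor positions recorded as
  -- displacements from the start.
  let g : σ × (Fin k → Fin (T + 1)) × (Fin k → Fin B → α) × Fin (T + 1) × Fin (T + 1) × (Fin B → α)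
      → PassState B k α σ := fun x =>
    ⟨x.1, fun i => pos i + x.2.1 i, x.2.2.1, x.2.2.2.1, x.2.2.2.2.1, x.2.2.2.2.2⟩
  let F : Finset (PassState B k α σ) := Finset.univ.image g
  let R : ℕ → Set (PassState B k α σ) := fun t => {S | t ≤ T ∧ (∀ i, pos i ≤ S.pos i ∧
    S.pos i ≤ pos i + t) ∧ S.full * B + S.fill ≤ t}
  have hF : F.card ≤ Fintype.card σ * (T + 1) ^ (k + 2) * X ^ (k + 1) := by
    refine Finset.card_image_le.trans ?_
    simp only [Finset.card_univ, Fintype.card_prod, Fintype.card_fun, Fintype.card_fin, ← hX]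
    exact le_of_eq (by ring)
  have hRF : ∀ t, R t ⊆ ↑F := by
    rintro t S ⟨ht, h2, h3⟩
    simp only [F, Finset.coe_image, Finset.coe_univ, Set.image_univ]
    have hfull : S.full ≤ S.full * B := Nat.le_mul_of_pos_right _ hB
    refine ⟨⟨S.st, fun i => ⟨S.pos i - pos i, ?_⟩, S.buf, ⟨S.full, ?_⟩, ⟨S.fill, ?_⟩, S.arr⟩, ?_⟩
    · have := h2 i; omega
    · omega
    · omega
    · simp only [g]
      have : (fun i => pos i + (S.pos i - pos i)) = S.pos := by
        funext i
        have := h2 i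
        omega
      rw [this]
  have h2 : ∀ j, 0 ≤ j → j < 0 + T → ∀ S ∈ R j,
      Fits A ((X + 1) + X ^ k * (2 + 1 * 1)) (R (j + 1)) (passStep hB δ base S) := by
    rintro j _ hj S ⟨ht, h2, h3⟩
    simp only [passStep]
    generalize δ S.st S.pos (fun i => S.buf i ⟨S.pos i % B, Nat.mod_lt _ hB⟩) = r
    have hr : Fits A (X + 1) Set.univ (refill S.pos S.buf r.2.1) := by
      cases r.2.1 with
      | none => exact (Fits.ret (Set.mem_univ _)).mono le_rfl (by omega) subset_rfl
      | some i =>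
        simp only [refill]
        split_ifs with hc
        · refine (Fits.read (N := 1) (haddr _ ?_) fun r => Fits.ret (Set.mem_univ _)).mono le_rfl
            (by simp [hX]) subset_rfl
          have := hpos i
          have := h2 i
          omega
        · exact (Fits.ret (Set.mem_univ _)).mono le_rfl (by omega) subset_rfl
    refine hr.bind hbufs (by simp) fun buf _ => ?_
    obtain ⟨c, hc1, hc2, hc3, hc4⟩ := put_fits (A := A) (base := base) (full := S.full)
      (fill := S.fill) (arr := S.arr) r.2.2 (fun _ => by
        have h5 : S.full ≤ T / B := (Nat.le_div_iff_mul_le hB).2 (by omega)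
        omega)
    refine hc1.bind (F := {c}) (by simp) (by simp) fun c' hc' => ?_
    obtain rfl : c' = c := hc'
    refine Fits.ret ⟨by omega, ?_, by dsimp only; omega⟩
    intro i
    dsimp only
    have hi := h2 i
    cases r.2.1 with
    | none => simp only [advance]; omega
    | some i' =>
      simp only [advance, Function.update_apply]
      split_ifs with hii
      · subst hii; omega
      · omega
  have h3 : ∀ buf : Fin k → Fin B → α, Fits A _ (R (0 + T)) _ := fun buf =>
    Fits.loop hF hRF h2 (x := ⟨s, pos, buf, 0, 0, fun _ => pad⟩)
      ⟨by omega, fun i => by dsimp only; omega, by simp⟩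
  have h4 : ∀ S ∈ R (0 + T), Fits A 3 {r : σ × ℕ | r.2 ≤ T}
      ((flush base S.full S.fill S.arr pad).bind fun _ => ret (S.st, S.full * B + S.fill)) := by
    rintro S ⟨_, _, h4⟩
    refine Fits.seq (N := 2) (N' := 1) (R := Set.univ) ?_ (Fits.ret ?_)
    · unfold flush
      split_ifs
      · exact (Fits.ret (Set.mem_univ _)).mono le_rfl (by omega) subset_rfl
      · refine Fits.write ?_ (Fits.ret (Set.mem_univ _))
        have h5 : S.full ≤ T / B := (Nat.le_div_iff_mul_le hB).2 (by omega)
        omega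
    · change S.full * B + S.fill ≤ T
      omega
  refine (h1.bind hbufs (by simp) fun buf _ => (h3 buf).bind hF (hRF _) h4).mono le_rfl ?_
    subset_rfl
  have hXk : 1 ≤ X ^ k := Nat.one_le_pow _ _ hX1
  have e1 : X ^ k * (k * (X + 1) + 1) ≤ 3 * ((k + 1) * X ^ (k + 1)) := by
    have : k * (X + 1) + 1 ≤ 2 * ((k + 1) * X) := by nlinarith
    calc X ^ k * (k * (X + 1) + 1) ≤ X ^ k * (2 * ((k + 1) * X)) := Nat.mul_le_mul_left _ this
      _ = 2 * ((k + 1) * X ^ (k + 1)) := by ring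
      _ ≤ _ := by omega
  have e2 : T * (X + 1 + X ^ k * (2 + 1 * 1)) + 1 ≤ 6 * ((T + 1) * X ^ (k + 1)) := by
    have h5 : X ≤ X ^ (k + 1) := Nat.le_self_pow (by omega) X
    have h6 : X ^ k ≤ X ^ (k + 1) := Nat.pow_le_pow_right hX1 (by omega)
    have h7 : 1 ≤ X ^ (k + 1) := Nat.one_le_pow _ _ hX1
    nlinarith
  set Z := Fintype.card σ * (T + 1) ^ (k + 2) * X ^ (k + 1) with hZ
  have e3 : Z * (T * (X + 1 + X ^ k * (2 + 1 * 1)) + 1) + Z * 3 ≤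
      9 * (Fintype.card σ * (T + 1) ^ (k + 3) * X ^ (2 * k + 2)) := by
    have h7 : 1 ≤ (T + 1) * X ^ (k + 1) := Nat.mul_pos (by omega) (Nat.one_le_pow _ _ hX1)
    calc Z * (T * (X + 1 + X ^ k * (2 + 1 * 1)) + 1) + Z * 3
        ≤ Z * (6 * ((T + 1) * X ^ (k + 1))) + Z * (3 * ((T + 1) * X ^ (k + 1))) :=
          Nat.add_le_add (Nat.mul_le_mul_left _ e2) (Nat.mul_le_mul_left _ (by omega))
      _ = _ := by rw [hZ]; ring
  calc X ^ k * (k * (X + 1) + 1) + X ^ k * (Z * (T * (X + 1 + X ^ k * (2 + 1 * 1)) + 1) + Z * 3)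
      ≤ 3 * ((k + 1) * X ^ (k + 1)) +
        X ^ k * (9 * (Fintype.card σ * (T + 1) ^ (k + 3) * X ^ (2 * k + 2))) :=
        Nat.add_le_add e1 (Nat.mul_le_mul_left _ e3)
    _ ≤ 3 * ((k + 1) * Fintype.card σ * (T + 1) ^ (k + 4) * X ^ (3 * k + 2)) +
        9 * ((k + 1) * Fintype.card σ * (T + 1) ^ (k + 4) * X ^ (3 * k + 2)) := by
        have hT : 1 ≤ (T + 1) ^ (k + 4) := Nat.one_le_pow _ _ (by omega)
        have hT' : (T + 1) ^ (k + 3) ≤ (T + 1) ^ (k + 4) := Nat.pow_le_pow_right (by omega) (by omega)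
        have hX' : X ^ (k + 1) ≤ X ^ (3 * k + 2) := Nat.pow_le_pow_right hX1 (by omega)
        refine Nat.add_le_add (Nat.mul_le_mul_left _ ?_) ?_
        · calc (k + 1) * X ^ (k + 1) = (k + 1) * 1 * 1 * X ^ (k + 1) := by ring
            _ ≤ _ := by gcongr
        · calc X ^ k * (9 * (Fintype.card σ * (T + 1) ^ (k + 3) * X ^ (2 * k + 2)))
              = 9 * (1 * Fintype.card σ * (T + 1) ^ (k + 3) * X ^ (3 * k + 2)) := by ring
            _ ≤ _ := by gcongr; omega
    _ ≤ _ := by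
        rw [passSize]
        have : 0 ≤ (k + 1) * Fintype.card σ * (T + 1) ^ (k + 4) * X ^ (3 * k + 2) := Nat.zero_le _
        nlinarith

end Prog

/-! ### External merge sort -/

namespace Prog

variable {B k : ℕ} {α σ : Type}

/-- The list of the words at positions `p`, …, `p + l - 1` of the external memory `D`. -/
def window (D : ℕ → α) (p l : ℕ) : List α := (List.range l).map fun i => D (p + i)

@[simp]
theorem length_window (D : ℕ → α) (p l : ℕ) : (window D p l).length = l := by simp [window]

@[simp]
theorem getElem_window (D : ℕ → α) (p l i : ℕ) (h : i < (window D p l).length) :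
    (window D p l)[i] = D (p + i) := by simp [window]

@[simp]
theorem window_zero (D : ℕ → α) (p : ℕ) : window D p 0 = [] := rfl

theorem window_succ (D : ℕ → α) (p l : ℕ) : window D p (l + 1) = D p :: window D (p + 1) l := by
  refine List.ext_getElem (by simp) fun i h _ => ?_
  cases i with
  | zero => simp
  | succ i => simp [Nat.add_assoc, Nat.add_comm 1]

theorem window_add (D : ℕ → α) (p l l' : ℕ) :
    window D p (l + l') = window D p l ++ window D (p + l) l' := by
  induction l generalizing p with
  | zero => simp
  | succ l ih =>
    rw [Nat.add_right_comm, window_succ, window_succ, ih, List.cons_append, Nat.add_assoc,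
      Nat.add_comm 1]

theorem window_congr {D D' : ℕ → α} {p p' l : ℕ} (h : ∀ i, i < l → D (p + i) = D' (p' + i)) :
    window D p l = window D' p' l :=
  List.map_congr_left fun i hi => h i (List.mem_range.1 hi)

theorem window_overwrite (D : ℕ → α) (p : ℕ) (o : List α) :
    window (overwrite D p o) p o.length = o := by
  refine List.ext_getElem (by simp) fun i h h' => ?_
  simp [overwrite, h']

theorem overwrite_of_outside {D : ℕ → α} {p q : ℕ} {o : List α} (h : q < p ∨ p + o.length ≤ q) :
    overwrite D p o q = D q := by
  rw [overwrite]
  split_ifs with hq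
  · rw [List.getD_eq_default _ _ (by omega)]
  · rfl

theorem padded_of_dvd {o : List α} {pad : α} (h : B ∣ o.length) :
    padded B o pad = o := by
  simp [padded, Nat.mod_eq_zero_of_dvd h]

/-- Copy the blocks `src`, …, `src + len - 1` to the blocks `dst`, …, `dst + len - 1`. -/
def copyBlocks (src dst len : ℕ) : Prog B α Unit :=
  loop (fun i _ => read (src + i) fun x => write (dst + i) x (ret ())) 0 len ()

/-- The target ends before the source begins, so no block is overwritten before it is read. -/
theorem copyBlocks_evals {src dst len : ℕ} (h : dst + len ≤ src) (D : ℕ → α) :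
    ∃ E, (copyBlocks (B := B) src dst len).Evals D () E (2 * len) ∧
      window E (dst * B) (len * B) = window D (src * B) (len * B) ∧
      ∀ q, (q < dst * B ∨ (dst + len) * B ≤ q) → E q = D q := by
  obtain ⟨⟨⟩, E, t, h1, h2, h3, rfl⟩ := Evals.loop (n := len) (x := ()) (D := D)
    (body := fun i _ => read (src + i) fun x : Fin B → α => write (dst + i) x (ret ()))
    (fun i _ E c => (∀ q, dst * B ≤ q → q < (dst + i) * B → E q = D (src * B + (q - dst * B))) ∧
      (∀ q, (q < dst * B ∨ (dst + i) * B ≤ q) → E q = D q) ∧ c = 2 * i)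
    (by
      rintro i ⟨⟩ E c hi ⟨h1, h2, rfl⟩
      refine ⟨(), _, 2, Evals.read (Evals.write Evals.ret), ?_, ?_, by omega⟩
      · intro q hq hq'
        have e1 : (dst + (i + 1)) * B = (dst + i) * B + B := by ring
        have e2 : (dst + i) * B = dst * B + i * B := Nat.add_mul _ _ _
        have e3 : (src + i) * B = src * B + i * B := Nat.add_mul _ _ _
        have e4 : (dst + len) * B ≤ src * B := Nat.mul_le_mul_right _ h
        have e5 : (i + 1) * B ≤ len * B := Nat.mul_le_mul_right _ hi
        rw [Nat.add_mul] at e4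
        rw [Nat.add_mul, Nat.one_mul] at e5
        rw [setBlock]
        split_ifs with hc
        · rw [block, h2 _ (Or.inr (by dsimp only; omega))]
          congr 1
          dsimp only
          omega
        · exact h1 q hq (by omega)
      · intro q hq
        have e1 : (dst + (i + 1)) * B = (dst + i) * B + B := by ring
        have e2 : (dst + i) * B = dst * B + i * B := Nat.add_mul _ _ _
        rw [setBlock, dif_neg (by omega)]
        exact h2 q (by omega))
    ⟨fun q h h' => by rw [Nat.add_zero] at h'; omega, fun q _ => rfl, rfl⟩
  refine ⟨E, h1, window_congr fun i hi => ?_, h3⟩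
  rw [h2 _ (by omega) (by rw [Nat.add_mul]; omega)]
  congr 1
  omega

theorem window_block (D : ℕ → α) (a : ℕ) : window D (a * B) B = List.ofFn (block B D a) := by
  refine List.ext_getElem (by simp) fun i h h' => ?_
  simp [block]

theorem window_setBlock (D : ℕ → α) (a : ℕ) (x : Fin B → α) :
    window (setBlock D a x) (a * B) B = List.ofFn x := by
  refine List.ext_getElem (by simp) fun i h h' => ?_
  have hi : i < B := by simpa using h
  simp [setBlock, hi]

theorem sum_windows {D : ℕ → α} (p s len q : ℕ) (hq : ∀ i, i < q → i * s ≤ len) :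
    ∑ i ∈ Finset.range q, (window D (p + i * s * B) (min s (len - i * s) * B) : Multiset α) =
      window D p (min (q * s) len * B) := by
  induction q with
  | zero => simp
  | succ q ih =>
    have h1 := hq q (by omega)
    rw [Finset.sum_range_succ, ih fun i hi => hq i (by omega), Multiset.coe_add]
    have h2 : (q + 1) * s = q * s + s := by ring
    have h3 : min ((q + 1) * s) len * B = min (q * s) len * B + min s (len - q * s) * B := by
      rw [← Nat.add_mul, h2]
      congr 1
      omega
    rw [h3, window_add, Nat.min_eq_left h1]

theorem div_bounds {len s i : ℕ} (hs : 0 < s) :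
    (i < (len + s - 1) / s → i * s < len) ∧ len ≤ (len + s - 1) / s * s := by
  constructor
  · intro h
    have := (Nat.le_div_iff_mul_le hs).1 h
    rw [Nat.succ_mul] at this
    omega
  · have := Nat.lt_mul_div_succ (len + s - 1) hs
    rw [Nat.mul_add, Nat.mul_one, Nat.mul_comm] at this
    omega

/-- The number of residual programs of a merge step, in terms of the number `X` of contents of a
block, the number `k` of runs and the number `T` of words. -/
def mergeSize (X k T : ℕ) : ℕ := passSize 1 X k T + (T + 1) * (2 * X + 2) + 1

theorem copyBlocks_fits [Fintype α] [Nonempty α] {A src dst len : ℕ} (h1 : src + len ≤ A)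
    (h2 : dst + len ≤ A) (hlen : 1 ≤ len) :
    Fits A (len * (2 * Fintype.card α ^ B + 2)) Set.univ
      (copyBlocks (B := B) (α := α) src dst len) := by
  refine (Fits.loop_unit (N := fun _ => Fintype.card α ^ B * 2 + 1) fun j _ hj => ?_).mono le_rfl
    ?_ subset_rfl
  · exact Fits.read (by omega) fun r => Fits.write (by omega) (Fits.ret (Set.mem_univ _))
  · simp only [Finset.sum_const, Finset.card_range, smul_eq_mul]
    nlinarith

theorem passSize_mono {s X k T k' T' : ℕ} (hX : 0 < X) (hk : k ≤ k') (hT : T ≤ T') :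
    passSize s X k T ≤ passSize s X k' T' := by
  unfold passSize
  have h1 : X ^ (3 * k + 2) ≤ X ^ (3 * k' + 2) := Nat.pow_le_pow_right hX (by omega)
  have h2 : (T + 1) ^ (k + 4) ≤ (T' + 1) ^ (k' + 4) :=
    (Nat.pow_le_pow_left (by omega) _).trans (Nat.pow_le_pow_right (by omega) (by omega))
  gcongr

theorem sum_min_pieces (s len q : ℕ) (hq : ∀ i, i < q → i * s ≤ len) :
    ∑ i ∈ Finset.range q, min s (len - i * s) = min (q * s) len := by
  induction q with
  | zero => simp
  | succ q ih =>
    have h1 := hq q (by omega)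
    rw [Finset.sum_range_succ, ih fun i hi => hq i (by omega), Nat.succ_mul]
    omega

variable [LinearOrder α]

/-- The rule that merges sorted runs: move the cursor on the least word, and output this word. The
run of cursor `i` ends at position `ends i`. -/
noncomputable def mergeRule (ends : Fin k → ℕ) : Rule k α Unit := fun _ pos head =>
  open Classical in
  if h : ∃ i, pos i < ends i ∧ ∀ j, pos j < ends j → head i ≤ head j then
    ((), some h.choose, some (head h.choose))
  else ((), none, none)

/-- Induction on the number of words left. Since the runs are sorted, the least head is the least of
all remaining words, and it may precede the merge of the rest. The equality of multisets serves both
as the permutation statement and to locate a later output word in its run. -/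
theorem merge_trace {D : ℕ → α} {ends : Fin k → ℕ} {T : ℕ} {pos : Fin k → ℕ}
    (hT : T = ∑ i, (ends i - pos i))
    (hs : ∀ i, (window D (pos i) (ends i - pos i)).Pairwise (· ≤ ·)) :
    ∃ o pos', Trace (mergeRule ends) D T () pos o () pos' ∧ o.Pairwise (· ≤ ·) ∧
      (o : Multiset α) = ∑ i, (window D (pos i) (ends i - pos i) : Multiset α) := by
  classical
  induction T generalizing pos with
  | zero =>
    refine ⟨[], pos, Trace.zero _ _, List.Pairwise.nil, ?_⟩
    symm
    refine Finset.sum_eq_zero fun i _ => ?_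
    have : ends i - pos i = 0 := (Finset.sum_eq_zero_iff.1 hT.symm) i (Finset.mem_univ i)
    rw [this]
    rfl
  | succ T ih =>
    obtain ⟨i₀, hi₀⟩ : ∃ i, pos i < ends i := by
      by_contra! h
      have : ∑ i, (ends i - pos i) = 0 := Finset.sum_eq_zero fun i _ => by have := h i; omega
      omega
    have hex : ∃ i, pos i < ends i ∧ ∀ j, pos j < ends j → D (pos i) ≤ D (pos j) := by
      obtain ⟨i, hi, hmin⟩ := Finset.exists_min_image
        (Finset.univ.filter fun i => pos i < ends i) (fun i => D (pos i)) ⟨i₀, by simpa using hi₀⟩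
      exact ⟨i, by simpa using hi, fun j hj => hmin j (by simpa using hj)⟩
    obtain ⟨i, hrule, hi, hmin⟩ : ∃ i, mergeRule ends () pos (fun i => D (pos i)) =
        ((), some i, some (D (pos i))) ∧ pos i < ends i ∧
        ∀ j, pos j < ends j → D (pos i) ≤ D (pos j) :=
      ⟨hex.choose, by rw [mergeRule, dif_pos hex], hex.choose_spec⟩
    have hsplit : window D (pos i) (ends i - pos i) =
        D (pos i) :: window D (pos i + 1) (ends i - (pos i + 1)) := by
      rw [← window_succ]
      congr 1
      omega
    set pos₁ := Function.update pos i (pos i + 1) with hpos₁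
    have hself : pos₁ i = pos i + 1 := by simp [hpos₁]
    have hne : ∀ j, j ≠ i → pos₁ j = pos j := fun j hj => by simp [hpos₁, hj]
    have hT₁ : T = ∑ j, (ends j - pos₁ j) := by
      rw [← Finset.add_sum_erase _ _ (Finset.mem_univ i)] at hT ⊢
      have : ∑ x ∈ Finset.univ.erase i, (ends x - pos₁ x) =
          ∑ x ∈ Finset.univ.erase i, (ends x - pos x) :=
        Finset.sum_congr rfl fun x hx => by rw [hne x (Finset.ne_of_mem_erase hx)]
      rw [this, hself]
      omega
    have hs₁ : ∀ j, (window D (pos₁ j) (ends j - pos₁ j)).Pairwise (· ≤ ·) := by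
      intro j
      by_cases hj : j = i
      · subst hj
        have := hs j
        rw [hsplit] at this
        rw [hself]
        exact this.of_cons
      · rw [hne j hj]
        exact hs j
    obtain ⟨o, pos', h1, h2, h3⟩ := ih hT₁ hs₁
    have hsum : ∑ j, (window D (pos j) (ends j - pos j) : Multiset α) =
        D (pos i) ::ₘ ∑ j, (window D (pos₁ j) (ends j - pos₁ j) : Multiset α) := by
      rw [← Finset.add_sum_erase _ _ (Finset.mem_univ i),
        ← Finset.add_sum_erase _ _ (Finset.mem_univ i), hself, hsplit]
      have : ∑ x ∈ Finset.univ.erase i, (window D (pos₁ x) (ends x - pos₁ x) : Multiset α) =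
          ∑ x ∈ Finset.univ.erase i, (window D (pos x) (ends x - pos x) : Multiset α) :=
        Finset.sum_congr rfl fun x hx => by rw [hne x (Finset.ne_of_mem_erase hx)]
      rw [this, ← Multiset.cons_coe, Multiset.cons_add]
    refine ⟨D (pos i) :: o, pos', Trace.step hrule h1, ?_, ?_⟩
    · refine List.pairwise_cons.2 ⟨fun y hy => ?_, h2⟩
      have hy' : y ∈ ∑ j, (window D (pos j) (ends j - pos j) : Multiset α) := by
        rw [hsum, ← h3]
        exact Multiset.mem_cons_of_mem hy
      obtain ⟨j, -, hj⟩ := Multiset.mem_sum.1 hy'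
      have hj' : y ∈ window D (pos j) (ends j - pos j) := hj
      have hlt : pos j < ends j := by
        by_contra hlt
        rw [show ends j - pos j = 0 by omega] at hj'
        simp at hj'
      have hsj := hs j
      rw [show ends j - pos j = ends j - (pos j + 1) + 1 by omega, window_succ] at hsj hj'
      rcases List.mem_cons.1 hj' with rfl | hj'
      · exact hmin j hlt
      · exact (hmin j hlt).trans ((List.pairwise_cons.1 hsj).1 y hj')
    · rw [hsum, ← h3]
      rfl

/-- Sort each of the blocks `a`, …, `a + len - 1`. -/
def sortBlocks (a len : ℕ) : Prog B α Unit :=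
  loop (fun i _ => read (a + i) fun x => write (a + i) (x ∘ Tuple.sort x) (ret ())) 0 len ()

/-- Sort the blocks `a + lo`, …, `a + lo + len - 1`, where `len ≤ k ^ L`, by `k`-way merging, using
the blocks `x + lo`, …, `x + lo + len - 1` as scratch space. -/
noncomputable def mergeSort (hB : 0 < B) (k : ℕ) (pad : α) (a x : ℕ) :
    ℕ → ℕ → ℕ → Prog B α Unit
  | 0, lo, len => sortBlocks (a + lo) len
  | L + 1, lo, len =>
    (loop (fun i _ => mergeSort hB k pad a x L (lo + i * k ^ L) (min (k ^ L) (len - i * k ^ L))) 0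
      ((len + k ^ L - 1) / k ^ L) ()).bind fun _ =>
    (pass hB (mergeRule fun i : Fin ((len + k ^ L - 1) / k ^ L) =>
        (a + lo + min ((i + 1) * k ^ L) len) * B) (len * B) (x + lo) pad ()
      fun i => (a + lo + i * k ^ L) * B).bind fun _ =>
    copyBlocks (x + lo) (a + lo) len

/-- `E` arises from `D` by sorting the words at positions `p`, …, `p + l - 1`, up to the contents of
the positions `p'`, …, `p' + l - 1`. -/
structure SortedFrom (D E : ℕ → α) (p p' l : ℕ) : Prop where
  sorted : (window E p l).Pairwise (· ≤ ·)
  perm : (window E p l).Perm (window D p l)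
  frame : ∀ q, (q < p ∨ p + l ≤ q) → (q < p' ∨ p' + l ≤ q) → E q = D q

theorem sortBlocks_evals {a len : ℕ} (hlen : len ≤ 1) (p' : ℕ) (D : ℕ → α) :
    ∃ E t, (sortBlocks (B := B) a len).Evals D () E t ∧ t ≤ 2 * len ∧
      SortedFrom D E (a * B) p' (len * B) := by
  interval_cases len
  · exact ⟨D, 0, Evals.ret, by omega, ⟨by simp, by simp, fun _ _ _ => rfl⟩⟩
  · refine ⟨_, 2, Evals.read (Evals.write Evals.ret), by omega, ?_, ?_, ?_⟩
    · rw [Nat.add_zero, Nat.one_mul, window_setBlock]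
      exact List.pairwise_ofFn.2 fun i j hij => Tuple.monotone_sort _ hij.le
    · rw [Nat.add_zero, Nat.one_mul, window_setBlock, window_block]
      exact Equiv.Perm.ofFn_comp_perm _ _
    · intro q hq _
      rw [Nat.add_zero, setBlock, dif_neg (by omega)]

/-- Sorting single blocks costs `2 * len`. A level of merging costs at most `5 * len` for the pass,
because the number of runs is at most `len`, and `2 * len` for copying back; this is the `7`. -/
theorem mergeSort_evals (hB : 0 < B) (pad : α) {k a x : ℕ} (hk : 0 < k) (L : ℕ) {lo len : ℕ}
    (hlen : 1 ≤ len) (hL : len ≤ k ^ L) (hx : a + 2 * len < x) (D : ℕ → α) :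
    ∃ E t, (mergeSort hB k pad a x L lo len).Evals D () E t ∧ t ≤ 2 * len + 7 * (len * L) ∧
      SortedFrom D E ((a + lo) * B) ((x + lo) * B) (len * B) := by
  induction L generalizing lo len D with
  | zero =>
    obtain ⟨E, t, h1, h2, h3⟩ := sortBlocks_evals (a := a + lo) (len := len) (by simpa using hL)
      ((x + lo) * B) D
    exact ⟨E, t, h1, by omega, h3⟩
  | succ L ih =>
    have hs : 0 < k ^ L := Nat.pow_pos hk
    simp only [mergeSort]
    set s := k ^ L with hs_def
    set q := (len + s - 1) / s with hq
    have hqs : len ≤ q * s := (div_bounds (i := 0) hs).2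
    have hqi : ∀ i, i < q → i * s < len := fun i => (div_bounds hs).1
    have hqlen : q ≤ len := by
      by_contra h
      have := hqi len (by omega)
      nlinarith
    -- For the purpose of `pass_evals` every cursor might move by all `len * B` steps. This is why
    -- the scratch space has to lie more than `2 * len` blocks behind `a`.
    have hp0 : (a + lo + len) * B + len * B < (x + lo) * B := by
      have : (a + lo + 2 * len) * B < (x + lo) * B := Nat.mul_lt_mul_of_pos_right (by omega) hB
      calc _ = (a + lo + 2 * len) * B := by ring
        _ < _ := this
    have ep : ∀ i, (a + lo + i) * B = (a + lo) * B + i * B := fun i => Nat.add_mul _ _ _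
    have hlenB := ep len
    -- After `i` runs, `min (i * s) len` blocks are done; the minimum takes care of a shorter last
    -- run. The scratch space is exempt from the frame condition, since the recursive calls use it.
    obtain ⟨⟨⟩, E₁, t₁, e1, e2, e3, e4, e5⟩ := Evals.loop (n := q) (x := ()) (D := D)
      (body := fun i _ => mergeSort hB k pad a x L (lo + i * s) (min s (len - i * s)))
      (fun i _ E c => (∀ j, j < i →
          (window E ((a + lo) * B + j * s * B) (min s (len - j * s) * B)).Pairwise (· ≤ ·)) ∧
        (window E ((a + lo) * B) (min (i * s) len * B)).Perm
          (window D ((a + lo) * B) (min (i * s) len * B)) ∧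
        (∀ p, (p < (a + lo) * B ∨ (a + lo + min (i * s) len) * B ≤ p) →
          (p < (x + lo) * B ∨ (x + lo) * B + len * B ≤ p) → E p = D p) ∧
        c ≤ 2 * min (i * s) len + 7 * (min (i * s) len * L))
      (by
        rintro i ⟨⟩ E c hi ⟨h1, h2, h3, h4⟩
        have hi' := hqi i hi
        set l := min s (len - i * s) with hl
        obtain ⟨E', t, f1, f2, f3⟩ := ih (lo := lo + i * s) (len := l) (by omega) (by omega)
          (by omega) E
        have hmin : min ((i + 1) * s) len = min (i * s) len + l := by
          rw [Nat.succ_mul]; omega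
        have hmin0 : min (i * s) len = i * s := by omega
        have hlB : min (i * s) len * B + l * B ≤ len * B := by
          rw [← Nat.add_mul]
          exact Nat.mul_le_mul_right _ (by omega)
        have e0 : (a + (lo + i * s)) * B = (a + lo) * B + i * s * B := by ring
        have e0' : (x + (lo + i * s)) * B = (x + lo) * B + i * s * B := by ring
        rw [e0, e0'] at f3
        rw [hmin0] at hlB h2 h3 h4 hmin
        have e9 : (i * s + l) * B = i * s * B + l * B := Nat.add_mul _ _ _
        have hlow : ∀ p, p < (a + lo) * B + i * s * B → E' p = E p := fun p hp =>
          f3.frame p (by omega) (by omega)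
        refine ⟨(), E', t, f1, ?_, ?_, ?_, ?_⟩
        · intro j hj
          by_cases hji : j = i
          · subst hji
            exact f3.sorted
          · have hjs : (j + 1) * s ≤ i * s := Nat.mul_le_mul_right _ (by omega)
            have hjB : (j + 1) * s * B ≤ i * s * B := Nat.mul_le_mul_right _ hjs
            have hm : min s (len - j * s) * B ≤ s * B := Nat.mul_le_mul_right _ (by omega)
            have e6 : (j + 1) * s * B = j * s * B + s * B := by ring
            rw [window_congr (D' := E) (p' := (a + lo) * B + j * s * B)
              fun r hr => hlow _ (by omega)]
            exact h1 j (by omega)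
        · rw [hmin, e9, window_add, window_add]
          refine List.Perm.append ?_ ?_
          · rw [window_congr (D' := E) (p' := (a + lo) * B) fun r hr => hlow _ (by omega)]
            exact h2
          · refine f3.perm.trans (List.Perm.of_eq ?_)
            refine window_congr fun r hr => h3 _ (Or.inr ?_) (Or.inl ?_)
            · rw [ep]; omega
            · omega
        · intro p hp hp'
          rw [hmin, ep, e9] at hp
          have hx' : p < (x + lo) * B + i * s * B ∨ (x + lo) * B + i * s * B + l * B ≤ p := by
            omega
          rw [f3.frame p (by omega) hx']
          exact h3 p (by rw [ep]; omega) hp'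
        · rw [hmin, Nat.add_mul]
          omega)
      ⟨fun j hj => absurd hj (by omega), by simp, fun _ _ _ => rfl, by simp⟩
    rw [Nat.min_eq_right hqs] at e3 e4 e5
    set ends : Fin q → ℕ := fun i => (a + lo + min ((i + 1) * s) len) * B with hends
    set pos : Fin q → ℕ := fun i => (a + lo + i * s) * B with hpos
    have hsub : ∀ i : Fin q, ends i - pos i = min s (len - i * s) * B := by
      intro i
      have := hqi i i.2
      simp only [hends, hpos]
      rw [← Nat.sub_mul]
      congr 1
      rw [Nat.succ_mul]
      omega
    have hposi : ∀ i : Fin q, pos i = (a + lo) * B + i * s * B := fun i => ep _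
    have hms : ∑ i, (window E₁ (pos i) (ends i - pos i) : Multiset α) =
        window E₁ ((a + lo) * B) (len * B) := by
      have : ∀ i : Fin q, (window E₁ (pos i) (ends i - pos i) : Multiset α) =
          window E₁ ((a + lo) * B + i * s * B) (min s (len - i * s) * B) := fun i => by
        rw [hsub, hposi]
      rw [Finset.sum_congr rfl fun i _ => this i, Fin.sum_univ_eq_sum_range (fun i => (window E₁ ((a + lo) * B + i * s * B)
        (min s (len - i * s) * B) : Multiset α)) q,
        sum_windows _ _ _ _ fun i hi => (hqi i hi).le, Nat.min_eq_right hqs]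
    have hT : len * B = ∑ i, (ends i - pos i) := by
      have := congrArg Multiset.card hms
      rw [Multiset.card_sum] at this
      simpa using this.symm
    obtain ⟨o, pos', m1, m2, m3⟩ := merge_trace hT (D := E₁) fun i => by
      rw [hsub, hposi]
      exact e2 i i.2
    rw [hms] at m3
    have hperm : o.Perm (window E₁ ((a + lo) * B) (len * B)) := Multiset.coe_eq_coe.1 m3
    have hol : o.length = len * B := by simpa using hperm.length_eq
    obtain ⟨t₂, g1, g2⟩ := pass_evals hB (base := x + lo) pad m1 (fun i => by
      have := hqi i i.2
      have h7 : i * s * B ≤ len * B := Nat.mul_le_mul_right _ this.le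
      rw [hposi]
      omega)
    rw [padded_of_dvd (hol ▸ Dvd.intro_left _ rfl)] at g1
    obtain ⟨E₃, c1, c2, c3⟩ := copyBlocks_evals (B := B) (src := x + lo) (dst := a + lo)
      (len := len) (by omega) (overwrite E₁ ((x + lo) * B) o)
    have hwin : window E₃ ((a + lo) * B) (len * B) = o := by
      rw [c2, ← hol, window_overwrite]
    refine ⟨E₃, t₁ + (t₂ + 2 * len), e1.bind (g1.bind c1), ?_, ⟨?_, ?_, ?_⟩⟩
    · have h8 : t₂ ≤ 2 * len + 2 * q + 1 := by
        refine Nat.le_of_mul_le_mul_left (c := B) ?_ hB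
        calc B * t₂ ≤ _ := g2
          _ = _ := by ring
      rw [Nat.mul_add]
      omega
    · rw [hwin]
      exact m2
    · rw [hwin]
      exact hperm.trans e3
    · intro p hp hp'
      rw [c3 p (by rw [ep]; omega), overwrite_of_outside (by omega)]
      exact e4 p (by rw [ep]; omega) hp'

theorem sortBlocks_fits [Fintype α] [Nonempty α] {A a len : ℕ} (h : a + len ≤ A)
    (hlen : 1 ≤ len) :
    Fits A (len * (2 * Fintype.card α ^ B + 2)) Set.univ
      (sortBlocks (B := B) (α := α) a len) := by
  refine (Fits.loop_unit (N := fun _ => Fintype.card α ^ B * 2 + 1) fun j _ hj => ?_).mono le_rfl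
    ?_ subset_rfl
  · exact Fits.read (by omega) fun r => Fits.write (by omega) (Fits.ret (Set.mem_univ _))
  · simp only [Finset.sum_const, Finset.card_range, smul_eq_mul]
    nlinarith

/-- The pieces partition the `len` blocks, so the bounds of the recursive calls sum up to the bound
for the lower levels, and the merge on top fits into one further summand `len * W`. -/
theorem mergeSort_fits [Fintype α] [Nonempty α] (hB : 0 < B) (pad : α) {k a x A T₀ : ℕ}
    (hk : 0 < k) (L : ℕ) {lo len : ℕ}
    (hlen : 1 ≤ len) (hL : len ≤ k ^ L) (hx : a + 2 * len < x) (hA : x + lo + len + 1 ≤ A)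
    (hT : len * B ≤ T₀) :
    Fits A ((L + 1) * len * mergeSize (Fintype.card α ^ B) k T₀) Set.univ
      (mergeSort hB k pad a x L lo len) := by
  set X := Fintype.card α ^ B with hX
  have hX1 : 1 ≤ X := Nat.one_le_pow _ _ Fintype.card_pos
  set W := mergeSize X k T₀ with hW
  have hW' : passSize 1 X k T₀ + (T₀ + 1) * (2 * X + 2) + 1 = W := rfl
  induction L generalizing lo len with
  | zero =>
    refine (sortBlocks_fits (by omega) hlen).mono le_rfl ?_ subset_rfl
    rw [Nat.zero_add, Nat.one_mul, ← hX]
    refine Nat.mul_le_mul_left _ ?_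
    nlinarith
  | succ L ih =>
    have hs : 0 < k ^ L := Nat.pow_pos hk
    simp only [mergeSort]
    set s := k ^ L with hs_def
    set q := (len + s - 1) / s with hq
    have hqs : len ≤ q * s := (div_bounds (i := 0) hs).2
    have hqi : ∀ i, i < q → i * s < len := fun i => (div_bounds hs).1
    -- The size of a pass is exponential in its number of cursors, so the number of runs must not
    -- exceed `k`.
    have hqk : q ≤ k := by
      by_contra h
      have h1 := hqi k (by omega)
      rw [pow_succ, ← hs_def, Nat.mul_comm] at hL
      omega
    have h1 : Fits A (((L + 1) * len * W) + 1) Set.univ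
        (loop (fun i _ => mergeSort hB k pad a x L (lo + i * s) (min s (len - i * s))) 0 q ()) := by
      refine (Fits.loop_unit (N := fun i => (L + 1) * min s (len - i * s) * W)
        fun j _ hj => ?_).mono le_rfl ?_ subset_rfl
      · have hj' := hqi j (by omega)
        refine ih (by omega) (by omega) (by omega) (by omega) ?_
        exact (Nat.mul_le_mul_right _ (by omega)).trans hT
      · simp only [Nat.zero_add]
        rw [← Finset.sum_mul, ← Finset.mul_sum, sum_min_pieces _ _ _ fun i hi => (hqi i hi).le,
          Nat.min_eq_right hqs]
    have hdiv : len * B / B = len := Nat.mul_div_cancel _ hB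
    have h2 : Fits A (passSize 1 X k T₀) {r : Unit × ℕ | r.2 ≤ T₀}
        (pass hB (mergeRule fun i : Fin q => (a + lo + min ((i + 1) * s) len) * B) (len * B)
          (x + lo) pad () fun i => (a + lo + i * s) * B) := by
      refine (pass_fits hB ?_ (by omega)).mono le_rfl ?_ fun r hr => le_trans hr hT
      · intro i
        have hi := hqi i i.2
        rw [← Nat.add_mul]
        exact Nat.mul_lt_mul_of_pos_right (by omega) hB
      · simpa using passSize_mono hX1 hqk hT
    have h3 : ∀ r ∈ {r : Unit × ℕ | r.2 ≤ T₀}, Fits A (len * (2 * X + 2)) Set.univ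
        ((fun _ : Unit × ℕ => copyBlocks (B := B) (α := α) (x + lo) (a + lo) len) r) := fun r _ =>
      copyBlocks_fits (by omega) (by omega) hlen
    -- The pass returns the length of its output. Copying ignores it but is counted once for each
    -- possible length, whence the factor `T + 1` in `mergeSize`.
    have hF : (Finset.univ ×ˢ Finset.range (T₀ + 1) : Finset (Unit × ℕ)).card ≤ T₀ + 1 := by simp
    refine (h1.seq (h2.bind hF ?_ h3)).mono le_rfl ?_ subset_rfl
    · rintro ⟨⟨⟩, r⟩ hr
      have hr' : r ≤ T₀ := hr
      simp only [Finset.coe_product, Finset.coe_univ, Finset.coe_range, Set.mem_prod,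
        Set.mem_univ, Set.mem_Iio, true_and]
      omega
    · have e : (L + 1 + 1) * len * W = (L + 1) * len * W + len * W := by ring
      have e' : len * W = len * passSize 1 X k T₀ + len * ((T₀ + 1) * (2 * X + 2)) + len := by
        rw [← hW']; ring
      rw [e, e']
      have h4 : passSize 1 X k T₀ ≤ len * passSize 1 X k T₀ := Nat.le_mul_of_pos_left _ hlen
      have h5 : (T₀ + 1) * (len * (2 * X + 2)) = len * ((T₀ + 1) * (2 * X + 2)) := by ring
      omega

end Prog

/-! ### Vicinal preorder -/

section Vicinal

variable {V : Type*} {G : SimpleGraph V}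

/-- Every neighbor of `u` other than `v` is a neighbor of `v`. -/
def Nested (G : SimpleGraph V) (u v : V) : Prop := ∀ x, G.Adj u x → x ≠ v → G.Adj v x

/-- Only `x = v` needs care: the edge `uv` yields `uw` by the second hypothesis, and this yields
`vw` by the first. -/
theorem Nested.trans {u v w : V} (h : Nested G u v) (h' : Nested G v w) (huw : u ≠ w)
    (hvw : v ≠ w) : Nested G u w := by
  intro x hx hxw
  by_cases hxv : x = v
  · subst hxv
    exact (h w (h' u hx.symm huw).symm hvw.symm).symm
  · exact h' x (h x hx hxv) hxw

theorem pairwise_nested_of_isChain {l : List V} (h : l.IsChain (Nested G)) (hl : l.Nodup) :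
    l.Pairwise (Nested G) := by
  -- Transitivity needs distinct vertices. Adjoining equality makes the relation transitive, and
  -- `hl` removes equality again at the end.
  have : IsTrans V fun u v => u = v ∨ Nested G u v := ⟨by
    rintro u v w (rfl | h1) (rfl | h2)
    · exact Or.inl rfl
    · exact Or.inr h2
    · exact Or.inr h1
    · by_cases huw : u = w
      · exact Or.inl huw
      · by_cases hvw : v = w
        · exact Or.inr (hvw ▸ h1)
        · exact Or.inr (h1.trans h2 huw hvw)⟩
  have h1 : l.IsChain fun u v => u = v ∨ Nested G u v := h.imp fun u v h => Or.inr h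
  refine ((List.isChain_iff_pairwise.1 h1).and hl).imp ?_
  rintro u v ⟨h, hne⟩
  exact h.resolve_left hne

/-- An alternating 4-cycle: `u x` and `v y` are edges, `v x` and `u y` are not. -/
structure IsAlternating (G : SimpleGraph V) (u v x y : V) : Prop where
  ux : G.Adj u x
  vy : G.Adj v y
  vx : ¬ G.Adj v x
  uy : ¬ G.Adj u y
  xv : x ≠ v
  yu : y ≠ u

/-- Since `u` and `y` are distinct and not adjacent, one of them lies on the independent side; by
the symmetry that takes `(u, v, x, y)` to `(y, x, v, u)`, let it be `u`. Then `x` is in the clique,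
hence `v` is independent and `y` is in the clique. Now `x` and `y` show that the neighborhoods of
`u` and `v` are incomparable. -/
theorem IsAlternating.not_isThreshold {u v x y : V} (h : IsAlternating G u v x y) :
    ¬ IsThreshold G := by
  rintro ⟨K, I, hKI, β, rfl, hβ, hnest⟩
  have hK : ∀ a, a ∈ K ↔ a ∉ β := by
    intro a
    constructor
    · intro ha hb
      exact Set.disjoint_left.1 hKI.disj ha hb
    · intro ha
      have : a ∈ K ∪ {x | x ∈ β} := hKI.cover ▸ Set.mem_univ a
      exact this.resolve_right ha
  have hclique : ∀ a b, a ∉ β → b ∉ β → a ≠ b → G.Adj a b := fun a b ha hb hab =>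
    hKI.clique ((hK a).2 ha) ((hK b).2 hb) hab
  have hindep : ∀ a b, a ∈ β → b ∈ β → ¬ G.Adj a b := fun a b ha hb hab =>
    hKI.indep ha hb hab.ne hab
  have huv : u ≠ v := by rintro rfl; exact h.vx h.ux
  have hxy : x ≠ y := by rintro rfl; exact h.uy h.ux
  have hlin : ∀ a b, a ∈ β → b ∈ β → a ≠ b →
      (G.neighborSet a \ {x | x ∈ β} ⊆ G.neighborSet b \ {x | x ∈ β}) ∨
      (G.neighborSet b \ {x | x ∈ β} ⊆ G.neighborSet a \ {x | x ∈ β}) := by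
    intro a b ha hb hab
    obtain ⟨i, hi, rfl⟩ := List.getElem_of_mem ha
    obtain ⟨j, hj, rfl⟩ := List.getElem_of_mem hb
    rcases lt_trichotomy i j with hij | rfl | hij
    · exact Or.inl (List.pairwise_iff_getElem.1 hnest i j hi hj hij)
    · exact absurd rfl hab
    · exact Or.inr (List.pairwise_iff_getElem.1 hnest j i hj hi hij)
  have key : ∀ a b c d, G.Adj a c → G.Adj b d → ¬ G.Adj b c → ¬ G.Adj a d → a ≠ b → c ≠ b →
      d ≠ a → a ∈ β → False := by
    intro a b c d hac hbd hbc had hab hcb hda ha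
    have hc : c ∉ β := fun hc => hindep _ _ ha hc hac
    have hb : b ∈ β := by
      by_contra hb
      exact hbc (hclique _ _ hb hc hcb.symm)
    have hd : d ∉ β := fun hd => hindep _ _ hb hd hbd
    rcases hlin a b ha hb hab with hsub | hsub
    · exact hbc (hsub ⟨hac, hc⟩).1
    · exact had (hsub ⟨hbd, hd⟩).1
  by_cases hu : u ∈ β
  · exact key u v x y h.ux h.vy h.vx h.uy huv h.xv h.yu hu
  · have hy : y ∈ β := by
      by_contra hy
      exact h.uy (hclique _ _ hu hy h.yu.symm)
    exact key y x v u h.vy.symm h.ux.symm (fun h' => h.vx h'.symm) (fun h' => h.uy h'.symm) hxy.symm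
      h.xv.symm h.yu.symm hy

theorem exists_embedding {H : SimpleGraph (Fin 4)} {f : Fin 4 → V} (hf : Function.Injective f)
    (h : ∀ i j, i < j → (G.Adj (f i) (f j) ↔ H.Adj i j)) :
    ∃ e : H ↪g G, List.ofFn f = List.ofFn e := by
  refine ⟨⟨⟨f, hf⟩, fun {i j} => ?_⟩, rfl⟩
  rcases lt_trichotomy i j with hij | rfl | hij
  · exact h i j hij
  · simp
  · rw [SimpleGraph.adj_comm, H.adj_comm]
    exact h j i hij

open Classical in
/-- The NO-certificate on the vertices of an alternating 4-cycle, given the adjacencies `b` of `u`,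
`v` and `b'` of `x`, `y`. -/
theorem IsAlternating.isNoCertificate {u v x y : V} (h : IsAlternating G u v x y) :
    IsNoCertificate G (if G.Adj u v then (if G.Adj x y then [u, v, y, x] else [x, u, v, y])
      else (if G.Adj x y then [u, x, y, v] else [u, x, v, y])) := by
  have huv : u ≠ v := by rintro rfl; exact h.vx h.ux
  have hxy : x ≠ y := by rintro rfl; exact h.uy h.ux
  have hux := h.ux
  have hvy := h.vy
  have hxu := h.ux.symm
  have hyv := h.vy.symm
  have hvx := h.vx
  have huy := h.uy
  have hxv : ¬ G.Adj x v := fun h' => h.vx h'.symm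
  have hyu : ¬ G.Adj y u := fun h' => h.uy h'.symm
  have n1 := h.xv
  have n2 := h.yu
  have n3 := h.ux.ne
  have n4 := h.vy.ne
  have inj : ∀ a b c d : V, a ≠ b → a ≠ c → a ≠ d → b ≠ c → b ≠ d → c ≠ d →
      Function.Injective ![a, b, c, d] := by
    intro a b c d h1 h2 h3 h4 h5 h6 i j hij
    fin_cases i <;> fin_cases j <;> simp_all [eq_comm]
  have fin4 : ∀ P : Fin 4 → Fin 4 → Prop, P 0 1 → P 0 2 → P 0 3 → P 1 2 → P 1 3 → P 2 3 →
      ∀ i j, i < j → P i j := by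
    intro P h1 h2 h3 h4 h5 h6 i j hij
    fin_cases i <;> fin_cases j <;> first | assumption | exact absurd hij (by decide)
  split_ifs with h1 h2 h2
  · have hc : ∀ i j, (SimpleGraph.cycleGraph 4).Adj i j ↔ i - j = 1 ∨ j - i = 1 := fun i j =>
      SimpleGraph.cycleGraph_adj (n := 2)
    refine ⟨SimpleGraph.cycleGraph 4, by simp, ?_⟩
    exact exists_embedding (f := ![u, v, y, x])
      (inj _ _ _ _ huv n2.symm n3 n4 n1.symm hxy.symm)
      (fin4 _ (by simpa [hc] using h1) (by simpa [hc, show (-2 : Fin 4) ≠ 1 by decide] using huy)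
        (by simpa [hc, show (-3 : Fin 4) = 1 by decide] using hux)
        (by simpa [hc] using hvy) (by simpa [hc] using hvx) (by simpa [hc] using h2.symm))
  · refine ⟨SimpleGraph.pathGraph 4, by simp, ?_⟩
    exact exists_embedding (f := ![x, u, v, y])
      (inj _ _ _ _ n3.symm n1 hxy huv n2.symm n4)
      (fin4 _ (by simpa [SimpleGraph.pathGraph_adj] using hxu)
        (by simpa [SimpleGraph.pathGraph_adj] using hxv)
        (by simpa [SimpleGraph.pathGraph_adj] using h2)
        (by simpa [SimpleGraph.pathGraph_adj] using h1)
        (by simpa [SimpleGraph.pathGraph_adj] using huy)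
        (by simpa [SimpleGraph.pathGraph_adj] using hvy))
  · refine ⟨SimpleGraph.pathGraph 4, by simp, ?_⟩
    exact exists_embedding (f := ![u, x, y, v])
      (inj _ _ _ _ n3 n2.symm huv hxy n1 n4.symm)
      (fin4 _ (by simpa [SimpleGraph.pathGraph_adj] using hux)
        (by simpa [SimpleGraph.pathGraph_adj] using huy)
        (by simpa [SimpleGraph.pathGraph_adj] using h1)
        (by simpa [SimpleGraph.pathGraph_adj] using h2)
        (by simpa [SimpleGraph.pathGraph_adj] using hxv)
        (by simpa [SimpleGraph.pathGraph_adj] using hyv))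
  · refine ⟨twoK2, by simp, ?_⟩
    exact exists_embedding (f := ![u, x, v, y])
      (inj _ _ _ _ n3 huv n2.symm n1 hxy n4)
      (fin4 _ (by simpa [twoK2] using hux) (by simpa [twoK2] using h1)
        (by simpa [twoK2] using huy) (by simpa [twoK2] using hxv)
        (by simpa [twoK2] using h2) (by simpa [twoK2] using hvy))

end Vicinal

/-! ### Degree order, alternating cycles and the split partition -/

section Order

variable {n : ℕ} {G : SimpleGraph (Fin n)} {adj : Fin n → List (Fin n)}

theorem IsAdjacencyLists.card_filter [DecidableRel G.Adj] (h : IsAdjacencyLists G adj)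
    (v : Fin n) : (Finset.univ.filter (G.Adj v)).card = (adj v).length := by
  rw [← List.toFinset_card_of_nodup (h v).1]
  congr 1
  ext w
  simp [(h v).2 w]

/-- Adjacency is symmetric, so removing `v` from `N(u)` and `u` from `N(v)` does not change the
comparison of sizes. Without such a `y`, the second set would be a proper subset of the first, as it
misses `x`. -/
theorem exists_alternating (h : IsAdjacencyLists G adj) {u v x : Fin n}
    (hd : (adj u).length ≤ (adj v).length) (hx : G.Adj u x) (hxv : x ≠ v)
    (hvx : ¬ G.Adj v x) : ∃ y, G.Adj v y ∧ y ≠ u ∧ ¬ G.Adj u y := by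
  classical
  by_contra! hcon
  rw [← h.card_filter, ← h.card_filter] at hd
  have h1 : (Finset.univ.filter (G.Adj v)).erase u ⊂ (Finset.univ.filter (G.Adj u)).erase v := by
    refine Finset.ssubset_iff_subset_ne.2 ⟨?_, ?_⟩
    · intro y hy
      simp only [Finset.mem_erase, Finset.mem_filter, Finset.mem_univ, true_and] at hy ⊢
      exact ⟨hy.2.ne', hcon y hy.2 hy.1⟩
    · intro he
      have : x ∈ (Finset.univ.filter (G.Adj u)).erase v := by simp [hx, hxv]
      rw [← he] at this
      simp [hvx] at this
  have h2 := Finset.card_lt_card h1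
  by_cases hadj : G.Adj u v
  · rw [Finset.card_erase_of_mem (by simpa using hadj.symm),
      Finset.card_erase_of_mem (by simpa using hadj)] at h2
    omega
  · rw [Finset.erase_eq_of_notMem (by simpa using fun h' => hadj h'.symm),
      Finset.erase_eq_of_notMem (by simpa using hadj)] at h2
    omega

/-- The vertices of the list whose degree is small compared to their index in the list, where the
indices start from `i`. -/
def select (adj : Fin n → List (Fin n)) : ℕ → List (Fin n) → List (Fin n)
  | _, [] => []
  | i, v :: l => if (adj v).length + i + 1 < n then v :: select adj (i + 1) l
      else select adj (i + 1) l

theorem select_sublist (i : ℕ) (l : List (Fin n)) : (select adj i l).Sublist l := by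
  induction l generalizing i with
  | nil => exact List.Sublist.refl _
  | cons v l ih =>
    rw [select]
    split_ifs
    · exact (ih _).cons_cons v
    · exact (ih _).cons v

theorem mem_select {i : ℕ} {l : List (Fin n)} {v : Fin n} :
    v ∈ select adj i l ↔ ∃ j, ∃ h : j < l.length, l[j] = v ∧ (adj v).length + (i + j) + 1 < n := by
  induction l generalizing i with
  | nil => simp [select]
  | cons w l ih =>
    have h1 : v ∈ select adj i (w :: l) ↔
        (v = w ∧ (adj w).length + i + 1 < n) ∨ v ∈ select adj (i + 1) l := by
      rw [select]
      split_ifs with h <;> simp [h]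
    rw [h1, ih]
    constructor
    · rintro (⟨rfl, h⟩ | ⟨j, hj, h2, h3⟩)
      · exact ⟨0, by simp, rfl, by simpa using h⟩
      · exact ⟨j + 1, by simpa using hj, by simpa using h2, by omega⟩
    · rintro ⟨j, hj, h2, h3⟩
      cases j with
      | zero =>
        have h2' : w = v := by simpa using h2
        subst h2'
        exact Or.inl ⟨rfl, by simpa using h3⟩
      | succ j => exact Or.inr ⟨j, by simpa using hj, by simpa using h2, by omega⟩

/-- The vertex at index `i` has `n - 1 - i` successors. In a nested order, a vertex of at least this
degree is adjacent to all of its successors, and a vertex of smaller degree is adjacent to no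
predecessor. -/
theorem isYesCertificate_select (h : IsAdjacencyLists G adj) {l : List (Fin n)} (hl : l.Nodup)
    (hmem : ∀ v, v ∈ l) (hnest : l.Pairwise (Nested G)) :
    IsYesCertificate G (select adj 0 l) := by
  classical
  have hlen : l.length = n := by
    have h1 := List.toFinset_card_of_nodup hl
    have h2 : l.toFinset = Finset.univ := by ext v; simp [hmem]
    rw [h2] at h1
    simpa using h1.symm
  obtain ⟨f, hf⟩ : ∃ f : Fin n → Fin n, ∀ i : Fin n, f i = l[(i : ℕ)]'(by omega) :=
    ⟨fun i => l[(i : ℕ)]'(by omega), fun _ => rfl⟩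
  have hinj : Function.Injective f := by
    intro i j hij
    rw [hf, hf] at hij
    exact Fin.ext ((List.Nodup.getElem_inj_iff hl).1 hij)
  have hsurj : Function.Surjective f := Finite.surjective_of_injective hinj
  have hN : ∀ i j, i < j → Nested G (f i) (f j) := by
    intro i j hij
    rw [hf, hf]
    exact List.pairwise_iff_getElem.1 hnest i j _ _ hij
  have hsel : ∀ i, f i ∈ select adj 0 l ↔ (adj (f i)).length + i + 1 < n := by
    intro i
    rw [mem_select]
    constructor
    · rintro ⟨j, hj, h1, h2⟩
      rw [hf] at h1
      have := (List.Nodup.getElem_inj_iff hl).1 h1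
      omega
    · intro h1
      exact ⟨i, by omega, (hf i).symm, by omega⟩
  have hdeg : ∀ i, (adj (f i)).length = (Finset.univ.filter fun l => G.Adj (f i) (f l)).card := by
    intro i
    rw [← h.card_filter, 
      ← Finset.card_image_of_injective (Finset.univ.filter fun l => G.Adj (f i) (f l)) hinj]
    congr 1
    ext w
    obtain ⟨k, rfl⟩ := hsurj w
    simp [hinj.eq_iff]
  -- If `f i` has an earlier neighbor, nesting extends this adjacency to every later vertex.
  -- Otherwise all neighbors come later, and the degree is too large for one of them to be missing.
  have hclique : ∀ i j, i < j → f i ∉ select adj 0 l → G.Adj (f i) (f j) := by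
    intro i j hij hi
    by_contra hadj
    rw [hsel, hdeg] at hi
    by_cases hlow : ∃ k, k < i ∧ G.Adj (f i) (f k)
    · obtain ⟨k, hk, hki⟩ := hlow
      exact hadj (hN k j (hk.trans hij) (f i) hki.symm (hinj.ne hij.ne)).symm
    · have hsub : (Finset.univ.filter fun l => G.Adj (f i) (f l)) ⊆ (Finset.Ioi i).erase j := by
        intro k hk
        have hk' : G.Adj (f i) (f k) := by simpa using hk
        refine Finset.mem_erase.2 ⟨?_, Finset.mem_Ioi.2 ?_⟩
        · rintro rfl
          exact hadj hk'
        · rcases lt_trichotomy i k with h1 | rfl | h1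
          · exact h1
          · exact absurd hk' (G.irrefl)
          · exact absurd ⟨k, h1, hk'⟩ hlow
      have h1 := Finset.card_le_card hsub
      rw [Finset.card_erase_of_mem (Finset.mem_Ioi.2 hij), Fin.card_Ioi] at h1
      have := j.2
      have hij' : (i : ℕ) < j := hij
      omega
  -- An earlier neighbor `f i` of `f j` makes all vertices from index `i` on, except `f j`,
  -- neighbors of `f j` by nesting. These are more than the degree of a selected vertex allows.
  have hindep : ∀ i j, i < j → f j ∈ select adj 0 l → ¬ G.Adj (f i) (f j) := by
    intro i j hij hj hadj
    rw [hsel, hdeg] at hj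
    have hsub : (Finset.Ici i).erase j ⊆ (Finset.univ.filter fun l => G.Adj (f j) (f l)) := by
      intro k hk
      obtain ⟨h1, h2⟩ := Finset.mem_erase.1 hk
      have h2' := Finset.mem_Ici.1 h2
      simp only [Finset.mem_filter, Finset.mem_univ, true_and]
      rcases h2'.eq_or_lt with rfl | h3
      · exact hadj.symm
      · exact (hN i k h3 (f j) hadj (hinj.ne h1.symm)).symm
    have h1 := Finset.card_le_card hsub
    rw [Finset.card_erase_of_mem (Finset.mem_Ici.2 hij.le), Fin.card_Ici] at h1
    have := j.2
    have hij' : (i : ℕ) < j := hij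
    omega
  refine ⟨⟨?_, ?_, ?_, ?_⟩, (select_sublist 0 l).nodup hl, ?_⟩
  · ext v
    simp [Classical.em, or_comm]
  · exact Set.disjoint_left.2 fun v h1 h2 => h1 h2
  · intro u hu v hv huv
    obtain ⟨i, rfl⟩ := hsurj u
    obtain ⟨j, rfl⟩ := hsurj v
    rcases lt_trichotomy i j with hij | rfl | hij
    · exact hclique i j hij hu
    · exact absurd rfl huv
    · exact (hclique j i hij hv).symm
  · intro u hu v hv huv
    obtain ⟨i, rfl⟩ := hsurj u
    obtain ⟨j, rfl⟩ := hsurj v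
    rcases lt_trichotomy i j with hij | rfl | hij
    · exact hindep i j hij hv
    · exact absurd rfl huv
    · exact fun h' => hindep j i hij hu h'.symm
  · have h1 := hnest.sublist (select_sublist (adj := adj) 0 l)
    refine (List.pairwise_iff_forall_sublist.2 ?_)
    intro u v huv x hx
    have hv : v ∈ select adj 0 l := huv.subset (by simp)
    refine ⟨List.pairwise_iff_forall_sublist.1 h1 huv x hx.1 ?_, hx.2⟩
    rintro rfl
    exact hx.2 hv

end Order

open Prog

/-! ### Words -/

/-- Words are triples of numbers from `{0, …, q}`, ordered lexicographically. -/
abbrev Word (q : ℕ) : Type := Fin (q + 1) ×ₗ Fin (q + 1) ×ₗ Fin (q + 1)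

/-- The word with entries `a`, `b` and `c`. -/
def word (q a b c : ℕ) : Word q :=
  toLex (Fin.ofNat (q + 1) a, toLex (Fin.ofNat (q + 1) b, Fin.ofNat (q + 1) c))

namespace Word

variable {q : ℕ}

/-- The first entry. -/
def a (x : Word q) : ℕ := (ofLex x).1

/-- The second entry. -/
def b (x : Word q) : ℕ := (ofLex (ofLex x).2).1

/-- The third entry. -/
def c (x : Word q) : ℕ := (ofLex (ofLex x).2).2

theorem a_le (x : Word q) : x.a ≤ q := Nat.le_of_lt_succ (ofLex x).1.2

theorem b_le (x : Word q) : x.b ≤ q := Nat.le_of_lt_succ (ofLex (ofLex x).2).1.2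

theorem c_le (x : Word q) : x.c ≤ q := Nat.le_of_lt_succ (ofLex (ofLex x).2).2.2

theorem a_word {i : ℕ} (h : i ≤ q) (j k : ℕ) : (word q i j k).a = i :=
  Nat.mod_eq_of_lt (Nat.lt_succ_of_le h)

theorem b_word {j : ℕ} (h : j ≤ q) (i k : ℕ) : (word q i j k).b = j :=
  Nat.mod_eq_of_lt (Nat.lt_succ_of_le h)

theorem c_word {k : ℕ} (h : k ≤ q) (i j : ℕ) : (word q i j k).c = k :=
  Nat.mod_eq_of_lt (Nat.lt_succ_of_le h)

theorem word_abc (x : Word q) : word q x.a x.b x.c = x := by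
  obtain ⟨i, j, k⟩ := x
  simp only [word, a, b, c]
  have h : ∀ i : Fin (q + 1), Fin.ofNat (q + 1) (i : ℕ) = i := fun i => by
    apply Fin.ext
    simp
  rw [h, h, h]
  rfl

theorem le_iff {x y : Word q} :
    x ≤ y ↔ x.a < y.a ∨ x.a = y.a ∧ (x.b < y.b ∨ x.b = y.b ∧ x.c ≤ y.c) := by
  rw [Prod.Lex.le_iff, Prod.Lex.le_iff]
  simp only [a, b, c, Fin.lt_def, Fin.le_def, Fin.ext_iff]

/-- The number that represents a word. -/
def toNat (x : Word q) : ℕ := (x.a * (q + 1) + x.b) * (q + 1) + x.c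

theorem toNat_word_zero {i : ℕ} (h : i ≤ q) : (word q 0 0 i).toNat = i := by
  rw [toNat, a_word (Nat.zero_le _), b_word (Nat.zero_le _), c_word h]
  simp

theorem toNat_injective : Function.Injective (toNat : Word q → ℕ) := by
  have key : ∀ x y i j : ℕ, i ≤ q → j ≤ q → x * (q + 1) + i = y * (q + 1) + j → x = y ∧ i = j := by
    intro x y i j hi hj h
    have h1 : (x * (q + 1) + i) % (q + 1) = i := by
      rw [Nat.add_comm, Nat.add_mul_mod_self_right, Nat.mod_eq_of_lt (by omega)]
    have h2 : (y * (q + 1) + j) % (q + 1) = j := by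
      rw [Nat.add_comm, Nat.add_mul_mod_self_right, Nat.mod_eq_of_lt (by omega)]
    rw [h, h2] at h1
    subst h1
    exact ⟨Nat.eq_of_mul_eq_mul_right (by omega) (Nat.add_right_cancel h), rfl⟩
  intro x y h
  obtain ⟨h1, h2⟩ := key _ _ _ _ x.c_le y.c_le h
  obtain ⟨h3, h4⟩ := key _ _ _ _ x.b_le y.b_le h1
  rw [← word_abc x, ← word_abc y, h2, h3, h4]

theorem toNat_lt (x : Word q) : x.toNat < (q + 1) ^ 3 := by
  have h1 := x.a_le
  have h2 := x.b_le
  have h3 := x.c_le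
  have h4 : x.a * (q + 1) + x.b + 1 ≤ (q + 1) ^ 2 := by nlinarith
  have h5 : (x.a * (q + 1) + x.b + 1) * (q + 1) ≤ (q + 1) ^ 2 * (q + 1) :=
    Nat.mul_le_mul_right _ h4
  rw [toNat]
  calc _ < (x.a * (q + 1) + x.b + 1) * (q + 1) := by rw [Nat.add_mul _ 1]; omega
    _ ≤ _ := h5
    _ = _ := by ring

theorem card : Fintype.card (Word q) = (q + 1) ^ 3 := by
  have : Fintype.card (Word q) = Fintype.card (Fin (q + 1) × Fin (q + 1) × Fin (q + 1)) :=
    Fintype.card_congr ⟨fun x => ((ofLex x).1, (ofLex x).2), fun x => toLex (x.1, toLex x.2),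
      fun _ => rfl, fun _ => rfl⟩
  rw [this]
  simp
  ring

/-- The word that follows all records. -/
def top (q : ℕ) : Word q := word q q q 0

end Word

/-! ### Records -/

section Records

variable {n q : ℕ} {adj : Fin n → List (Fin n)}

/-- The record of the vertex `v` of degree `d`. -/
def header (q d : ℕ) (v : Fin n) : Word q := word q d v 0

/-- The record of a neighbor `w` of the vertex `v` of degree `d`. -/
def entry (q d : ℕ) (v w : Fin n) : Word q := word q d v (w + 1)

/-- The records of a vertex with the list `l` of neighbors. -/
def vertexRecords (q : ℕ) (l : List (Fin n)) (v : Fin n) : List (Word q) :=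
  header q l.length v :: l.map (entry q l.length v)

theorem advance_zero (i j : ℕ) : advance ![i, j] (some 0) = ![i + 1, j] := by
  funext k
  fin_cases k <;> simp [advance]

theorem advance_one (i j : ℕ) : advance ![i, j] (some 1) = ![i, j + 1] := by
  funext k
  fin_cases k <;> simp [advance]

/-- The rule that turns the arrays `P` and `E`, scanned by the two cursors, into the list of all
records. The state consists of the current vertex, the last entry of `P`, and the number of records
of this vertex written so far. -/
def recordRule (n q : ℕ) : Rule 2 (Word q) (Word q) := fun s _ head =>
  if s.a < n then
    if s.c = 0 then (word q s.a s.b 1, none, some (word q ((head 0).c - s.b) s.a 0))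
    else if s.c ≤ (head 0).c - s.b then
      (word q s.a s.b (s.c + 1), some 1, some (word q ((head 0).c - s.b) s.a ((head 1).c + 1)))
    else (word q (s.a + 1) (head 0).c 0, some 0, none)
  else if s.c = 0 then (word q s.a s.b 1, none, some (Word.top q))
  else (s, none, none)

/-- Induction on the neighbors not yet written. The counter in the state includes the header, so it
equals `d - l.length + 1` while `l` remains. -/
theorem record_entries {D : ℕ → Word q} {v : Fin n} {prev p₀ p₁ : ℕ} {l : List (Fin n)} (d : ℕ)
    (hn : n ≤ q) (hprev : prev + d < q) (hP : (D p₀).c = prev + d)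
    (hE : ∀ i (h : i < l.length), (D (p₁ + i)).c = l[i]) (hd : l.length ≤ d) :
    Trace (recordRule n q) D l.length (word q v prev (d - l.length + 1)) ![p₀, p₁]
      (l.map (entry q d v)) (word q v prev (d + 1)) ![p₀, p₁ + l.length] := by
  have hv := v.2
  induction l generalizing p₁ with
  | nil => exact Trace.zero _ _
  | cons w l ih =>
    simp only [List.length_cons] at hd
    have h1 := ih (p₁ := p₁ + 1) (fun i h => by
      have := hE (i + 1) (by simpa using h)
      rw [Nat.add_assoc, Nat.add_comm 1]
      simpa using this) (by omega)
    have h0 := hE 0 (by simp)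
    simp only [Nat.add_zero, List.getElem_cons_zero] at h0
    rw [List.length_cons, Nat.add_comm l.length 1, ← Nat.add_assoc, List.map_cons]
    rw [Nat.add_comm 1]
    refine Trace.step (x := some (entry q d v w)) (a := some 1)
      (s₁ := word q v prev (d - l.length + 1)) ?_ ?_
    · have e1 : (word q v prev (d - (l.length + 1) + 1)).a = v := Word.a_word (by omega) _ _
      have e2 : (word q v prev (d - (l.length + 1) + 1)).b = prev := Word.b_word (by omega) _ _
      have e3 : (word q v prev (d - (l.length + 1) + 1)).c = d - (l.length + 1) + 1 :=
        Word.c_word (by omega) _ _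
      simp only [recordRule, e1, e2, e3, hv, if_true, Matrix.cons_val_zero, Matrix.cons_val_one,
        hP, h0, Nat.add_sub_cancel_left, entry]
      rw [if_neg (by omega), if_pos (by omega), show d - (l.length + 1) + 1 = d - l.length by omega]
    · rw [advance_one]
      exact h1

theorem record_vertex {D : ℕ → Word q} {v : Fin n} {prev p₀ p₁ : ℕ} {l : List (Fin n)}
    (hn : n ≤ q) (hprev : prev + l.length < q) (hP : (D p₀).c = prev + l.length)
    (hE : ∀ i (h : i < l.length), (D (p₁ + i)).c = l[i]) :
    Trace (recordRule n q) D (l.length + 2) (word q v prev 0) ![p₀, p₁]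
      (vertexRecords q l v) (word q (v + 1) (prev + l.length) 0) ![p₀ + 1, p₁ + l.length] := by
  have hv := v.2
  have h1 := record_entries (v := v) l.length hn hprev hP hE le_rfl
  rw [Nat.sub_self, Nat.zero_add] at h1
  rw [Nat.add_comm, show 2 + l.length = l.length + 1 + 1 by omega]
  refine Trace.step (x := some (header q l.length v)) (a := none) (s₁ := word q v prev 1) ?_ ?_
  · simp only [recordRule, Word.a_word (show (v : ℕ) ≤ q by omega),
      Word.b_word (show prev ≤ q by omega), Word.c_word (Nat.zero_le q), hv, if_true,
      Matrix.cons_val_zero, hP, Nat.add_sub_cancel_left, header]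
  · rw [← List.append_nil (l.map _)]
    refine h1.trans (T' := 1) ?_
    refine Trace.step (x := none) (a := some 0) (s₁ := word q (v + 1) (prev + l.length) 0) ?_ ?_
    · simp only [recordRule, Word.a_word (show (v : ℕ) ≤ q by omega),
        Word.b_word (show prev ≤ q by omega), Word.c_word (show l.length + 1 ≤ q by omega), hv,
        if_true, Matrix.cons_val_zero, hP, Nat.add_sub_cancel_left]
      rw [if_neg (by omega), if_neg (by omega)]
    · rw [advance_zero]
      exact Trace.zero _ _

/-- The entry `P[v]`. -/
def rowStart (adj : Fin n → List (Fin n)) (v : ℕ) : ℕ := ((List.ofFn adj).take v).flatten.length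

theorem rowStart_succ (adj : Fin n → List (Fin n)) (v : Fin n) :
    rowStart adj (v + 1) = rowStart adj v + (adj v).length := by
  rw [rowStart, rowStart, List.take_succ_eq_append_getElem (by simp)]
  simp

theorem rowStart_mono (adj : Fin n → List (Fin n)) {v w : ℕ} (h : v ≤ w) :
    rowStart adj v ≤ rowStart adj w := by
  obtain ⟨k, rfl⟩ := Nat.exists_eq_add_of_le h
  rw [rowStart, rowStart, List.take_add, List.flatten_append, List.length_append]
  omega

theorem getElem_flatten_ofFn (adj : Fin n → List (Fin n)) (v : Fin n) (i : ℕ)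
    (hi : i < (adj v).length) :
    (List.ofFn adj).flatten[rowStart adj v + i]? = some ((adj v)[i]) := by
  have h1 : List.ofFn adj = (List.ofFn adj).take v ++ adj v :: (List.ofFn adj).drop (v + 1) := by
    have h2 : (v : ℕ) < (List.ofFn adj).length := by simp
    conv_lhs => rw [← List.take_append_drop v (List.ofFn adj), List.drop_eq_getElem_cons h2]
    simp
  rw [h1, List.flatten_append, List.flatten_cons, List.getElem?_append_right (by rw [rowStart]; omega)]
  rw [rowStart, Nat.add_sub_cancel_left, List.getElem?_append_left hi, List.getElem?_eq_getElem hi]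

/-- The input as an external memory of words. -/
def inputWords (q : ℕ) (adj : Fin n → List (Fin n)) (i : ℕ) : Word q :=
  word q 0 0 ((rowP adj ++ rowE adj).getD i 0)

theorem length_rowP (adj : Fin n → List (Fin n)) : (rowP adj).length = n + 1 := by simp [rowP]

theorem getD_rowP (adj : Fin n → List (Fin n)) {v : ℕ} (hv : v ≤ n) :
    (rowP adj ++ rowE adj).getD v 0 = rowStart adj v := by
  rw [List.getD_append _ _ _ _ (by rw [length_rowP]; omega),
    List.getD_eq_getElem _ _ (by rw [length_rowP]; omega)]
  simp only [rowP, List.getElem_ofFn, rowStart]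

theorem getD_rowE (adj : Fin n → List (Fin n)) (v : Fin n) {i : ℕ} (hi : i < (adj v).length) :
    (rowP adj ++ rowE adj).getD (n + 1 + rowStart adj v + i) 0 = (adj v)[i] := by
  rw [List.getD_append_right _ _ _ _ (by rw [length_rowP]; omega), length_rowP,
    show n + 1 + rowStart adj v + i - (n + 1) = rowStart adj v + i by omega,
    List.getD_eq_getElem?_getD, rowE, List.getElem?_map, getElem_flatten_ofFn adj v i hi]
  simp

theorem getD_row_le (adj : Fin n → List (Fin n)) (i : ℕ) :
    (rowP adj ++ rowE adj).getD i 0 ≤ n + rowStart adj n := by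
  rw [List.getD_eq_getElem?_getD]
  cases h : (rowP adj ++ rowE adj)[i]? with
  | none => simp
  | some x =>
    rcases List.mem_append.1 (List.mem_of_getElem? h) with hx | hx
    · rw [rowP, List.mem_ofFn] at hx
      obtain ⟨j, rfl⟩ := hx
      exact (rowStart_mono adj (Nat.le_of_lt_succ j.2)).trans (Nat.le_add_left _ _)
    · rw [rowE, List.mem_map] at hx
      obtain ⟨j, -, rfl⟩ := hx
      exact j.2.le.trans (Nat.le_add_right _ _)

theorem length_vertexRecords (l : List (Fin n)) (v : Fin n) :
    (vertexRecords q l v).length = l.length + 1 := by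
  simp [vertexRecords]

/-- The first pass writes all records. -/
theorem record_trace (hq : n + rowStart adj n < q) (T : ℕ)
    (hT : rowStart adj n + 2 * n + 1 ≤ T) :
    ∃ s pos, Trace (recordRule n q) (inputWords q adj) T (word q 0 0 0) ![1, n + 1]
      ((List.finRange n).flatMap (fun v => vertexRecords q (adj v) v) ++ [Word.top q]) s pos := by
  -- At vertex `k` the first cursor is on `P[k + 1]` and the state remembers `P[k]`, so the degree
  -- is available as their difference. A vertex takes two steps beyond its degree, for the header
  -- and for moving on.
  have key : ∀ k, k ≤ n → Trace (recordRule n q) (inputWords q adj) (rowStart adj k + 2 * k)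
      (word q 0 0 0) ![1, n + 1]
      (((List.finRange n).take k).flatMap (fun v => vertexRecords q (adj v) v))
      (word q k (rowStart adj k) 0) ![1 + k, n + 1 + rowStart adj k] := by
    intro k hk
    induction k with
    | zero => exact Trace.zero _ _
    | succ k ih =>
      have h1 := ih (by omega)
      have h2 := rowStart_succ adj ⟨k, hk⟩
      have h3 := rowStart_mono adj hk
      dsimp only at h2
      have h4 := record_vertex (D := inputWords q adj) (v := ⟨k, hk⟩) (prev := rowStart adj k)
        (p₀ := 1 + k) (p₁ := n + 1 + rowStart adj k) (l := adj ⟨k, hk⟩) (by omega) (by omega)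
        (by
          rw [inputWords, getD_rowP adj (by omega), Word.c_word (by rw [Nat.add_comm]; omega),
            Nat.add_comm 1, h2])
        (fun i hi => by
          rw [inputWords, Word.c_word ((getD_row_le _ _).trans hq.le)]
          exact getD_rowE adj ⟨k, hk⟩ hi)
      have h5 := h1.trans h4
      have h6 : ((List.finRange n).take (k + 1)).flatMap (fun v => vertexRecords q (adj v) v) =
          ((List.finRange n).take k).flatMap (fun v => vertexRecords q (adj v) v) ++
            vertexRecords q (adj ⟨k, hk⟩) ⟨k, hk⟩ := by
        rw [List.take_succ_eq_append_getElem (by simpa using hk), List.flatMap_append]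
        simp
      have e1 : rowStart adj k + 2 * k + ((adj ⟨k, hk⟩).length + 2) =
          rowStart adj (k + 1) + 2 * (k + 1) := by omega
      have e2 : n + 1 + rowStart adj k + (adj ⟨k, hk⟩).length = n + 1 + rowStart adj (k + 1) := by
        omega
      rw [e1, e2, ← h2, ← h6, Nat.add_assoc 1] at h5
      exact h5
  have h1 := key n le_rfl
  rw [List.take_of_length_le (by simp)] at h1
  have h2 : Trace (recordRule n q) (inputWords q adj) 1 (word q n (rowStart adj n) 0)
      ![1 + n, n + 1 + rowStart adj n] [Word.top q] (word q n (rowStart adj n) 1)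
      ![1 + n, n + 1 + rowStart adj n] := by
    refine Trace.step (x := some (Word.top q)) (a := none) (s₁ := word q n (rowStart adj n) 1)
      ?_ (Trace.zero _ _)
    simp only [recordRule, Word.a_word (show n ≤ q by omega),
      Word.b_word (show rowStart adj n ≤ q by omega), Word.c_word (Nat.zero_le q), lt_irrefl,
      if_true, if_false]
  have h3 := Trace.idle (δ := recordRule n q) (D := inputWords q adj)
    (s := word q n (rowStart adj n) 1) (pos := ![1 + n, n + 1 + rowStart adj n]) (by
      simp only [recordRule, Word.a_word (show n ≤ q by omega),
        Word.c_word (show 1 ≤ q by omega), lt_irrefl, if_false, one_ne_zero])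
    (T - (rowStart adj n + 2 * n + 1))
  refine ⟨word q n (rowStart adj n) 1, ![1 + n, n + 1 + rowStart adj n], ?_⟩
  have h4 := (h1.trans h2).trans h3
  rwa [List.append_nil, Nat.add_sub_cancel' hT] at h4

end Records

/-! ### Comparing consecutive adjacency lists, searching and selecting -/

section Check

variable {n q : ℕ}

/-- From position `p` on, `D` holds entries of the vertices in `l`, followed by a header. -/
def Entries (D : ℕ → Word q) : ℕ → List (Fin n) → Prop
  | p, [] => (D p).c = 0
  | p, w :: l => (D p).c = w + 1 ∧ Entries D (p + 1) l

/-- The rule that checks, for consecutive vertices `u` and `v` in the sorted list of records, that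
all neighbors of `u` except `v` are neighbors of `v`. The two cursors scan the entries of `u` and of
`v`. The state consists of a mode (`0`: comparing, `1`: about to start with the next pair, `2`: all
pairs passed, `3`: a pair failed), the vertices `u`, `v` and, in mode `3`, the neighbor of `u` that
failed, and the positions of the entries of `u` and `v`, relative to `base`. -/
def checkRule (q base : ℕ) : Rule 2 (Word q) (Fin 4 × Word q × Word q) := fun s pos head =>
  if s.1 = 0 then
    if (head 0).c = 0 then
      if (head 1).c ≠ 0 then (s, some 1, none)
      else if (head 1).a = q then ((2, s.2), none, none)
      else ((1, word q (head 0).b 0 0, word q (pos 0 + 1 - base) 0 0), some 0, none)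
    else if (head 0).c = s.2.1.b + 1 then (s, some 0, none)
    else if (head 1).c = 0 ∨ (head 0).c < (head 1).c then
      ((3, word q s.2.1.a s.2.1.b ((head 0).c - 1), s.2.2), none, none)
    else if (head 1).c < (head 0).c then (s, some 1, none)
    else (s, some 0, none)
  else if s.1 = 1 then
    ((0, word q s.2.1.a (head 1).b 0, word q s.2.2.a (pos 1 + 1 - base) 0), some 1, none)
  else (s, none, none)

/-- Comparing the neighbors `a` of `u` with the neighbors `b` of `v`. -/
theorem check_compare {base : ℕ} {D : ℕ → Word q} {u v pu pv : ℕ} (hu : u ≤ q) (hv : v ≤ q)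
    {p₀ p₁ : ℕ} {a b : List (Fin n)} (ha : a.Pairwise (· < ·)) (hb : b.Pairwise (· < ·))
    (hpa : Entries D p₀ a) (hpb : Entries D p₁ b) :
    ((∀ w ∈ a, (w : ℕ) ≠ v → w ∈ b) ∧ ∃ b', b' <:+ b ∧
      Trace (checkRule q base) D (a.length + (b.length - b'.length))
        (0, word q u v 0, word q pu pv 0) ![p₀, p₁] []
        (0, word q u v 0, word q pu pv 0) ![p₀ + a.length, p₁ + (b.length - b'.length)] ∧
      Entries D (p₁ + (b.length - b'.length)) b') ∨
    ∃ x ∈ a, (x : ℕ) ≠ v ∧ x ∉ b ∧ ∃ T pos, T ≤ a.length + b.length + 1 ∧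
      Trace (checkRule q base) D T (0, word q u v 0, word q pu pv 0) ![p₀, p₁] []
        (3, word q u v x, word q pu pv 0) pos := by
  induction a generalizing p₀ p₁ b with
  | nil =>
    refine Or.inl ⟨by simp, b, List.suffix_rfl, ?_, ?_⟩
    · simpa using Trace.zero _ _
    · simpa using hpb
  | cons w a iha =>
    have hc := hpa.1
    have hwa : (word q u v 0).a = u := Word.a_word hu _ _
    have hwb : (word q u v 0).b = v := Word.b_word hv _ _
    -- All cases in which the first cursor advances. The second cursor stays even if both entries
    -- are equal, so the list `b` is the same afterwards.
    have skip : ∀ {b : List (Fin n)} {p₁ : ℕ}, b.Pairwise (· < ·) → Entries D p₁ b →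
        ((w : ℕ) ≠ v → w ∈ b) →
        (checkRule q base (0, word q u v 0, word q pu pv 0) ![p₀, p₁]
          (fun i => D (![p₀, p₁] i))) = ((0, word q u v 0, word q pu pv 0), some 0, none) →
        ((∀ x ∈ w :: a, (x : ℕ) ≠ v → x ∈ b) ∧ ∃ b', b' <:+ b ∧
          Trace (checkRule q base) D ((w :: a).length + (b.length - b'.length))
            (0, word q u v 0, word q pu pv 0) ![p₀, p₁] []
            (0, word q u v 0, word q pu pv 0)
              ![p₀ + (w :: a).length, p₁ + (b.length - b'.length)] ∧
          Entries D (p₁ + (b.length - b'.length)) b') ∨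
        ∃ x ∈ w :: a, (x : ℕ) ≠ v ∧ x ∉ b ∧ ∃ T pos, T ≤ (w :: a).length + b.length + 1 ∧
          Trace (checkRule q base) D T (0, word q u v 0, word q pu pv 0) ![p₀, p₁] []
            (3, word q u v x, word q pu pv 0) pos := by
      intro b p₁ hb hpb hw hstep
      rcases iha ha.of_cons hb hpa.2 hpb with ⟨h1, b', h2, h3, h4⟩ | ⟨x, h1, h2, h3, T, pos, h4, h5⟩
      · refine Or.inl ⟨?_, b', h2, ?_, h4⟩
        · intro x hx
          rcases List.mem_cons.1 hx with rfl | hx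
          · exact hw
          · exact h1 x hx
        · rw [List.length_cons, Nat.add_right_comm, Nat.add_comm a.length 1, ← Nat.add_assoc p₀]
          exact Trace.step (x := none) (a := some 0) hstep (by rwa [advance_zero])
      · refine Or.inr ⟨x, List.mem_cons_of_mem _ h1, h2, h3, T + 1, pos, ?_, ?_⟩
        · simp only [List.length_cons]
          omega
        · exact Trace.step (x := none) (a := some 0) hstep (by rwa [advance_zero])
    by_cases hw : (w : ℕ) = v
    · refine skip hb hpb (fun h => absurd hw h) ?_
      simp [checkRule, hc, hwb, hw]
    have fail : ((D p₁).c = 0 ∨ (w : ℕ) + 1 < (D p₁).c) →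
        checkRule q base (0, word q u v 0, word q pu pv 0) ![p₀, p₁]
          (fun i => D (![p₀, p₁] i)) = ((3, word q u v w, word q pu pv 0), none, none) := by
      intro h
      simp [checkRule, hc, hwa, hwb, hw, h]
    -- With `w` fixed, the inner induction runs through the entries of `v` smaller than `w`. Both
    -- lists are increasing, so the first entry beyond `w` proves that `w` is missing.
    induction b generalizing p₁ with
    | nil =>
      refine Or.inr ⟨w, by simp, hw, by simp, 1, ![p₀, p₁], by simp, ?_⟩
      exact Trace.step (x := none) (a := none) (fail (Or.inl hpb)) (Trace.zero _ _)
    | cons y b ihb =>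
      have hd := hpb.1
      rcases lt_trichotomy w y with hwy | rfl | hyw
      · refine Or.inr ⟨w, by simp, hw, ?_, 1, ![p₀, p₁], by simp, ?_⟩
        · intro hmem
          rcases List.mem_cons.1 hmem with rfl | hmem
          · exact lt_irrefl _ hwy
          · exact lt_asymm hwy (List.rel_of_pairwise_cons hb hmem)
        · refine Trace.step (x := none) (a := none) (fail (Or.inr ?_)) (Trace.zero _ _)
          rw [hd]
          have := Fin.lt_def.1 hwy
          omega
      · refine skip hb hpb (fun _ => by simp) ?_
        simp [checkRule, hc, hd, hwb, hw]
      · have hstep : checkRule q base (0, word q u v 0, word q pu pv 0) ![p₀, p₁]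
            (fun i => D (![p₀, p₁] i)) = ((0, word q u v 0, word q pu pv 0), some 1, none) := by
          have h1 := Fin.lt_def.1 hyw
          have h2 : ¬ (w : ℕ) < y := by omega
          simp [checkRule, hc, hd, hwb, hw, h1, h2, -Fin.val_fin_lt]
        rcases ihb hb.of_cons hpb.2 (fun h => by
          simp [checkRule, hc, hwa, hwb, hw, h]) with
          ⟨h1, b', h2, h3, h4⟩ | ⟨x, h1, h2, h3, T, pos, h4, h5⟩
        · have h5 := h2.length_le
          have e : (y :: b).length - b'.length = b.length - b'.length + 1 := by
            rw [List.length_cons]; omega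
          refine Or.inl ⟨fun x hx hxv => List.mem_cons_of_mem _ (h1 x hx hxv), b',
            h2.trans (List.suffix_cons _ _), ?_, ?_⟩
          · rw [e, ← Nat.add_assoc, Nat.add_comm (b.length - b'.length) 1, ← Nat.add_assoc p₁]
            exact Trace.step (x := none) (a := some 1) hstep (by rwa [advance_one])
          · rwa [e, Nat.add_comm (b.length - b'.length) 1, ← Nat.add_assoc]
        · refine Or.inr ⟨x, h1, h2, ?_, T + 1, pos, ?_, ?_⟩
          · intro hmem
            rcases List.mem_cons.1 hmem with rfl | hmem
            · rcases List.mem_cons.1 h1 with rfl | h1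
              · exact lt_irrefl _ hyw
              · exact lt_asymm hyw (List.rel_of_pairwise_cons ha h1)
            · exact h3 hmem
          · simp only [List.length_cons] at h4 ⊢
            omega
          · exact Trace.step (x := none) (a := some 1) hstep (by rwa [advance_one])

/-- From position `p` on, `D` holds the records of the vertices in `l`, followed by `Word.top`. -/
def HasRecords (D : ℕ → Word q) (adj : Fin n → List (Fin n)) : ℕ → List (Fin n) → Prop
  | p, [] => D p = Word.top q
  | p, v :: l => D p = header q (adj v).length v ∧ Entries D (p + 1) (adj v) ∧
      HasRecords D adj (p + 1 + (adj v).length) l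

/-- The number of records of the vertices in `l`. -/
def recordCount (adj : Fin n → List (Fin n)) (l : List (Fin n)) : ℕ :=
  (l.map fun v => (adj v).length + 1).sum

/-- A comparison may end before the second list is exhausted. The first cursor then waits on a
header while the second one proceeds to the next header. -/
theorem check_skip {base p₀ p₁ : ℕ} {D : ℕ → Word q} {s : Fin 4 × Word q × Word q}
    (hs : s.1 = 0) (h₀ : (D p₀).c = 0) {b : List (Fin n)} (hb : Entries D p₁ b) :
    Trace (checkRule q base) D b.length s ![p₀, p₁] [] s ![p₀, p₁ + b.length] := by
  induction b generalizing p₁ with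
  | nil => exact Trace.zero _ _
  | cons w b ih =>
    have h1 := ih hb.2
    rw [List.length_cons, Nat.add_comm b.length, ← Nat.add_assoc]
    rw [Nat.add_comm 1]
    refine Trace.step (x := none) (a := some 1) (s₁ := s) ?_ (by rwa [advance_one])
    simp [checkRule, hs, h₀, hb.1]

/-- The outcome of the comparison of all consecutive pairs. -/
theorem check_chain {base E : ℕ} {D : ℕ → Word q} {adj : Fin n → List (Fin n)} (hn : n ≤ q)
    (hE : E < base + q) (hadj : ∀ v, (adj v).Pairwise (· < ·)) {l : List (Fin n)} {v : Fin n}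
    (hdeg : (v :: l).Pairwise fun u v => (adj u).length ≤ (adj v).length)
    {p₀ p₁ : ℕ} {b : List (Fin n)} {s : Fin 4 × Word q × Word q} (hs : s.1 = 0)
    (hp₀ : base ≤ p₀) (h₀ : D p₀ = header q (adj v).length v) (hv : Entries D (p₀ + 1) (adj v))
    (hb : Entries D p₁ b) (hlen : p₀ + 1 + (adj v).length = p₁ + b.length)
    (hl : HasRecords D adj (p₁ + b.length) l) (hE' : p₁ + b.length + recordCount adj l = E) :
    ((v :: l).IsChain (fun u v => ∀ w ∈ adj u, w ≠ v → w ∈ adj v) ∧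
      ∃ T s' pos, T + p₀ + p₁ ≤ 2 * E + 1 ∧
        Trace (checkRule q base) D T s ![p₀, p₁] [] s' pos ∧ s'.1 = 2) ∨
    ∃ (u v x : Fin n) (pu pv T : ℕ) (pos : Fin 2 → ℕ),
      (adj u).length ≤ (adj v).length ∧ x ∈ adj u ∧ x ≠ v ∧ x ∉ adj v ∧
      base + pu + (adj u).length ≤ E ∧ base + pv + (adj v).length ≤ E ∧
      Entries D (base + pu) (adj u) ∧ Entries D (base + pv) (adj v) ∧ T + p₀ + p₁ ≤ 2 * E + 1 ∧
      Trace (checkRule q base) D T s ![p₀, p₁] [] (3, word q u v x, word q pu pv 0) pos := by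
  have hc₀ : (D p₀).c = 0 := by rw [h₀]; exact Word.c_word (Nat.zero_le _) _ _
  have hb₀ : (D p₀).b = v := by rw [h₀]; exact Word.b_word (by omega) _ _
  induction l generalizing v p₀ p₁ b s with
  | nil =>
    have hl' : D (p₁ + b.length) = Word.top q := hl
    have hE'' : p₁ + b.length = E := by simpa [recordCount] using hE'
    refine Or.inl ⟨List.IsChain.singleton _, b.length + 1, (2, s.2), ![p₀, p₁ + b.length], ?_, ?_,
      rfl⟩
    · omega
    · refine (check_skip hs hc₀ hb).trans (T' := 1) (o' := []) ?_
      refine Trace.step (x := none) (a := none) (s₁ := (2, s.2)) ?_ (Trace.zero _ _)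
      have h1 : (Word.top q).c = 0 := Word.c_word (Nat.zero_le _) _ _
      have h2 : (Word.top q).a = q := Word.a_word le_rfl _ _
      simp [checkRule, hs, hc₀, hl', h1, h2]
  | cons w l ih =>
    obtain ⟨h1, h2, h3⟩ := hl
    have hcount : p₁ + b.length + ((adj w).length + 1 + recordCount adj l) = E := by
      rw [← hE']
      simp [recordCount]
    have ha₁ : (D (p₁ + b.length)).a = (adj w).length := by
      rw [h1]; exact Word.a_word (by omega) _ _
    have hb₁ : (D (p₁ + b.length)).b = w := by
      rw [h1]; exact Word.b_word (by omega) _ _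
    have hc₁ : (D (p₁ + b.length)).c = 0 := by
      rw [h1]; exact Word.c_word (Nat.zero_le _) _ _
    -- Positions are stored relative to `base`, which keeps them small enough for an entry of a
    -- word.
    obtain ⟨pu, hpu⟩ := Nat.exists_eq_add_of_le (show base ≤ p₀ + 1 by omega)
    obtain ⟨pv, hpv⟩ := Nat.exists_eq_add_of_le (show base ≤ p₁ + b.length + 1 by omega)
    have t1 := check_skip (base := base) hs hc₀ hb
    have t2 : Trace (checkRule q base) D 2 s ![p₀, p₁ + b.length] []
        (0, word q v w 0, word q pu pv 0) ![p₀ + 1, p₁ + b.length + 1] := by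
      refine Trace.step (x := none) (a := some 0) (s₁ := (1, word q v 0 0, word q pu 0 0)) ?_ ?_
      · have h4 : (adj w).length ≠ q := by omega
        simp [checkRule, hs, hc₀, hc₁, ha₁, h4, hb₀, hpu]
      · rw [advance_zero]
        refine Trace.step (x := none) (a := some 1) (s₁ := (0, word q v w 0, word q pu pv 0)) ?_ ?_
        · have h4 : (word q v 0 0).a = v := Word.a_word (by omega) _ _
          have h5 : (word q pu 0 0).a = pu := Word.a_word (by omega) _ _
          simp [checkRule, hb₁, h4, h5, hpv]
        · rw [advance_one]
          exact Trace.zero _ _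
    have t3 := t1.trans t2
    have hdeg' := List.pairwise_cons.1 hdeg
    rcases check_compare (base := base) (u := v) (v := w) (pu := pu) (pv := pv)
      (by omega) (by omega) (hadj v) (hadj w) hv h2 with
      ⟨g1, b', g2, g3, g4⟩ | ⟨x, g1, g2, g3, T, pos, g4, g5⟩
    · have g5 := g2.length_le
      have e : p₁ + b.length + 1 + ((adj w).length - b'.length) + b'.length =
        p₁ + b.length + 1 + (adj w).length := by omega
      -- Behind the entries of `v` the first cursor stands on the header of `w`, which is the first
      -- vertex of the next pair. So neither cursor ever moves back, and the sum of the positions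
      -- bounds the number of steps.
      have hih := ih hdeg'.2 (s := (0, word q v w 0, word q pu pv 0)) (p₀ := p₁ + b.length) rfl
        (by omega) h1 h2 g4 e.symm (by rwa [e]) (by omega) hc₁ hb₁
      rw [hlen] at g3
      have t4 := t3.trans g3
      rcases hih with ⟨i1, T, s', pos, i2, i3, i4⟩ |
        ⟨u, v', x, pu', pv', T, pos, i1, i2, i3, i4, i5, i6, i7, i8, i9, i10⟩
      · refine Or.inl ⟨List.IsChain.cons_cons (fun x hx hxw => g1 x hx
          (fun h => hxw (Fin.ext h))) i1, _, s', pos, ?_, t4.trans i3, i4⟩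
        omega
      · exact Or.inr ⟨u, v', x, pu', pv', _, pos, i1, i2, i3, i4, i5, i6, i7, i8, by omega,
          t4.trans i10⟩
    · exact Or.inr ⟨v, w, x, pu, pv, _, pos, hdeg'.1 w (by simp), g1, fun h => g2 (by rw [h]), g3,
        by omega, by omega, by rwa [← hpu], by rwa [← hpv], by omega, t3.trans g5⟩

theorem advance_single (i : ℕ) : advance ![i] (some 0) = ![i + 1] := by
  funext k
  fin_cases k
  simp [advance]

/-- The rule that looks for the entry `x` of the vertex `u`. -/
def searchRule (u x : ℕ) : Rule 1 (Word q) Bool := fun s _ head =>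
  if s then (s, none, none)
  else if (head 0).b = u ∧ (head 0).c = x + 1 then (true, none, none)
  else (s, some 0, none)

theorem search_trace {D : ℕ → Word q} {u x p len : ℕ} :
    ∃ s pos, Trace (searchRule u x) D len false ![p] [] s pos ∧
      (s = true ↔ ∃ r ∈ window D p len, Word.b r = u ∧ Word.c r = x + 1) := by
  induction len generalizing p with
  | zero => exact ⟨false, ![p], Trace.zero _ _, by simp⟩
  | succ len ih =>
    by_cases h : (D p).b = u ∧ (D p).c = x + 1
    · refine ⟨true, ![p], Trace.step (x := none) (a := none) (s₁ := true) ?_ (Trace.idle ?_ _), ?_⟩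
      · simp [searchRule, h]
      · simp [searchRule]
      · simp only [window_succ, true_iff]
        exact ⟨D p, by simp, h⟩
    · obtain ⟨s, pos, h1, h2⟩ := ih (p := p + 1)
      refine ⟨s, pos, Trace.step (x := none) (a := some 0) (s₁ := false) ?_ ?_, ?_⟩
      · simp [searchRule, h]
      · rwa [advance_single]
      · rw [h2, window_succ]
        simp [h]

/-- The rule that writes the vertices of the independent set. The first entry of the state counts
the vertices seen before. -/
def selectRule (n q : ℕ) : Rule 1 (Word q) (Word q) := fun s _ head =>
  if (head 0).c = 0 then
    (word q (s.a + 1) 0 0, some 0,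
      if (head 0).a + s.a + 1 < n then some (word q 0 0 (head 0).b) else none)
  else (s, some 0, none)

theorem select_skip {D : ℕ → Word q} {p : ℕ} {s : Word q} {l : List (Fin n)} (h : Entries D p l) :
    Trace (selectRule n q) D l.length s ![p] [] s ![p + l.length] := by
  induction l generalizing p with
  | nil => exact Trace.zero _ _
  | cons w l ih =>
    have h1 := ih h.2
    rw [List.length_cons, Nat.add_comm l.length, ← Nat.add_assoc]
    rw [Nat.add_comm 1]
    refine Trace.step (x := none) (a := some 0) (s₁ := s) ?_ (by rwa [advance_single])
    simp [selectRule, h.1]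

theorem select_trace {D : ℕ → Word q} {adj : Fin n → List (Fin n)} (hn : n ≤ q)
    (hadj : ∀ v, (adj v).length ≤ q) {p i : ℕ} {l : List (Fin n)} (hi : i + l.length ≤ q)
    (h : HasRecords D adj p l) :
    ∃ s pos, Trace (selectRule n q) D (recordCount adj l) (word q i 0 0) ![p]
      ((select adj i l).map fun v : Fin n => word q 0 0 v) s pos := by
  induction l generalizing p i with
  | nil => exact ⟨_, _, Trace.zero _ _⟩
  | cons v l ih =>
    obtain ⟨h1, h2, h3⟩ := h
    rw [List.length_cons] at hi
    obtain ⟨s, pos, h4⟩ := ih (i := i + 1) (by omega) h3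
    have ha : (D p).a = (adj v).length := by rw [h1]; exact Word.a_word (hadj v) _ _
    have hb : (D p).b = v := by rw [h1]; exact Word.b_word (by omega) _ _
    have hc : (D p).c = 0 := by rw [h1]; exact Word.c_word (Nat.zero_le _) _ _
    have hi' : (word q i 0 0).a = i := Word.a_word (by omega) _ _
    have h5 := (select_skip (s := word q (i + 1) 0 0) h2).trans h4
    have e : recordCount adj (v :: l) = (adj v).length + recordCount adj l + 1 := by
      simp only [recordCount, List.map_cons, List.sum_cons]
      omega
    refine ⟨s, pos, ?_⟩
    rw [e]
    by_cases hv : (adj v).length + i + 1 < n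
    · rw [select, if_pos hv, List.map_cons]
      refine Trace.step (x := some (word q 0 0 v)) (a := some 0) (s₁ := word q (i + 1) 0 0) ?_ ?_
      · simp [selectRule, ha, hb, hc, hi', hv]
      · rwa [advance_single]
    · rw [select, if_neg hv]
      refine Trace.step (x := none) (a := some 0) (s₁ := word q (i + 1) 0 0) ?_ ?_
      · simp [selectRule, ha, hc, hi', hv]
      · rwa [advance_single]

end Check

/-! ### The sorted list of records -/

section Sorted

variable {n q : ℕ}

theorem vertexRecords_perm {l l' : List (Fin n)} (h : l.Perm l') (v : Fin n) :
    (vertexRecords q l v).Perm (vertexRecords q l' v) := by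
  rw [vertexRecords, vertexRecords, h.length_eq]
  exact (h.map _).cons _

theorem mem_vertexRecords {l : List (Fin n)} {v : Fin n} {x : Word q} :
    x ∈ vertexRecords q l v ↔
      x = header q l.length v ∨ ∃ w ∈ l, x = entry q l.length v w := by
  simp [vertexRecords, eq_comm]

theorem le_top (x : Word q) (hx : x.a < q) : x ≤ Word.top q := by
  rw [Word.le_iff, Word.top, Word.a_word le_rfl]
  exact Or.inl hx

/-- The records of all vertices in sorted order, with the vertices sorted by degree. -/
theorem exists_sorted_records (adj : Fin n → List (Fin n)) (hnd : ∀ v, (adj v).Nodup)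
    (hn : n ≤ q) (hq : ∀ v, (adj v).length < q) :
    ∃ (l : List (Fin n)) (srt : Fin n → List (Fin n)), l.Perm (List.finRange n) ∧
      (∀ v, (srt v).Perm (adj v) ∧ (srt v).Pairwise (· < ·)) ∧
      (l.Pairwise fun u v => (srt u).length ≤ (srt v).length) ∧
      ∀ k, (l.flatMap (fun v => vertexRecords q (srt v) v) ++
          List.replicate k (Word.top q)).Pairwise (· ≤ ·) ∧
        (l.flatMap (fun v => vertexRecords q (srt v) v) ++ List.replicate k (Word.top q)).Perm
          ((List.finRange n).flatMap (fun v => vertexRecords q (adj v) v) ++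
            List.replicate k (Word.top q)) := by
  classical
  set srt : Fin n → List (Fin n) := fun v => (adj v).insertionSort (· ≤ ·) with hsrt
  have hperm : ∀ v, (srt v).Perm (adj v) := fun v => List.perm_insertionSort _ _
  have hlen : ∀ v, (srt v).length = (adj v).length := fun v => (hperm v).length_eq
  have hlt : ∀ v, (srt v).Pairwise (· < ·) := fun v =>
    ((List.pairwise_insertionSort (· ≤ ·) (adj v)).and ((hperm v).nodup_iff.2 (hnd v))).imp
      fun h => lt_of_le_of_ne h.1 h.2
  -- Headers compare by degree and then by vertex number. Breaking ties in this way makes the vertex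
  -- order agree with the lexicographic order of all records.
  set r : Fin n → Fin n → Prop := fun u v => header q (adj u).length u ≤ header q (adj v).length v
    with hr
  have : Std.Total r := ⟨fun u v => le_total _ _⟩
  have : IsTrans (Fin n) r := ⟨fun u v w h h' => le_trans h h'⟩
  have hlperm := List.perm_insertionSort r (List.finRange n)
  have hlsort := (List.pairwise_insertionSort r (List.finRange n)).and
    (hlperm.nodup_iff.2 (List.nodup_finRange n))
  have hord : ∀ {u v : Fin n}, r u v → u ≠ v → (adj u).length < (adj v).length ∨
      (adj u).length = (adj v).length ∧ (u : ℕ) < v := by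
    intro u v h huv
    have hu := u.2
    have hv := v.2
    have huv' : (u : ℕ) ≠ v := fun h => huv (Fin.ext h)
    simp only [hr, header, Word.le_iff, Word.a_word (hq u).le, Word.a_word (hq v).le,
      Word.b_word (show (u : ℕ) ≤ q by omega), Word.b_word (show (v : ℕ) ≤ q by omega)] at h
    omega
  have ha : ∀ (v : Fin n), ∀ x ∈ vertexRecords q (srt v) v, x.a = (adj v).length ∧ x.b = v := by
    intro v x hx
    have hv := v.2
    rcases mem_vertexRecords.1 hx with rfl | ⟨w, -, rfl⟩
    · exact ⟨by rw [hlen, header, Word.a_word (hq v).le], Word.b_word (by omega) _ _⟩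
    · exact ⟨by rw [hlen, entry, Word.a_word (hq v).le], Word.b_word (by omega) _ _⟩
  refine ⟨(List.finRange n).insertionSort r, srt, hlperm, fun v => ⟨hperm v, hlt v⟩, ?_, ?_⟩
  · refine hlsort.imp fun {u v} h => ?_
    have := hord h.1 h.2
    rw [hlen, hlen]
    omega
  intro k
  refine ⟨?_, ?_⟩
  · rw [List.pairwise_append]
    refine ⟨List.pairwise_flatMap.2 ⟨?_, ?_⟩, List.pairwise_replicate.2 (Or.inr le_rfl), ?_⟩
    · intro v _
      have hv := v.2
      rw [vertexRecords, List.pairwise_cons]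
      refine ⟨?_, List.pairwise_map.2 ((hlt v).imp fun {w w'} h => ?_)⟩
      · intro x hx
        obtain ⟨w, -, rfl⟩ := List.mem_map.1 hx
        rw [Word.le_iff, header, entry, Word.a_word (hlen v ▸ (hq v).le),
          Word.a_word (hlen v ▸ (hq v).le), Word.b_word (by omega), Word.b_word (by omega),
          Word.c_word (Nat.zero_le _)]
        exact Or.inr ⟨rfl, Or.inr ⟨rfl, Nat.zero_le _⟩⟩
      · have := w.2
        have := w'.2
        have := Fin.lt_def.1 h
        rw [Word.le_iff, entry, entry, Word.a_word (hlen v ▸ (hq v).le),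
          Word.a_word (hlen v ▸ (hq v).le), Word.b_word (by omega), Word.b_word (by omega),
          Word.c_word (by omega), Word.c_word (by omega)]
        exact Or.inr ⟨rfl, Or.inr ⟨rfl, by omega⟩⟩
    · refine hlsort.imp fun {u v} h x hx y hy => ?_
      have h1 := ha u x hx
      have h2 := ha v y hy
      have h3 := hord h.1 h.2
      rw [Word.le_iff, h1.1, h1.2, h2.1, h2.2]
      omega
    · intro x hx y hy
      obtain ⟨v, -, hx⟩ := List.mem_flatMap.1 hx
      rw [List.eq_of_mem_replicate hy]
      exact le_top x ((ha v x hx).1 ▸ hq v)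
  · exact (hlperm.flatMap fun v _ => vertexRecords_perm (hperm v) v).append_right _

/-- `Entries` also demands a word with last entry `0` behind the list. It is the first word of
`rest`, or it is supplied separately if `rest` is empty. -/
theorem entries_of_window {D : ℕ → Word q} (hn : n ≤ q) {p d : ℕ} {v : Fin n}
    {l : List (Fin n)} {rest : List (Word q)}
    (h : window D p (l.length + rest.length) = l.map (entry q d v) ++ rest) :
    (rest = [] → (D (p + l.length)).c = 0) → (∀ x ∈ rest.head?, x.c = 0) → Entries D p l := by
  intro h1 h2
  induction l generalizing p with
  | nil =>
    cases rest with
    | nil => exact h1 rfl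
    | cons x rest =>
      rw [List.length_cons, ← Nat.add_assoc, window_succ] at h
      have h3 := (List.cons.inj h).1
      have := h2 x (by simp)
      rwa [← h3] at this
  | cons w l ih =>
    have hw := w.2
    rw [List.length_cons, Nat.add_right_comm, window_succ, List.map_cons, List.cons_append] at h
    obtain ⟨h3, h4⟩ := List.cons.inj h
    refine ⟨by rw [h3]; exact Word.c_word (by omega) _ _, ih h4 fun h => ?_⟩
    have := h1 h
    rwa [List.length_cons, Nat.add_comm l.length, ← Nat.add_assoc] at this

theorem length_records (srt : Fin n → List (Fin n)) (l : List (Fin n)) :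
    (l.flatMap fun v => vertexRecords q (srt v) v).length = recordCount srt l := by
  simp [List.length_flatMap, recordCount, length_vertexRecords]

theorem hasRecords_of_window {D : ℕ → Word q} (hn : n ≤ q) {srt : Fin n → List (Fin n)}
    {l : List (Fin n)} {p : ℕ}
    (h : window D p (recordCount srt l + 1) =
      l.flatMap (fun v => vertexRecords q (srt v) v) ++ [Word.top q]) : HasRecords D srt p l := by
  induction l generalizing p with
  | nil =>
    change D p = Word.top q
    simpa [window_succ, recordCount] using h
  | cons v l ih =>
    have e : recordCount srt (v :: l) + 1 =
        1 + ((srt v).length + (recordCount srt l + 1)) := by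
      simp only [recordCount, List.map_cons, List.sum_cons]
      omega
    rw [e, window_add, window_add, window_succ, window_zero, List.flatMap_cons, vertexRecords,
      List.cons_append, List.cons_append, List.cons_append, List.nil_append,
      List.append_assoc] at h
    obtain ⟨h1, h2⟩ := List.cons.inj h
    obtain ⟨h3, h4⟩ := List.append_inj h2 (by simp)
    refine ⟨h1, ?_, ih h4⟩
    refine entries_of_window hn (d := (srt v).length) (v := v)
      (rest := l.flatMap (fun v => vertexRecords q (srt v) v) ++ [Word.top q]) ?_ (by simp) ?_
    · rw [List.length_append, length_records, List.length_singleton, window_add, h3, h4]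
    · intro x hx
      cases l with
      | nil =>
        have hx' : Word.top q = x := by simpa using hx
        rw [← hx']
        exact Word.c_word (Nat.zero_le _) _ _
      | cons w l =>
        have hx' : header q (srt w).length w = x := by
          simpa [vertexRecords] using hx
        rw [← hx']
        exact Word.c_word (Nat.zero_le _) _ _

end Sorted

/-! ### Effect of the passes on sorted records -/

section Layout

variable {n q m base : ℕ} {G : SimpleGraph (Fin n)} {D : ℕ → Word q}
  {srt : Fin n → List (Fin n)} {l : List (Fin n)}

/-- From position `base` on, `D` holds the sorted list of all records of the graph `G` with `m`
edges. -/
structure SortedRecords (G : SimpleGraph (Fin n)) (m : ℕ) (D : ℕ → Word q) (base : ℕ)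
    (srt : Fin n → List (Fin n)) (l : List (Fin n)) : Prop where
  perm : l.Perm (List.finRange n)
  adj : IsAdjacencyLists G srt
  sorted : ∀ v, (srt v).Pairwise (· < ·)
  degree : l.Pairwise fun u v => (srt u).length ≤ (srt v).length
  count : recordCount srt l = n + 2 * m
  window_eq : window D base (n + 2 * m + 1) =
    l.flatMap (fun v => vertexRecords q (srt v) v) ++ [Word.top q]
  lt : n + 2 * m < q

namespace SortedRecords

theorem hasRecords (h : SortedRecords G m D base srt l) : HasRecords D srt base l :=
  hasRecords_of_window (by have := h.lt; omega) (by rw [h.count]; exact h.window_eq)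

theorem mem (h : SortedRecords G m D base srt l) (v : Fin n) : v ∈ l :=
  h.perm.mem_iff.2 (List.mem_finRange v)

theorem length_lt (h : SortedRecords G m D base srt l) (v : Fin n) :
    (srt v).length < n + 2 * m := by
  rw [← h.count]
  have : (srt v).length + 1 ≤ recordCount srt l :=
    List.le_sum_of_mem (List.mem_map.2 ⟨v, h.mem v, rfl⟩)
  omega

theorem length_eq (h : SortedRecords G m D base srt l) : l.length = n := by
  simpa using h.perm.length_eq

/-- If the scan stops at `u`, `v`, `x`, the degree argument gives some `y`, so the comparison with
`u` and `v` exchanged cannot succeed and stops at a suitable vertex as well. Passes run for a fixed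
number of steps, and the end modes are idle for the surplus. -/
theorem check (h : SortedRecords G m D base srt l) (hn : 0 < n) :
    (IsYesCertificate G (select srt 0 l) ∧ ∃ s pos, s.1 = 2 ∧
      Trace (checkRule q base) D (2 * (n + 2 * m) + 1) (0, word q 0 0 0, word q 0 1 0)
        ![base, base + 1] [] s pos) ∨
    ∃ (u v x y : Fin n) (pu pv : ℕ) (pos pos' : Fin 2 → ℕ), IsAlternating G u v x y ∧
      pu ≤ n + 2 * m ∧ pv ≤ n + 2 * m ∧
      Trace (checkRule q base) D (2 * (n + 2 * m) + 1) (0, word q 0 0 0, word q 0 1 0)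
        ![base, base + 1] [] (3, word q u v x, word q pu pv 0) pos ∧
      Trace (checkRule q base) D (2 * (n + 2 * m) + 1) (0, word q v u 0, word q pv pu 0)
        ![base + pv, base + pu] [] (3, word q v u y, word q pv pu 0) pos' := by
  have hlt := h.lt
  have hrec := h.hasRecords
  have hcount := h.count
  have hdeg := h.degree
  have hlen := h.length_eq
  have hidle : ∀ (s : Fin 4 × Word q × Word q) (pos : Fin 2 → ℕ) (T : ℕ), s.1 = 2 ∨ s.1 = 3 →
      Trace (checkRule q base) D T s pos [] s pos := by
    intro s pos T hs
    refine Trace.idle ?_ T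
    rcases hs with hs | hs <;> simp [checkRule, hs]
  have extend : ∀ {T : ℕ} {s s' : Fin 4 × Word q × Word q} {pos pos' : Fin 2 → ℕ},
      Trace (checkRule q base) D T s pos [] s' pos' → s'.1 = 2 ∨ s'.1 = 3 →
      T ≤ 2 * (n + 2 * m) + 1 →
      Trace (checkRule q base) D (2 * (n + 2 * m) + 1) s pos [] s' pos' := by
    intro T s s' pos pos' h1 h2 h3
    have h4 := h1.trans (hidle s' pos' (2 * (n + 2 * m) + 1 - T) h2)
    rwa [Nat.add_sub_cancel' h3] at h4
  cases l with
  | nil => exact absurd hlen (by simpa using hn.ne)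
  | cons v l =>
    obtain ⟨h1, h2, h3⟩ := hrec
    have hc : recordCount srt (v :: l) = (srt v).length + 1 + recordCount srt l := by
      simp [recordCount]
    -- The initial configuration imitates the end of a comparison: the first cursor is on the first
    -- header and the second one on the entries of the same vertex, which are skipped.
    rcases check_chain (base := base) (E := base + (n + 2 * m)) (p₀ := base) (p₁ := base + 1)
      (b := srt v) (s := (0, word q 0 0 0, word q 0 1 0)) (by omega) (by omega) h.sorted hdeg rfl
      le_rfl h1 h2 h2 rfl h3 (by omega) with
      ⟨g1, T, s', pos, g2, g3, g4⟩ | ⟨u, v', x, pu, pv, T, pos, g1, g2, g3, g4, g5, g6, g7, g8, g9,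
        g10⟩
    · refine Or.inl ⟨?_, s', pos, g4, extend g3 (Or.inl g4) (by omega)⟩
      have hnd : (v :: l).Nodup := h.perm.nodup_iff.2 (List.nodup_finRange n)
      refine isYesCertificate_select h.adj hnd h.mem (pairwise_nested_of_isChain (g1.imp ?_) hnd)
      intro u w huw y hy hyw
      exact ((h.adj w).2 y).1 (huw y (((h.adj u).2 y).2 hy) hyw)
    · have hx : G.Adj u x := ((h.adj u).2 x).1 g2
      have hvx : ¬ G.Adj v' x := fun hv => g4 (((h.adj v').2 x).2 hv)
      obtain ⟨y, hy, hyu, huy⟩ := exists_alternating h.adj g1 hx g3 hvx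
      have hu := u.2
      have hv' := v'.2
      -- The recorded positions of the two lists allow the comparison to restart there in the
      -- opposite direction. It need not find the same `y`; any failure will do.
      rcases check_compare (base := base) (u := v') (v := u) (pu := pv) (pv := pu) (by omega)
        (by omega) (h.sorted v') (h.sorted u) g8 g7 with
        ⟨f1, -⟩ | ⟨y', f1, f2, f3, T', pos', f4, f5⟩
      · exact absurd (((h.adj u).2 y).1 (f1 y (((h.adj v').2 y).2 hy)
          (fun h => hyu (Fin.ext h)))) huy
      · have i1 := h.length_lt u
        have i2 := h.length_lt v'
        refine Or.inr ⟨u, v', x, y', pu, pv, pos, pos', ⟨hx, ((h.adj v').2 y').1 f1, hvx,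
          fun hh => f3 (((h.adj u).2 y').2 hh), g3, fun h => f2 (by rw [h])⟩, by omega, by omega,
          extend g10 (Or.inr rfl) (by omega), extend f5 (Or.inr rfl) (by omega)⟩

theorem search (h : SortedRecords G m D base srt l) (u x : Fin n) :
    ∃ s pos, Trace (searchRule u x) D (n + 2 * m + 1) false ![base] [] s pos ∧
      (s = true ↔ G.Adj u x) := by
  obtain ⟨s, pos, h1, h2⟩ := search_trace (D := D) (u := u) (x := x) (p := base)
    (len := n + 2 * m + 1)
  refine ⟨s, pos, h1, h2.trans ?_⟩
  rw [h.window_eq]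
  have hlt := h.lt
  have hu := u.2
  constructor
  · rintro ⟨r, hr, hb, hc⟩
    rcases List.mem_append.1 hr with hr | hr
    · obtain ⟨v, -, hr⟩ := List.mem_flatMap.1 hr
      have hv := v.2
      rcases mem_vertexRecords.1 hr with rfl | ⟨w, hw, rfl⟩
      · rw [header, Word.c_word (Nat.zero_le _)] at hc
        omega
      · have := w.2
        rw [entry, Word.b_word (by omega)] at hb
        rw [entry, Word.c_word (by omega)] at hc
        obtain rfl : v = u := Fin.ext hb
        obtain rfl : w = x := Fin.ext (by omega)
        exact ((h.adj v).2 w).1 hw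
    · rw [List.mem_singleton.1 hr, Word.top, Word.b_word le_rfl] at hb
      omega
  · intro hux
    have := x.2
    refine ⟨entry q (srt u).length u x, List.mem_append_left _ (List.mem_flatMap.2 ⟨u, h.mem u,
      mem_vertexRecords.2 (Or.inr ⟨x, ((h.adj u).2 x).2 hux, rfl⟩)⟩), ?_, ?_⟩
    · exact Word.b_word (by omega) _ _
    · exact Word.c_word (by omega) _ _

theorem select (h : SortedRecords G m D base srt l) :
    ∃ s pos, Trace (selectRule n q) D (n + 2 * m) (word q 0 0 0) ![base]
      ((ThresholdCert.select srt 0 l).map fun v : Fin n => word q 0 0 v) s pos := by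
  have hlt := h.lt
  rw [← h.count]
  exact select_trace (by omega) (fun v => by have := h.length_lt v; omega)
    (by have := h.length_eq; omega) h.hasRecords

end SortedRecords

theorem rowStart_eq (adj : Fin n → List (Fin n)) (hG : G.edgeSet.ncard = m)
    (hadj : IsAdjacencyLists G adj) : rowStart adj n = 2 * m := by
  classical
  have h1 : rowStart adj n = ∑ v, (adj v).length := by
    rw [rowStart, List.take_of_length_le (by simp), List.length_flatten, List.map_ofFn,
      List.sum_ofFn]
    rfl
  have h2 : ∀ v, (adj v).length = G.degree v := by
    intro v
    rw [← List.toFinset_card_of_nodup (hadj v).1, ← G.card_neighborFinset_eq_degree]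
    congr 1
    ext w
    simp [(hadj v).2]
  rw [h1, Finset.sum_congr rfl fun v _ => h2 v, G.sum_degrees_eq_twice_card_edges, ← hG,
    ← SimpleGraph.coe_edgeFinset, Set.ncard_coe_finset]

theorem recordCount_eq (hadj : IsAdjacencyLists G srt) (hG : G.edgeSet.ncard = m)
    (hl : l.Perm (List.finRange n)) : recordCount srt l = n + 2 * m := by
  have h1 := rowStart_eq srt hG hadj
  rw [rowStart, List.take_of_length_le (by simp), List.length_flatten, List.map_ofFn,
    List.sum_ofFn] at h1
  rw [recordCount, (hl.map _).sum_eq, ← List.ofFn_eq_map, List.sum_ofFn, Finset.sum_add_distrib,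
    ← h1]
  simp [Nat.add_comm]

/-- Sorting the records written by the first pass. -/
theorem sortedRecords_of_perm {adj : Fin n → List (Fin n)} (hadj : IsAdjacencyLists G adj)
    (hG : G.edgeSet.ncard = m) (hq : n + 2 * m < q) {len : ℕ}
    (hs : (window D base len).Pairwise (· ≤ ·)) {k : ℕ}
    (hp : (window D base len).Perm ((List.finRange n).flatMap
      (fun v => vertexRecords q (adj v) v) ++ List.replicate (k + 1) (Word.top q))) :
    ∃ srt l, SortedRecords G m D base srt l := by
  have hdeg : ∀ v, (adj v).length < q := by
    intro v
    have h1 := rowStart_succ adj v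
    have h2 := rowStart_mono adj (show (v : ℕ) + 1 ≤ n from v.2)
    have h3 := rowStart_eq adj hG hadj
    omega
  obtain ⟨l, srt, h1, h2, h3, h4⟩ := exists_sorted_records (q := q) adj (fun v => (hadj v).1)
    (by omega) hdeg
  have hsrt : IsAdjacencyLists G srt := fun v =>
    ⟨(h2 v).1.nodup_iff.2 (hadj v).1, fun w => (h2 v).1.mem_iff.trans ((hadj v).2 w)⟩
  have hcount := recordCount_eq hsrt hG h1
  refine ⟨srt, l, h1, hsrt, fun v => (h2 v).2, h3, hcount, ?_, hq⟩
  -- Two sorted permutations of the same list coincide. `Word.top` follows every record, so the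
  -- padding of the last block ends up behind the records.
  have heq : window D base len = l.flatMap (fun v => vertexRecords q (srt v) v) ++
      List.replicate (k + 1) (Word.top q) :=
    (hp.trans (h4 (k + 1)).2.symm).eq_of_pairwise' hs (h4 (k + 1)).1
  have hlen : len = n + 2 * m + 1 + k := by
    have := congrArg List.length heq
    rw [length_window, List.length_append, length_records, hcount, List.length_replicate] at this
    omega
  rw [hlen, window_add, Nat.add_comm k 1, List.replicate_add, ← List.append_assoc] at heq
  refine (List.append_inj heq ?_).1
  rw [length_window, List.length_append, length_records, hcount]
  rfl

end Layout

/-! ### The algorithm and its correctness -/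

section Main

/-- Words have entries up to `cap n m`. -/
abbrev cap (n m : ℕ) : ℕ := 2 * (n + m + 2)

/-- The block from which on the records are stored. -/
abbrev home (n m : ℕ) : ℕ := 8 * (n + m + 2)

/-- The first block of the scratch space. -/
abbrev spare (n m : ℕ) : ℕ := 16 * (n + m + 2)

/-- The number of blocks of the records. -/
abbrev blocks (B n m : ℕ) : ℕ := (n + 2 * m + 1 + B - 1) / B

/-- The outcome of the decision phase: the number of vertices in the YES-certificate, or the words
`(u, v, x)` and `(v, u, y)` for an alternating cycle, and whether `uv` and `xy` are edges. -/
abbrev Outcome (q : ℕ) : Type := Fin (q + 1) ⊕ (Word q × Word q × Bool × Bool)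

variable {B : ℕ}

/-- Write all records. -/
def recordPass (hB : 0 < B) (n m : ℕ) : Prog B (Word (cap n m)) (Word (cap n m) × ℕ) :=
  pass hB (recordRule n (cap n m)) (2 * n + 2 * m + 1) (home n m) (Word.top _)
    (word (cap n m) 0 0 0) ![1, n + 1]

/-- Compare consecutive adjacency lists, starting with the lists at positions `pu` and `pv`. -/
def checkPass (hB : 0 < B) (n m u v pu pv : ℕ) :
    Prog B (Word (cap n m)) ((Fin 4 × Word (cap n m) × Word (cap n m)) × ℕ) :=
  pass hB (checkRule (cap n m) (home n m * B)) (2 * (n + 2 * m) + 1) (spare n m) (Word.top _)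
    (0, word _ u v 0, word _ pu pv 0) ![home n m * B + pu, home n m * B + pv]

/-- Test whether `u` and `x` are adjacent. -/
def searchPass (hB : 0 < B) (n m u x : ℕ) : Prog B (Word (cap n m)) (Bool × ℕ) :=
  pass hB (searchRule u x) (n + 2 * m + 1) (spare n m) (Word.top _) false ![home n m * B]

/-- Write the independent set to the scratch space. -/
def selectPass (hB : 0 < B) (n m : ℕ) : Prog B (Word (cap n m)) (Word (cap n m) × ℕ) :=
  pass hB (selectRule n (cap n m)) (n + 2 * m) (spare n m) (Word.top _) (word _ 0 0 0)
    ![home n m * B]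

/-- Complete a failed comparison to an alternating cycle. -/
def refute (hB : 0 < B) (n m : ℕ) (z p : Word (cap n m)) :
    Prog B (Word (cap n m)) (Outcome (cap n m)) :=
  (checkPass hB n m z.b z.a p.b p.a).bind fun r =>
  (searchPass hB n m z.a z.b).bind fun s =>
  (searchPass hB n m z.c r.1.2.1.c).bind fun s' =>
  ret (Sum.inr (z, r.1.2.1, s.1, s'.1))

/-- The decision phase. -/
noncomputable def decision (hB : 0 < B) (M n m : ℕ) :
    Prog B (Word (cap n m)) (Outcome (cap n m)) :=
  (recordPass hB n m).bind fun _ =>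
  (mergeSort hB (M / B) (Word.top _) (home n m) (spare n m)
    (Nat.clog (M / B) (blocks B n m)) 0 (blocks B n m)).bind fun _ =>
  (checkPass hB n m 0 0 0 1).bind fun r =>
  if r.1.1 = 2 then (selectPass hB n m).bind fun r => ret (Sum.inl (Fin.ofNat _ r.2))
  else refute hB n m r.1.2.1 r.1.2.2

/-- Print the first `len` words of the `c` blocks from `a` on. -/
def printBlocks {α : Type} : ℕ → ℕ → ℕ → Prog B α Unit
  | 0, _, _ => ret ()
  | c + 1, a, len => (read a fun r => emit ((List.ofFn r).take len) (ret ())).bind fun _ =>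
      printBlocks c (a + 1) (len - B)

/-- Print the words in a list one by one. -/
def printList {α : Type} : List α → Prog B α Unit
  | [] => ret ()
  | x :: l => emit [x] (printList l)

/-- The four vertices of an alternating cycle in the order of a NO-certificate. -/
def quadruple {β : Type} (u v x y : β) (s s' : Bool) : List β :=
  if s then (if s' then [u, v, y, x] else [x, u, v, y])
    else (if s' then [u, x, y, v] else [u, x, v, y])

/-- The output phase. -/
def report (n m : ℕ) : Outcome (cap n m) → Prog B (Word (cap n m)) Unit
  | Sum.inl len => printBlocks ((len + B - 1) / B) (spare n m) len
  | Sum.inr (z, z', s, s') =>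
    printList ((quadruple z.a z.b z.c z'.c s s').map fun i => word _ 0 0 i)

theorem length_padded {α : Type} (hB : 0 < B) (o : List α) (pad : α) :
    (padded B o pad).length = (o.length + B - 1) / B * B := by
  rw [padded, List.length_append, List.length_replicate]
  generalize o.length = N
  have h1 := Nat.div_add_mod N B
  have h2 := Nat.mod_lt N hB
  have h3 := Nat.mul_comm B (N / B)
  have h4 : (N / B + 1) * B = N / B * B + B := Nat.succ_mul _ _
  rcases Nat.eq_zero_or_pos (N % B) with h | h
  · rw [h, Nat.sub_zero, Nat.mod_self, Nat.add_zero,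
      Nat.div_eq_of_lt_le (k := N / B) (by omega) (by rw [h4]; omega)]
    omega
  · rw [Nat.mod_eq_of_lt (show B - N % B < B by omega),
      Nat.div_eq_of_lt_le (k := N / B + 1) (by omega) (by rw [Nat.succ_mul]; omega), h4]
    omega

theorem overwrite_padded_nil {α : Type} (D : ℕ → α) (p : ℕ) (pad : α) :
    overwrite D p (padded B [] pad) = D := by
  funext i
  simp [overwrite, padded]

/-- Here `len` is the number of blocks of records; every scan takes at most twice as many steps as
these blocks have words. -/
theorem le_of_mul_pass_le {t T k len : ℕ} (hB : 0 < B) (h : B * t ≤ 2 * T + 2 * k * B + B)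
    (hT : T ≤ 2 * (len * B)) : t ≤ 4 * len + 2 * k + 1 := by
  refine Nat.le_of_mul_le_mul_left (h.trans ?_) hB
  nlinarith

theorem printBlocks_prints {α : Type} (D : ℕ → α) (c a len : ℕ) :
    (printBlocks (B := B) c a len).Prints D ((window D (a * B) (c * B)).take len) (2 * c) := by
  induction c generalizing a len with
  | zero =>
    rw [Nat.zero_mul, window_zero, List.take_nil]
    exact Prints.ret
  | succ c ih =>
    have h := ih (a + 1) (len - B)
    rw [Nat.add_mul c, Nat.one_mul, Nat.add_comm (c * B), window_add, List.take_append,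
      length_window, window_block, ← Nat.succ_mul]
    exact Prints.read (Prints.emit h)

theorem printList_prints {α : Type} (D : ℕ → α) (l : List α) :
    (printList (B := B) l).Prints D l l.length := by
  induction l with
  | nil => exact Prints.ret
  | cons x l ih => exact Prints.emit ih

variable {n m : ℕ} {G : SimpleGraph (Fin n)}

theorem le_blocks (hB : 0 < B) : n + 2 * m + 1 ≤ blocks B n m * B := by
  have h := length_padded hB (List.replicate (n + 2 * m + 1) ()) ()
  rw [padded, List.length_append, List.length_replicate] at h
  rw [blocks, ← h]
  omega

/-- None of the three passes has output, so external memory is unchanged. The comparison with two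
cursors costs `4 * blocks B n m + 5`, and each search with one cursor `4 * blocks B n m + 3`. -/
theorem refute_evals (hB : 0 < B) {D : ℕ → Word (cap n m)} {srt : Fin n → List (Fin n)}
    {l : List (Fin n)} (h : SortedRecords G m D (home n m * B) srt l) {u v x y : Fin n}
    {pu pv : ℕ} {pos : Fin 2 → ℕ} (hpu : pu ≤ n + 2 * m) (hpv : pv ≤ n + 2 * m)
    (ht : Trace (checkRule (cap n m) (home n m * B)) D (2 * (n + 2 * m) + 1)
      (0, word _ v u 0, word _ pv pu 0) ![home n m * B + pv, home n m * B + pu] []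
      (3, word _ v u y, word _ pv pu 0) pos) :
    ∃ s s' t, (refute hB n m (word _ u v x) (word _ pu pv 0)).Evals D
      (Sum.inr (word _ u v x, word _ v u y, s, s')) D t ∧ (s = true ↔ G.Adj u v) ∧
      (s' = true ↔ G.Adj x y) ∧ t ≤ 12 * blocks B n m + 11 := by
  have hlen := le_blocks (n := n) (m := m) hB
  have hQ : n + m + 2 ≤ (n + m + 2) * B := Nat.le_mul_of_pos_right _ hB
  have hspare : spare n m * B = 16 * ((n + m + 2) * B) := by rw [spare, Nat.mul_assoc]
  have hhome : home n m * B = 8 * ((n + m + 2) * B) := by rw [home, Nat.mul_assoc]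
  have hcap : cap n m = 2 * (n + m + 2) := rfl
  have hu := u.2
  have hv := v.2
  have hx := x.2
  have hy := y.2
  obtain ⟨t₁, e1, f1⟩ := pass_evals hB (base := spare n m) (Word.top _) ht (by
    rw [hspare, hhome]
    intro i
    fin_cases i
    · change 8 * ((n + m + 2) * B) + pv + _ < _
      omega
    · change 8 * ((n + m + 2) * B) + pu + _ < _
      omega)
  obtain ⟨s, pos₂, g2, g2'⟩ := h.search u v
  obtain ⟨t₂, e2, f2⟩ := pass_evals hB (base := spare n m) (Word.top _) g2 (by
    rw [hspare, hhome]
    intro i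
    fin_cases i
    change 8 * ((n + m + 2) * B) + _ < _
    omega)
  obtain ⟨s', pos₃, g3, g3'⟩ := h.search x y
  obtain ⟨t₃, e3, f3⟩ := pass_evals hB (base := spare n m) (Word.top _) g3 (by
    rw [hspare, hhome]
    intro i
    fin_cases i
    change 8 * ((n + m + 2) * B) + _ < _
    omega)
  rw [overwrite_padded_nil] at e1 e2 e3
  have f1' := le_of_mul_pass_le hB f1 (len := blocks B n m) (by omega)
  have f2' := le_of_mul_pass_le hB f2 (len := blocks B n m) (by omega)
  have f3' := le_of_mul_pass_le hB f3 (len := blocks B n m) (by omega)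
  refine ⟨s, s', t₁ + (t₂ + (t₃ + 0)), ?_, g2', g3', by omega⟩
  rw [refute, Word.a_word (by omega), Word.b_word (by omega), Word.c_word (by omega),
    Word.a_word (by omega), Word.b_word (by omega)]
  refine e1.bind ?_
  refine e2.bind ?_
  dsimp only
  rw [Word.c_word (by omega)]
  exact e3.bind Evals.ret

/-- The decision phase is correct. -/
theorem decision_evals {M : ℕ} (hB : 0 < B) (hM : 2 * B ≤ M) (hn : 0 < n)
    {adj : Fin n → List (Fin n)} (hadj : IsAdjacencyLists G adj) (hG : G.edgeSet.ncard = m) :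
    ∃ r D t, (decision hB M n m).Evals (inputWords (cap n m) adj) r D t ∧
      t ≤ 22 * blocks B n m + 21 + 7 * (blocks B n m * Nat.clog (M / B) (blocks B n m)) ∧
      ((∃ β : List (Fin n), IsYesCertificate G β ∧ r = Sum.inl (Fin.ofNat _ β.length) ∧
        window D (spare n m * B) ((β.length + B - 1) / B * B) =
          padded B (β.map fun v : Fin n => word _ 0 0 v) (Word.top _)) ∨
      ∃ (u v x y : Fin n) (s s' : Bool), IsAlternating G u v x y ∧
        r = Sum.inr (word _ u v x, word _ v u y, s, s') ∧ (s = true ↔ G.Adj u v) ∧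
        (s' = true ↔ G.Adj x y)) := by
  have hlen := le_blocks (n := n) (m := m) hB
  have hQ : n + m + 2 ≤ (n + m + 2) * B := Nat.le_mul_of_pos_right _ hB
  have hspare : spare n m * B = 16 * ((n + m + 2) * B) := by rw [spare, Nat.mul_assoc]
  have hhome : home n m * B = 8 * ((n + m + 2) * B) := by rw [home, Nat.mul_assoc]
  have hcap : cap n m = 2 * (n + m + 2) := rfl
  have hrow := rowStart_eq adj hG hadj
  have hq : n + 2 * m < cap n m := by omega
  have hk : 2 ≤ M / B := (Nat.le_div_iff_mul_le hB).2 hM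
  have hhome' : home n m = 8 * (n + m + 2) := rfl
  have hspare' : spare n m = 16 * (n + m + 2) := rfl
  have hblocks : blocks B n m ≤ n + 2 * m + 1 := by
    rw [blocks, Nat.div_le_iff_le_mul_add_pred hB]
    have := Nat.le_mul_of_pos_left (n + 2 * m + 1) hB
    omega
  have hblocks' : 1 ≤ blocks B n m := by
    by_contra h
    obtain h : blocks B n m = 0 := by omega
    rw [h] at hlen
    omega
  obtain ⟨s₁, pos₁, g1⟩ := record_trace (adj := adj) (q := cap n m) (by omega)
    (2 * n + 2 * m + 1) (by omega)
  have hout : ((List.finRange n).flatMap (fun v => vertexRecords (cap n m) (adj v) v) ++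
      [Word.top (cap n m)]).length = n + 2 * m + 1 := by
    rw [List.length_append, length_records, recordCount_eq hadj hG (List.Perm.refl _)]
    rfl
  obtain ⟨t₁, e1, f1⟩ := pass_evals hB (base := home n m) (Word.top _) g1 (by
    rw [hhome]
    intro i
    fin_cases i
    · change 1 + _ < _
      omega
    · change n + 1 + _ < _
      omega)
  have f1' := le_of_mul_pass_le hB f1 (len := blocks B n m) (by omega)
  -- `Nat.clog` is the number of merge levels needed for all blocks. The scratch space lies `8 * (n
  -- + m + 2)` blocks behind the records, more than twice their number of blocks.
  obtain ⟨E, t₂, e2, f2, g2⟩ := mergeSort_evals hB (Word.top (cap n m)) (k := M / B)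
    (a := home n m) (x := spare n m) (lo := 0) (by omega) (Nat.clog (M / B) (blocks B n m))
    hblocks' (Nat.le_pow_clog (by omega) _) (by omega)
    (overwrite (inputWords (cap n m) adj) (home n m * B) (padded B
      ((List.finRange n).flatMap (fun v => vertexRecords (cap n m) (adj v) v) ++
        [Word.top (cap n m)]) (Word.top _)))
  have hperm := g2.perm
  have hsort := g2.sorted
  rw [Nat.add_zero (home n m), blocks, ← hout, ← length_padded hB _ (Word.top (cap n m)),
    window_overwrite] at hperm
  rw [Nat.add_zero (home n m), blocks, ← hout, ← length_padded hB _ (Word.top (cap n m))] at hsort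
  obtain ⟨srt, l, hrec⟩ := sortedRecords_of_perm hadj hG hq hsort
    (hperm.trans (List.Perm.of_eq (by rw [padded, List.append_assoc]; rfl)))
  have hpos : ∀ i : Fin 2, (![home n m * B + 0, home n m * B + 1] : Fin 2 → ℕ) i +
      (2 * (n + 2 * m) + 1) < spare n m * B := by
    rw [hspare, hhome]
    intro i
    fin_cases i
    · change 8 * ((n + m + 2) * B) + 0 + _ < _
      omega
    · change 8 * ((n + m + 2) * B) + 1 + _ < _
      omega
  rcases hrec.check hn with ⟨hyes, s, pos, hs, g3⟩ |
    ⟨u, v, x, y, pu, pv, pos, pos', halt, hpu, hpv, g3, g4⟩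
  · obtain ⟨t₃, e3, f3⟩ := pass_evals hB (base := spare n m) (Word.top _) g3 hpos
    rw [overwrite_padded_nil] at e3
    have f3' := le_of_mul_pass_le hB f3 (len := blocks B n m) (by omega)
    obtain ⟨s₄, pos₄, g4⟩ := hrec.select
    obtain ⟨t₄, e4, f4⟩ := pass_evals hB (base := spare n m) (Word.top _) g4 (by
      rw [hspare, hhome]
      intro i
      fin_cases i
      change 8 * ((n + m + 2) * B) + _ < _
      omega)
    have f4' := le_of_mul_pass_le hB f4 (len := blocks B n m) (by omega)
    refine ⟨Sum.inl (Fin.ofNat _ ((select srt 0 l).map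
      fun v : Fin n => word (cap n m) 0 0 v).length), overwrite E (spare n m * B) (padded B
      ((select srt 0 l).map fun v : Fin n => word (cap n m) 0 0 v) (Word.top (cap n m))), t₁ + (t₂ + (t₃ + (t₄ + 0))), ?_, by omega,
      Or.inl ⟨select srt 0 l, hyes, by rw [List.length_map], ?_⟩⟩
    · rw [decision]
      refine e1.bind (e2.bind (e3.bind ?_))
      dsimp only
      rw [if_pos hs]
      exact e4.bind Evals.ret
    · rw [← List.length_map (f := fun v : Fin n => word (cap n m) 0 0 v),
        ← length_padded hB _ (Word.top (cap n m)), window_overwrite]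
  · obtain ⟨t₃, e3, f3⟩ := pass_evals hB (base := spare n m) (Word.top _) g3 hpos
    rw [overwrite_padded_nil] at e3
    have f3' := le_of_mul_pass_le hB f3 (len := blocks B n m) (by omega)
    obtain ⟨s, s', t₄, e4, g5, g6, f4⟩ := refute_evals hB hrec (x := x) hpu hpv g4
    refine ⟨_, E, t₁ + (t₂ + (t₃ + t₄)), ?_, by omega,
      Or.inr ⟨u, v, x, y, s, s', halt, rfl, g5, g6⟩⟩
    rw [decision]
    refine e1.bind (e2.bind (e3.bind ?_))
    dsimp only
    rw [if_neg (by decide)]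
    exact e4

end Main

/-! ### Numerical bounds on program sizes -/

section Size

variable {Q B M : ℕ}

theorem two_mul_add_one_le (hQ : 2 ≤ Q) : 2 * Q + 1 ≤ Q ^ 3 := by
  have h1 : 4 ≤ Q ^ 2 := by nlinarith
  have h2 : Q ^ 3 = Q ^ 2 * Q := by ring
  nlinarith

theorem words_le (hQ : 2 ≤ Q) : (2 * Q + 1) ^ 3 ≤ Q ^ 9 := by
  calc (2 * Q + 1) ^ 3 ≤ (Q ^ 3) ^ 3 := Nat.pow_le_pow_left (two_mul_add_one_le hQ) 3
    _ = Q ^ 9 := by rw [← pow_mul]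

theorem two_pow_le (hQ : 2 ≤ Q) (i : ℕ) : 2 ^ i ≤ Q ^ i := Nat.pow_le_pow_left hQ i

theorem four_mul_le (hQ : 2 ≤ Q) : 4 * Q ≤ Q ^ 3 := by
  have h1 : 4 ≤ Q ^ 2 := by nlinarith
  calc 4 * Q ≤ Q ^ 2 * Q := Nat.mul_le_mul_right _ h1
    _ = Q ^ 3 := by ring

/-- There are at most `Q ^ 24` results, and one more factor `Q` absorbs the sum of the two terms.
Since `M ≥ 2`, `25 ≤ 13 * M`. -/
theorem add_mul_le {N c N' a b : ℕ} (hQ : 2 ≤ Q) (hM : 2 ≤ M) (hN : N ≤ Q ^ (a * M))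
    (hc : c ≤ Q ^ 24) (hN' : N' ≤ Q ^ (b * M)) : N + c * N' ≤ Q ^ ((a + b + 13) * M) := by
  have h0 : 0 < Q := by omega
  have h1 : Q ^ (a * M) ≤ Q ^ (a * M + b * M + 24) := Nat.pow_le_pow_right h0 (by omega)
  have h2 : c * N' ≤ Q ^ (a * M + b * M + 24) := by
    calc c * N' ≤ Q ^ 24 * Q ^ (b * M) := Nat.mul_le_mul hc hN'
      _ = Q ^ (24 + b * M) := by rw [← pow_add]
      _ ≤ _ := Nat.pow_le_pow_right h0 (by omega)
  have h3 : Q ^ (a * M + b * M + 24) * 2 ≤ Q ^ (a * M + b * M + 25) := by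
    rw [pow_succ _ (a * M + b * M + 24)]
    exact Nat.mul_le_mul_left _ hQ
  have h4 : Q ^ (a * M + b * M + 25) ≤ Q ^ ((a + b + 13) * M) := by
    refine Nat.pow_le_pow_right h0 ?_
    rw [Nat.add_mul, Nat.add_mul]
    omega
  omega

/-- The decisive point is `k * B ≤ M`: `k` buffers of `B` words contribute an exponent linear in
`M`. The summands of the exponent stem from `20 * (k + 1)`, the states, the positions (at most `25 *
M`) and the block contents (at most `36 * M`, where the `9` is that of `words_le`). -/
theorem passSize_le {s k T : ℕ} (hQ : 2 ≤ Q) (hB : 1 ≤ B) (hM : 2 * B ≤ M)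
    (hkB : k * B ≤ M) (hs : s ≤ Q ^ 20) (hT : T + 1 ≤ Q ^ (B + 4)) :
    passSize s (((2 * Q + 1) ^ 3) ^ B) k T ≤ Q ^ (75 * M) := by
  have h0 : 0 < Q := by omega
  have h1 : 20 * (k + 1) ≤ Q ^ (5 + k) := by
    have h2 : k + 1 ≤ 2 ^ k := Nat.lt_two_pow_self
    calc 20 * (k + 1) ≤ 2 ^ 5 * 2 ^ k := Nat.mul_le_mul (by norm_num) h2
      _ = 2 ^ (5 + k) := by rw [pow_add]
      _ ≤ _ := two_pow_le hQ _
  have h2 : (T + 1) ^ (k + 4) ≤ Q ^ ((B + 4) * (k + 4)) := by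
    rw [pow_mul]
    exact Nat.pow_le_pow_left hT _
  have h3 : (((2 * Q + 1) ^ 3) ^ B) ^ (3 * k + 2) ≤ Q ^ (9 * B * (3 * k + 2)) := by
    rw [pow_mul, pow_mul]
    exact Nat.pow_le_pow_left (Nat.pow_le_pow_left (words_le hQ) _) _
  have h4 : (B + 4) * (k + 4) ≤ 25 * M := by nlinarith
  have h5 : 9 * B * (3 * k + 2) ≤ 36 * M := by nlinarith
  have h6 : k ≤ M := (Nat.le_mul_of_pos_right k hB).trans hkB
  calc passSize s (((2 * Q + 1) ^ 3) ^ B) k T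
      ≤ Q ^ (5 + k) * Q ^ 20 * Q ^ ((B + 4) * (k + 4)) * Q ^ (9 * B * (3 * k + 2)) :=
        Nat.mul_le_mul (Nat.mul_le_mul (Nat.mul_le_mul h1 hs) h2) h3
    _ = Q ^ (5 + k + 20 + (B + 4) * (k + 4) + 9 * B * (3 * k + 2)) := by
        rw [← pow_add, ← pow_add, ← pow_add]
    _ ≤ Q ^ (75 * M) := Nat.pow_le_pow_right h0 (by omega)

theorem mergeSize_le {k T : ℕ} (hQ : 2 ≤ Q) (hB : 1 ≤ B) (hM : 2 * B ≤ M)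
    (hkB : k * B ≤ M) (hT : T + 1 ≤ Q ^ (B + 4)) :
    mergeSize (((2 * Q + 1) ^ 3) ^ B) k T ≤ Q ^ (75 * M + 2) := by
  have h0 : 0 < Q := by omega
  have h1 := passSize_le (s := 1) hQ hB hM hkB (Nat.one_le_pow _ _ h0) hT
  have h2 : ((2 * Q + 1) ^ 3) ^ B ≤ Q ^ (9 * B) := by
    rw [pow_mul]
    exact Nat.pow_le_pow_left (words_le hQ) _
  have h3 : 2 * ((2 * Q + 1) ^ 3) ^ B + 2 ≤ Q ^ (9 * B + 2) := by
    have h4 : 1 ≤ Q ^ (9 * B) := Nat.one_le_pow _ _ h0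
    have h5 : 4 ≤ Q ^ 2 := by nlinarith
    calc _ ≤ Q ^ (9 * B) * 4 := by omega
      _ ≤ Q ^ (9 * B) * Q ^ 2 := Nat.mul_le_mul_left _ h5
      _ = _ := by rw [pow_add]
  have h4 : (T + 1) * (2 * ((2 * Q + 1) ^ 3) ^ B + 2) ≤ Q ^ (75 * M) := by
    calc _ ≤ Q ^ (B + 4) * Q ^ (9 * B + 2) := Nat.mul_le_mul hT h3
      _ = Q ^ (B + 4 + (9 * B + 2)) := by rw [← pow_add]
      _ ≤ _ := Nat.pow_le_pow_right h0 (by omega)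
  have h5 : 1 ≤ Q ^ (75 * M) := Nat.one_le_pow _ _ h0
  have h6 : 4 ≤ Q ^ 2 := by nlinarith
  have h7 : Q ^ (75 * M) * 4 ≤ Q ^ (75 * M + 2) := by
    rw [pow_add]
    exact Nat.mul_le_mul_left _ h6
  rw [mergeSize]
  omega

end Size

/-! ### Counting the residual programs of the algorithm -/

section Fits

variable {n m B M : ℕ}

theorem card_words : Fintype.card (Word (cap n m)) = (2 * (n + m + 2) + 1) ^ 3 := Word.card

instance : Nonempty (Word (cap n m)) := ⟨Word.top _⟩

/-- The pass accounts for `75` and the composition in `add_mul_le` for `13`. A pass ends in at most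
`Q ^ 20` states with at most `Q ^ 3` output lengths, where `Q = n + m + 2`; this is below the `Q ^
24` admitted there. -/
theorem fits_pass_bind {σ ρ : Type} [Fintype σ] [Nonempty σ] (hB : 0 < B) (hM : 2 * B ≤ M)
    {k T base b : ℕ} {δ : Rule k (Word (cap n m)) σ} {pad : Word (cap n m)} {s : σ}
    {pos : Fin k → ℕ} (hk : k ≤ 2) (hs : Fintype.card σ ≤ (n + m + 2) ^ 20)
    (hT : T + 1 ≤ 4 * (n + m + 2)) (hpos : ∀ i, pos i + T < base * B) (hbase : base ≤ spare n m)
    {f : σ × ℕ → Prog B (Word (cap n m)) ρ}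
    (hf : ∀ r, Fits (32 * (n + m + 2)) ((n + m + 2) ^ (b * M)) Set.univ (f r)) :
    Fits (32 * (n + m + 2)) ((n + m + 2) ^ ((75 + b + 13) * M)) Set.univ
      ((pass hB δ T base pad s pos).bind f) := by
  classical
  have hQ : 2 ≤ n + m + 2 := by omega
  have hspare : spare n m = 16 * (n + m + 2) := rfl
  have hT' : T + 1 ≤ (n + m + 2) ^ 3 := hT.trans (four_mul_le hQ)
  have h1 : Fits (32 * (n + m + 2)) ((n + m + 2) ^ (75 * M)) {r : σ × ℕ | r.2 ≤ T}
      (pass hB δ T base pad s pos) := by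
    refine (pass_fits hB hpos (A := 32 * (n + m + 2)) ?_).mono le_rfl ?_ subset_rfl
    · have := Nat.div_le_self T B
      omega
    · rw [card_words]
      refine passSize_le hQ hB hM ?_ hs (hT'.trans (Nat.pow_le_pow_right (by omega) (by omega)))
      nlinarith
  have h2 := h1.bind (c := (n + m + 2) ^ 24) (F := Finset.univ ×ˢ Finset.range (T + 1)) ?_
    (by rintro ⟨x, y⟩ h; simpa [Nat.lt_succ_iff] using h) (fun r _ => hf r)
  · exact h2.mono le_rfl (add_mul_le hQ (by omega) le_rfl le_rfl le_rfl) subset_rfl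
  · rw [Finset.card_product, Finset.card_univ, Finset.card_range]
    calc _ ≤ (n + m + 2) ^ 20 * (n + m + 2) ^ 3 := Nat.mul_le_mul hs hT'
      _ = (n + m + 2) ^ 23 := by rw [← pow_add]
      _ ≤ _ := Nat.pow_le_pow_right (by omega) (by omega)

theorem card_checkState :
    Fintype.card (Fin 4 × Word (cap n m) × Word (cap n m)) ≤ (n + m + 2) ^ 20 := by
  have hQ : 2 ≤ n + m + 2 := by omega
  rw [Fintype.card_prod, Fintype.card_prod, card_words, Fintype.card_fin]
  calc _ ≤ (n + m + 2) ^ 2 * ((n + m + 2) ^ 9 * (n + m + 2) ^ 9) :=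
        Nat.mul_le_mul (two_pow_le hQ 2) (Nat.mul_le_mul (words_le hQ) (words_le hQ))
    _ = _ := by rw [← pow_add, ← pow_add]

theorem card_words_le : Fintype.card (Word (cap n m)) ≤ (n + m + 2) ^ 20 := by
  rw [card_words]
  exact (words_le (by omega)).trans (Nat.pow_le_pow_right (by omega) (by omega))

theorem fits_checkPass_bind {ρ : Type} (hB : 0 < B) (hM : 2 * B ≤ M) {u v pu pv b : ℕ}
    (hpu : pu ≤ cap n m) (hpv : pv ≤ cap n m)
    {f : _ → Prog B (Word (cap n m)) ρ}
    (hf : ∀ r, Fits (32 * (n + m + 2)) ((n + m + 2) ^ (b * M)) Set.univ (f r)) :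
    Fits (32 * (n + m + 2)) ((n + m + 2) ^ ((75 + b + 13) * M)) Set.univ
      ((checkPass hB n m u v pu pv).bind f) := by
  have hQ : n + m + 2 ≤ (n + m + 2) * B := Nat.le_mul_of_pos_right _ hB
  have hspare : spare n m * B = 16 * ((n + m + 2) * B) := by rw [spare, Nat.mul_assoc]
  have hhome : home n m * B = 8 * ((n + m + 2) * B) := by rw [home, Nat.mul_assoc]
  have hcap : cap n m = 2 * (n + m + 2) := rfl
  refine fits_pass_bind hB hM le_rfl card_checkState (by omega) ?_ le_rfl hf
  rw [hspare, hhome]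
  intro i
  fin_cases i
  · change 8 * ((n + m + 2) * B) + pu + _ < _
    omega
  · change 8 * ((n + m + 2) * B) + pv + _ < _
    omega

theorem home_add_lt {T : ℕ} (hB : 0 < B) (hT : T + 1 ≤ 4 * (n + m + 2)) (i : Fin 1) :
    (![home n m * B] : Fin 1 → ℕ) i + T < spare n m * B := by
  have hQ : n + m + 2 ≤ (n + m + 2) * B := Nat.le_mul_of_pos_right _ hB
  have hspare : spare n m * B = 16 * ((n + m + 2) * B) := by rw [spare, Nat.mul_assoc]
  have hhome : home n m * B = 8 * ((n + m + 2) * B) := by rw [home, Nat.mul_assoc]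
  rw [hspare, hhome]
  fin_cases i
  change 8 * ((n + m + 2) * B) + _ < _
  omega

theorem fits_ret {ρ : Type} (x : ρ) :
    Fits (32 * (n + m + 2)) ((n + m + 2) ^ (0 * M)) Set.univ
      (ret x : Prog B (Word (cap n m)) ρ) :=
  (Fits.ret (Set.mem_univ x)).mono le_rfl (by simp) subset_rfl

theorem fits_searchPass_bind {ρ : Type} (hB : 0 < B) (hM : 2 * B ≤ M) {u x b : ℕ}
    {f : _ → Prog B (Word (cap n m)) ρ}
    (hf : ∀ r, Fits (32 * (n + m + 2)) ((n + m + 2) ^ (b * M)) Set.univ (f r)) :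
    Fits (32 * (n + m + 2)) ((n + m + 2) ^ ((75 + b + 13) * M)) Set.univ
      ((searchPass hB n m u x).bind f) := by
  refine fits_pass_bind hB hM (by norm_num) ?_ (by omega)
    (home_add_lt hB (by omega)) le_rfl hf
  rw [Fintype.card_bool]
  calc 2 ≤ n + m + 2 := by omega
    _ ≤ _ := Nat.le_self_pow (by norm_num) _

/-- Three passes give `3 * (75 + 13) = 264`. -/
theorem refute_fits (hB : 0 < B) (hM : 2 * B ≤ M) (z p : Word (cap n m)) :
    Fits (32 * (n + m + 2)) ((n + m + 2) ^ (264 * M)) Set.univ (refute hB n m z p) :=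
  fits_checkPass_bind hB hM p.b_le p.a_le fun _ => fits_searchPass_bind hB hM fun _ =>
    fits_searchPass_bind hB hM fun _ => fits_ret _

theorem blocks_bounds (hB : 0 < B) : 1 ≤ blocks B n m ∧ blocks B n m ≤ n + 2 * m + 1 ∧
    blocks B n m * B ≤ n + 2 * m + B := by
  have h1 := le_blocks (n := n) (m := m) hB
  refine ⟨?_, ?_, ?_⟩
  · by_contra h
    obtain h : blocks B n m = 0 := by omega
    rw [h] at h1
    omega
  · rw [blocks, Nat.div_le_iff_le_mul_add_pred hB]
    have := Nat.le_mul_of_pos_left (n + 2 * m + 1) hB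
    omega
  · have := Nat.div_mul_le_self (n + 2 * m + 1 + B - 1) B
    rw [blocks]
    omega

/-- From the end: check and refutation give `75 + 264 + 13 = 352`, which dominates the branch with
`selectPass`; preceded by the sort, at most `78 + 352 + 13 = 443`; preceded by the record pass, `75
+ 443 + 13 = 531`. -/
theorem decision_fits (hB : 0 < B) (hM : 2 * B ≤ M) :
    Fits (32 * (n + m + 2)) ((n + m + 2) ^ (531 * M)) Set.univ (decision hB M n m) := by
  have hQ : 2 ≤ n + m + 2 := by omega
  have hQ' : n + m + 2 ≤ (n + m + 2) * B := Nat.le_mul_of_pos_right _ hB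
  have hhome : home n m * B = 8 * ((n + m + 2) * B) := by rw [home, Nat.mul_assoc]
  have hhome' : home n m = 8 * (n + m + 2) := rfl
  have hspare' : spare n m = 16 * (n + m + 2) := rfl
  have hcap : cap n m = 2 * (n + m + 2) := rfl
  have hk : 2 ≤ M / B := (Nat.le_div_iff_mul_le hB).2 hM
  obtain ⟨b1, b2, b3⟩ := blocks_bounds (n := n) (m := m) hB
  have hclog : Nat.clog (M / B) (blocks B n m) ≤ blocks B n m :=
    Nat.clog_le_of_le_pow (Nat.lt_pow_self (by omega)).le
  refine fits_pass_bind (b := 443) hB hM le_rfl card_words_le (by omega) ?_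
    (by omega) fun _ => ?_
  · rw [hhome]
    intro i
    fin_cases i
    · change 1 + _ < _
      omega
    · change n + 1 + _ < _
      omega
  have hsort := mergeSort_fits hB (Word.top (cap n m)) (k := M / B) (a := home n m)
    (x := spare n m) (A := 32 * (n + m + 2)) (T₀ := blocks B n m * B) (by omega)
    (Nat.clog (M / B) (blocks B n m)) (lo := 0) b1 (Nat.le_pow_clog (by omega) _) (by omega)
    (by omega) le_rfl
  have hsort' : (Nat.clog (M / B) (blocks B n m) + 1) * blocks B n m *
      mergeSize (Fintype.card (Word (cap n m)) ^ B) (M / B) (blocks B n m * B) ≤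
      (n + m + 2) ^ (78 * M) := by
    have h1 : 2 * (n + m + 2) ≤ (n + m + 2) ^ 2 := by nlinarith
    have h2 : blocks B n m * B + 1 ≤ (n + m + 2) ^ (B + 4) := by
      have h3 : B ≤ 2 ^ B := Nat.lt_two_pow_self.le
      have h4 := two_pow_le hQ B
      have h5 : 1 ≤ (n + m + 2) ^ B := Nat.one_le_pow _ _ (by omega)
      have h6 : 4 ≤ (n + m + 2) ^ 2 := by nlinarith
      calc blocks B n m * B + 1 ≤ (n + m + 2) ^ 2 + (n + m + 2) ^ B := by omega
        _ ≤ (n + m + 2) ^ B * ((n + m + 2) ^ 2 * (n + m + 2) ^ 2) := by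
            generalize (n + m + 2) ^ B = R at h5
            generalize (n + m + 2) ^ 2 = P at h6
            have h7 : P ≤ R * P := Nat.le_mul_of_pos_left P h5
            have h8 : R ≤ R * P := Nat.le_mul_of_pos_right R (by omega)
            have h9 : R * P * 2 ≤ R * P * P := Nat.mul_le_mul_left _ (by omega)
            rw [← Nat.mul_assoc]
            omega
        _ = _ := by rw [← pow_add, ← pow_add]
    rw [card_words]
    calc _ ≤ (n + m + 2) ^ 2 * (n + m + 2) ^ 2 * (n + m + 2) ^ (75 * M + 2) :=
          Nat.mul_le_mul (Nat.mul_le_mul (by omega) (by omega))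
            (mergeSize_le hQ hB hM (Nat.div_mul_le_self M B) h2)
      _ = (n + m + 2) ^ (2 + 2 + (75 * M + 2)) := by rw [← pow_add, ← pow_add]
      _ ≤ _ := Nat.pow_le_pow_right (by omega) (by omega)
  have hrest : Fits (32 * (n + m + 2)) ((n + m + 2) ^ (352 * M)) Set.univ
      ((checkPass hB n m 0 0 0 1).bind fun r =>
        if r.1.1 = 2 then (selectPass hB n m).bind fun r => ret (Sum.inl (Fin.ofNat _ r.2))
        else refute hB n m r.1.2.1 r.1.2.2) := by
    refine fits_checkPass_bind (b := 264) hB hM (by omega) (by omega) fun r => ?_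
    split_ifs
    · have h1 : Fits (32 * (n + m + 2)) ((n + m + 2) ^ (88 * M)) Set.univ
          ((selectPass hB n m).bind fun r =>
            (ret (Sum.inl (Fin.ofNat _ r.2)) : Prog B _ (Outcome (cap n m)))) :=
        fits_pass_bind hB hM (by norm_num) card_words_le (by omega)
          (home_add_lt hB (by omega)) le_rfl fun _ => fits_ret _
      exact h1.mono le_rfl (Nat.pow_le_pow_right (by omega) (by omega)) subset_rfl
    · exact refute_fits hB hM _ _
  refine (hsort.seq hrest).mono le_rfl ?_ subset_rfl
  have := add_mul_le (N' := (n + m + 2) ^ (352 * M)) (b := 352) (c := 1) hQ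
    (show 2 ≤ M by omega) hsort' (Nat.one_le_pow _ _ (by omega)) le_rfl
  rwa [Nat.one_mul] at this

theorem printBlocks_fits {α : Type} [Fintype α] {A c a len : ℕ} (h : a + c ≤ A) :
    Fits A (c * (2 * Fintype.card α ^ B + 1) + 1) Set.univ
      (printBlocks (B := B) (α := α) c a len) := by
  induction c generalizing a len with
  | zero => exact (Fits.ret (Set.mem_univ _)).mono le_rfl (by simp) subset_rfl
  | succ c ih =>
    have h1 := ih (a := a + 1) (len := len - B) (by omega)
    have h2 : Fits A (Fintype.card α ^ B * 2 + 1) Set.univ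
        (read a fun r => emit ((List.ofFn r).take len) (ret ()) : Prog B α Unit) :=
      Fits.read (by omega) fun r => Fits.emit (by simp) (Fits.ret (Set.mem_univ _))
    refine (h2.seq (f := fun _ => printBlocks c (a + 1) (len - B)) h1).mono le_rfl ?_ subset_rfl
    rw [Nat.add_mul c]
    omega

theorem printList_fits {α : Type} {A : ℕ} (hB : 0 < B) (l : List α) :
    Fits A (l.length + 1) Set.univ (printList (B := B) l) := by
  induction l with
  | nil => exact Fits.ret (Set.mem_univ _)
  | cons x l ih => exact Fits.emit hB ih

theorem length_quadruple {β : Type} (u v x y : β) (s s' : Bool) :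
    (quadruple u v x y s s').length = 4 := by
  cases s <;> cases s' <;> rfl

theorem report_fits (hB : 0 < B) (hM : 2 * B ≤ M) (x : Outcome (cap n m)) :
    Fits (32 * (n + m + 2)) ((n + m + 2) ^ (7 * M)) Set.univ (report (B := B) n m x) := by
  have hQ : 2 ≤ n + m + 2 := by omega
  have hspare' : spare n m = 16 * (n + m + 2) := rfl
  have h6 : 4 ≤ (n + m + 2) ^ 2 := by nlinarith
  rcases x with len | ⟨z, z', s, s'⟩
  · have h1 : ((len : ℕ) + B - 1) / B ≤ 2 * (n + m + 2) := by
      have h2 := len.2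
      have hcap : cap n m = 2 * (n + m + 2) := rfl
      rw [Nat.div_le_iff_le_mul_add_pred hB]
      have := Nat.le_mul_of_pos_left (2 * (n + m + 2)) hB
      omega
    refine (printBlocks_fits (a := spare n m) (A := 32 * (n + m + 2)) (by omega)).mono le_rfl ?_
      subset_rfl
    rw [card_words]
    have h2 : ((2 * (n + m + 2) + 1) ^ 3) ^ B ≤ (n + m + 2) ^ (9 * B) := by
      rw [pow_mul]
      exact Nat.pow_le_pow_left (words_le hQ) _
    have h3 : 1 ≤ (n + m + 2) ^ (9 * B) := Nat.one_le_pow _ _ (by omega)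
    have h4 : 2 * (n + m + 2) ≤ (n + m + 2) ^ 2 := by nlinarith
    have h5 : 2 * ((2 * (n + m + 2) + 1) ^ 3) ^ B + 1 + 1 ≤
        (n + m + 2) ^ 2 * (n + m + 2) ^ (9 * B) := by nlinarith
    calc _ ≤ (n + m + 2) ^ 2 * (2 * ((2 * (n + m + 2) + 1) ^ 3) ^ B + 1) + 1 := by
          gcongr
          exact h1.trans h4
      _ ≤ (n + m + 2) ^ 2 * (2 * ((2 * (n + m + 2) + 1) ^ 3) ^ B + 1 + 1) := by
          refine (Nat.add_le_add_left ?_ _).trans (Nat.mul_succ _ _).symm.le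
          omega
      _ ≤ (n + m + 2) ^ 2 * ((n + m + 2) ^ 2 * (n + m + 2) ^ (9 * B)) :=
          Nat.mul_le_mul_left _ h5
      _ = (n + m + 2) ^ (2 + (2 + 9 * B)) := by rw [← pow_add, ← pow_add]
      _ ≤ _ := Nat.pow_le_pow_right (by omega) (by omega)
  · refine (printList_fits hB _).mono le_rfl ?_ subset_rfl
    rw [List.length_map, length_quadruple]
    calc 4 + 1 ≤ 2 ^ 3 := by norm_num
      _ ≤ (n + m + 2) ^ 3 := two_pow_le hQ 3
      _ ≤ _ := Nat.pow_le_pow_right (by omega) (by omega)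

theorem card_outcome : Fintype.card (Outcome (cap n m)) ≤ (n + m + 2) ^ 24 := by
  have key : ∀ Q : ℕ, 2 ≤ Q →
      2 * Q + 1 + (2 * Q + 1) ^ 3 * ((2 * Q + 1) ^ 3 * (2 * 2)) ≤ Q ^ 24 := by
    intro Q hQ
    have h1 := words_le hQ
    have h2 := two_mul_add_one_le hQ
    have h3 : Q ^ 3 ≤ Q ^ 20 := Nat.pow_le_pow_right (by omega) (by omega)
    have h4 : (2 * Q + 1) ^ 3 * ((2 * Q + 1) ^ 3 * (2 * 2)) ≤ Q ^ 20 := by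
      calc _ ≤ Q ^ 9 * (Q ^ 9 * Q ^ 2) :=
            Nat.mul_le_mul h1 (Nat.mul_le_mul h1 (two_pow_le hQ 2))
        _ = _ := by rw [← pow_add, ← pow_add]
    have h5 : Q ^ 20 * 2 ≤ Q ^ 21 := Nat.mul_le_mul_left _ hQ
    have h6 : Q ^ 21 ≤ Q ^ 24 := Nat.pow_le_pow_right (by omega) (by omega)
    exact (Nat.add_le_add (h2.trans h3) h4).trans (((Nat.mul_two _).symm.le.trans h5).trans h6)
  rw [Fintype.card_sum, Fintype.card_prod, Fintype.card_prod, Fintype.card_prod, card_words,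
    Fintype.card_bool, Fintype.card_fin]
  exact key _ (by omega)

end Fits

/-! ### The machine, its certificates and the sorting bound -/

section Correctness

/-- The programs that decide whether a graph is a threshold graph, with certificates. -/
noncomputable def thresholdFamily : Family where
  α n m := Word (cap n m)
  inst _ _ := ⟨Word.top _⟩
  enc _ _ := Word.toNat
  enc_inj _ _ := Word.toNat_injective
  -- For the empty graph `sortCost` is `0`, so no transfer is allowed and the answer must come at
  -- once. The condition on `B` only makes the definition total.
  main M B n m := if h : 0 < B ∧ 0 < n then
    (decision h.1 M n m).bind fun x => .answer x.isLeft (report n m x) else .answer true (.ret ())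
  -- Twice the `552` of `main_fits`, because only `M - B ≥ M / 2` cells carry the code.
  exponent := 1104

variable {n m B M : ℕ}

theorem thresholdFamily_main (hB : 0 < B) (hn : 0 < n) :
    thresholdFamily.main M B n m =
      (decision hB M n m).bind fun x => .answer x.isLeft (report n m x) :=
  dif_pos ⟨hB, hn⟩

theorem thresholdFamily_main_zero :
    thresholdFamily.main M B 0 m =
      (Prog.ret () : Prog B (Word (cap 0 m)) Unit).bind fun _ => .answer true (.ret ()) :=
  dif_neg (by simp)

theorem main_fits (hB : 0 < B) (hM : 2 * B ≤ M) (hn : 0 < n) :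
    Fits (32 * (n + m + 2)) ((n + m + 2) ^ (552 * M)) Set.univ
      (thresholdFamily.main M B n m) := by
  have hQ : 2 ≤ n + m + 2 := by omega
  rw [thresholdFamily_main hB hn]
  have h1 : ∀ x, Fits (32 * (n + m + 2)) ((n + m + 2) ^ (8 * M)) Set.univ
      (Prog.answer x.isLeft (report n m x) : Prog B (Word (cap n m)) Unit) := by
    intro x
    refine (Fits.answer (report_fits hB hM x)).mono le_rfl ?_ subset_rfl
    have h2 : 1 ≤ (n + m + 2) ^ (7 * M) := Nat.one_le_pow _ _ (by omega)
    calc (n + m + 2) ^ (7 * M) + 1 ≤ (n + m + 2) ^ (7 * M) * 2 := by omega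
      _ ≤ (n + m + 2) ^ (7 * M) * (n + m + 2) := Nat.mul_le_mul_left _ hQ
      _ = (n + m + 2) ^ (7 * M + 1) := (pow_succ _ _).symm
      _ ≤ _ := Nat.pow_le_pow_right (by omega) (by omega)
  exact ((decision_fits hB hM).bind (F := Finset.univ) (by
    rw [Finset.card_univ]; exact card_outcome) (by simp) (fun x _ => h1 x)).mono le_rfl
      (add_mul_le hQ (by omega) le_rfl le_rfl le_rfl) subset_rfl

theorem thresholdFamily_good (hB : 1 ≤ B) (hM : 2 * B ≤ M) :
    thresholdFamily.Good M B n m := by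
  have hQ : 2 ≤ n + m + 2 := by omega
  have he : thresholdFamily.exponent = 1104 := rfl
  refine ⟨hB, hM, by rw [he]; norm_num, fun x => ?_, ?_⟩
  · rw [Family.base, he]
    refine (Word.toNat_lt x).le.trans ((words_le hQ).trans ?_)
    exact Nat.pow_le_pow_right (by omega) (by norm_num)
  have h1 : 32 * (n + m + 2) ≤ thresholdFamily.base n m := by
    rw [Family.base, he]
    calc 32 * (n + m + 2) ≤ (n + m + 2) ^ 5 * (n + m + 2) :=
          Nat.mul_le_mul_right _ (two_pow_le hQ 5)
      _ = (n + m + 2) ^ 6 := (pow_succ _ _).symm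
      _ ≤ _ := Nat.pow_le_pow_right (by omega) (by norm_num)
  have h2 : (n + m + 2) ^ (552 * M) ≤ thresholdFamily.base n m ^ (M - B) := by
    rw [Family.base, he, ← pow_mul]
    exact Nat.pow_le_pow_right (by omega) (by omega)
  rcases Nat.eq_zero_or_pos n with rfl | hn
  · rw [thresholdFamily_main_zero]
    refine Fits.mono (Fits.answer (Fits.ret (Set.mem_univ _))) le_rfl (le_trans ?_ h2) subset_rfl
    calc 1 + 1 ≤ 0 + m + 2 := by omega
      _ ≤ _ := Nat.le_self_pow (by omega) _
  · exact (main_fits hB hM hn).mono h1 h2 subset_rfl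

theorem inputWords_toNat {G : SimpleGraph (Fin n)} {adj : Fin n → List (Fin n)}
    (hadj : IsAdjacencyLists G adj) (hG : G.edgeSet.ncard = m) (i : ℕ) :
    (inputWords (cap n m) adj i).toNat = (rowP adj ++ rowE adj).getD i 0 := by
  have hcap : cap n m = 2 * (n + m + 2) := rfl
  have h1 := getD_row_le adj i
  rw [rowStart_eq adj hG hadj] at h1
  exact Word.toNat_word_zero (by omega)

theorem toNat_map_word (l : List (Fin n)) :
    (l.map fun v : Fin n => word (cap n m) 0 0 v).map Word.toNat = l.map Fin.val := by
  have hcap : cap n m = 2 * (n + m + 2) := rfl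
  rw [List.map_map]
  refine List.map_congr_left fun v _ => ?_
  have := v.2
  exact Word.toNat_word_zero (by omega)

theorem div_le_ceil (hB : 0 < B) (N : ℕ) : (N + B - 1) / B ≤ ⌈(N : ℝ) / B⌉₊ := by
  have h1 : (N : ℝ) / B ≤ ⌈(N : ℝ) / B⌉₊ := Nat.le_ceil _
  rw [div_le_iff₀ (by exact_mod_cast hB)] at h1
  have h2 : N ≤ ⌈(N : ℝ) / B⌉₊ * B := by exact_mod_cast h1
  rw [Nat.div_le_iff_le_mul_add_pred hB, Nat.mul_comm]
  omega

theorem quadruple_eq (G : SimpleGraph (Fin n)) {u v x y : Fin n} {s s' : Bool}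
    (h : IsAlternating G u v x y) (hs : s = true ↔ G.Adj u v) (hs' : s' = true ↔ G.Adj x y) :
    IsNoCertificate G (quadruple u v x y s s') := by
  classical
  have h1 := h.isNoCertificate
  cases s <;> cases s' <;> simp_all [quadruple]

theorem quadruple_map {β γ : Type} (f : β → γ) (u v x y : β) (s s' : Bool) :
    (quadruple u v x y s s').map f = quadruple (f u) (f v) (f x) (f y) s s' := by
  cases s <;> cases s' <;> rfl

theorem isThreshold_of_isYesCertificate {V : Type*} {G : SimpleGraph V} {β : List V}
    (h : IsYesCertificate G β) : IsThreshold G :=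
  ⟨_, _, h.1, β, rfl, h.2⟩

/-- The machine on graphs with at least one vertex. -/
theorem machine_returns (hB : 1 ≤ B) (hM : 2 * B ≤ M) (hn : 0 < n) {G : SimpleGraph (Fin n)}
    (hG : G.edgeSet.ncard = m) {adj : Fin n → List (Fin n)} (hadj : IsAdjacencyLists G adj) :
    ∃ t s, t + s ≤ 24 * blocks B n m + 25 +
        7 * (blocks B n m * Nat.clog (M / B) (blocks B n m)) ∧
      ((∃ β : List (Fin n), IsYesCertificate G β ∧ s = 2 * ((β.length + B - 1) / B) ∧
        Returns thresholdFamily.machine M B ((n + m + 2) ^ (2 * thresholdFamily.exponent))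
          (initConfig thresholdFamily.machine M m adj) true (β.map Fin.val) t s) ∨
      (¬ IsThreshold G ∧ ∃ w : List (Fin n), IsNoCertificate G w ∧
        Returns thresholdFamily.machine M B ((n + m + 2) ^ (2 * thresholdFamily.exponent))
          (initConfig thresholdFamily.machine M m adj) false (w.map Fin.val) t s)) := by
  have hcap : cap n m = 2 * (n + m + 2) := rfl
  obtain ⟨r, D, t, h1, h2, h3⟩ := decision_evals hB hM hn hadj hG
  have hb := (blocks_bounds (n := n) (m := m) hB).1
  have hret := fun {o s} => Family.returns (F := thresholdFamily) (thresholdFamily_good hB hM) adj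
    (thresholdFamily_main (M := M) (m := m) hB hn) (inputWords_toNat hadj hG) h1 (o := o) (s := s)
  rcases h3 with ⟨β, hβ, rfl, hw⟩ | ⟨u, v, x, y, s, s', halt, rfl, hs, hs'⟩
  · have hlen : β.length ≤ n := by simpa using hβ.2.1.length_le_card
    have hval : ((Fin.ofNat (cap n m + 1) β.length : Fin _) : ℕ) = β.length :=
      Nat.mod_eq_of_lt (by omega)
    have hs : (β.length + B - 1) / B ≤ blocks B n m := Nat.div_le_div_right (by omega)
    refine ⟨t, 2 * ((β.length + B - 1) / B), by omega, Or.inl ⟨β, hβ, rfl, ?_⟩⟩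
    rw [← toNat_map_word (m := m) β]
    refine hret ?_
    have h4 := printBlocks_prints (B := B) D ((β.length + B - 1) / B) (spare n m) β.length
    rw [hw, padded, List.take_left' (by simp)] at h4
    rw [report, hval]
    exact h4
  · have hu := u.2
    have hv := v.2
    have hx := x.2
    have hy := y.2
    refine ⟨t, 4, by omega, Or.inr ⟨halt.not_isThreshold, quadruple u v x y s s',
      quadruple_eq G halt hs hs', ?_⟩⟩
    rw [← toNat_map_word (m := m)]
    refine hret ?_
    rw [report, Word.a_word (by omega), Word.b_word (by omega), Word.c_word (by omega),
      Word.c_word (by omega), ← quadruple_map Fin.val, List.map_map]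
    have h4 := printList_prints (B := B) D
      ((quadruple u v x y s s').map fun i : Fin n => word (cap n m) 0 0 i)
    rw [List.length_map, length_quadruple] at h4
    exact h4

/-- The bound on the number of block transfers in terms of `sortCost`. -/
theorem le_sortCost (hB : 1 ≤ B) (hM : 2 * B ≤ M) (hn : 0 < n) {t : ℕ}
    (ht : t ≤ 24 * blocks B n m + 25 +
      7 * (blocks B n m * Nat.clog (M / B) (blocks B n m))) :
    (t : ℝ) ≤ (600 : ℕ) * sortCost M B (n + m) := by
  obtain ⟨hb, -, -⟩ := blocks_bounds (n := n) (m := m) hB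
  have hk : 2 ≤ M / B := (Nat.le_div_iff_mul_le hB).2 hM
  set L := Nat.clog (M / B) (blocks B n m) with hL
  set c := ⌈((n + m : ℕ) : ℝ) / B⌉₊ with hc
  have hBr : (0 : ℝ) < B := by exact_mod_cast hB
  have h1 : ((n + m : ℕ) : ℝ) / B ≤ c := Nat.le_ceil _
  rw [div_le_iff₀ hBr] at h1
  have h2 : n + m ≤ c * B := by exact_mod_cast h1
  -- As `n ≥ 1`, the number `n + 2 * m + 1` of records is at most `2 * (n + m)`.
  have h3 : blocks B n m ≤ 2 * c := by
    rw [blocks, Nat.div_le_iff_le_mul_add_pred hB]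
    have : B * (2 * c) = 2 * (c * B) := by ring
    omega
  set lam := Real.logb ((M : ℝ) / B) (((n + m : ℕ) : ℝ) / B) with hlam
  -- Let `k` be `M / B` rounded down and `x = (n + m) / B`. From `k ^ (L - 1) < 2 * c ≤ 4 * x`
  -- follows `(L - 1) * log k ≤ log 4 + log x`. Here `log 4 ≤ 2 * log k` and `log x = lam * log (M /
  -- B) ≤ 2 * lam * log k`, so `L ≤ 3 + 2 * lam`.
  have h4 : (L : ℝ) ≤ 5 * max 1 lam := by
    have hmax : (1 : ℝ) ≤ max 1 lam := le_max_left _ _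
    rcases Nat.lt_or_ge L 2 with hL2 | hL2
    · have : (L : ℝ) ≤ 1 := by exact_mod_cast Nat.le_of_lt_succ hL2
      linarith
    have hb2 : 1 < blocks B n m := by
      by_contra h
      have : blocks B n m ≤ 1 := by omega
      rw [Nat.clog_of_right_le_one this] at hL
      omega
    have h5 : (M / B) ^ (L - 1) < blocks B n m := Nat.pow_pred_clog_lt_self (by omega) hb2
    have h6 : 2 ≤ (M / B) ^ (L - 1) := hk.trans (Nat.le_self_pow (by omega) _)
    -- This makes `x > 1`, which is used for `c ≤ 2 * x` and for `lam ≥ 0`.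
    have hc2 : 2 ≤ c := by omega
    have hx : (1 : ℝ) < ((n + m : ℕ) : ℝ) / B := by
      have : 1 < c := hc2
      rw [hc, Nat.lt_ceil] at this
      simpa using this
    have hc3 : (c : ℝ) < ((n + m : ℕ) : ℝ) / B + 1 := Nat.ceil_lt_add_one (by positivity)
    have h7 : ((M / B : ℕ) : ℝ) ^ (L - 1) ≤ 4 * (((n + m : ℕ) : ℝ) / B) := by
      have h8 : (((M / B) ^ (L - 1) : ℕ) : ℝ) ≤ ((2 * c : ℕ) : ℝ) := by
        exact_mod_cast (h5.le.trans h3)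
      push_cast at h8 ⊢
      push_cast at hc3 hx
      linarith
    have hkr : (2 : ℝ) ≤ ((M / B : ℕ) : ℝ) := by exact_mod_cast hk
    have hlogk : 0 < Real.log ((M / B : ℕ) : ℝ) := Real.log_pos (by linarith)
    have h8 := Real.log_le_log (by positivity) h7
    rw [Real.log_pow, Real.log_mul (by norm_num) (by linarith)] at h8
    have h9 : Real.log 4 ≤ 2 * Real.log ((M / B : ℕ) : ℝ) := by
      rw [show (4 : ℝ) = 2 ^ 2 by norm_num, Real.log_pow]
      have := Real.log_le_log (by norm_num) hkr
      push_cast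
      linarith
    have hratio : (2 : ℝ) ≤ (M : ℝ) / B := by
      rw [le_div_iff₀ hBr]
      exact_mod_cast hM
    -- Rounding down `M / B` costs at most a square: `M / B < k + 1 ≤ k ^ 2` for `k ≥ 2`.
    have hratio' : (M : ℝ) / B ≤ ((M / B : ℕ) : ℝ) ^ 2 := by
      have h10 : (M : ℝ) / B < ((M / B : ℕ) : ℝ) + 1 := by
        rw [div_lt_iff₀ hBr]
        have : M < (M / B + 1) * B := by
          rw [Nat.mul_comm]
          exact Nat.lt_mul_div_succ M hB
        exact_mod_cast this
      nlinarith
    have hlogr : 0 < Real.log ((M : ℝ) / B) := Real.log_pos (by linarith)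
    have h10 : Real.log ((M : ℝ) / B) ≤ 2 * Real.log ((M / B : ℕ) : ℝ) := by
      have := Real.log_le_log (by linarith) hratio'
      rwa [Real.log_pow, Nat.cast_ofNat] at this
    have hlam0 : 0 ≤ lam := Real.logb_nonneg (by linarith) hx.le
    have h11 : Real.log (((n + m : ℕ) : ℝ) / B) = lam * Real.log ((M : ℝ) / B) := by
      rw [hlam, Real.logb, div_mul_cancel₀ _ hlogr.ne']
    have h12 : ((L - 1 : ℕ) : ℝ) * Real.log ((M / B : ℕ) : ℝ) ≤
        (2 + 2 * lam) * Real.log ((M / B : ℕ) : ℝ) := by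
      rw [h11] at h8
      nlinarith [mul_le_mul_of_nonneg_left h10 hlam0]
    have h13 := le_of_mul_le_mul_right h12 hlogk
    rw [Nat.cast_sub (by omega), Nat.cast_one] at h13
    have := le_max_right 1 lam
    linarith
  -- There is at least one block, so `25` is absorbed: `24 + 25 = 49`. With `L ≤ 5 * max 1 lam` the
  -- factor becomes `49 + 35 = 84`, and `2 * 84 ≤ 600`.
  have h5 : t ≤ blocks B n m * (49 + 7 * L) := by nlinarith
  have h6 : (t : ℝ) ≤ (blocks B n m : ℝ) * (49 + 7 * (L : ℝ)) := by exact_mod_cast h5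
  have h7 : (blocks B n m : ℝ) ≤ 2 * (c : ℝ) := by exact_mod_cast h3
  have hmax : (1 : ℝ) ≤ max 1 lam := le_max_left _ _
  have h8 : sortCost M B (n + m) = c * max 1 lam := rfl
  rw [h8]
  calc (t : ℝ) ≤ (blocks B n m : ℝ) * (49 + 7 * (L : ℝ)) := h6
    _ ≤ 2 * (c : ℝ) * (84 * max 1 lam) := by
        refine mul_le_mul h7 (by linarith) (by positivity) (by positivity)
    _ ≤ (600 : ℕ) * (c * max 1 lam) := by
        have : 0 ≤ (c : ℝ) * max 1 lam := by positivity
        push_cast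
        linarith

end Correctness

end ThresholdCert

theorem mainTheorem2 :
    ∃ (A : ThresholdCert.Machine) (C d : ℕ),
      ∀ (M B : ℕ), 1 ≤ B → 2 * B ≤ M →
      ∀ (n m : ℕ) (G : SimpleGraph (Fin n)), G.edgeSet.ncard = m →
      ∀ adj : Fin n → List (Fin n), ThresholdCert.IsAdjacencyLists G adj →
        (ThresholdCert.IsThreshold G →
          ∃ (β : List (Fin n)) (t s : ℕ),
            ThresholdCert.IsYesCertificate G β ∧
            ThresholdCert.Returns A M B ((n + m + 2) ^ d)
              (ThresholdCert.initConfig A M m adj) true (β.map Fin.val) t s ∧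
            ((t + s : ℕ) : ℝ) ≤ C * ThresholdCert.sortCost M B (n + m) ∧
            (s : ℝ) ≤ C * ThresholdCert.scanCost B β.length) ∧
        (¬ ThresholdCert.IsThreshold G →
          ∃ (w : List (Fin n)) (t s : ℕ),
            ThresholdCert.IsNoCertificate G w ∧
            ThresholdCert.Returns A M B ((n + m + 2) ^ d)
              (ThresholdCert.initConfig A M m adj) false (w.map Fin.val) t s ∧
            ((t + s : ℕ) : ℝ) ≤ C * ThresholdCert.sortCost M B (n + m)) := by
  refine ⟨ThresholdCert.thresholdFamily.machine, 600,
    2 * ThresholdCert.thresholdFamily.exponent, ?_⟩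
  intro M B hB hM n m G hG adj hadj
  rcases Nat.eq_zero_or_pos n with rfl | hn
  · have hyes : ThresholdCert.IsYesCertificate G [] := by
      refine ⟨⟨?_, ?_, ?_, ?_⟩, List.nodup_nil, List.Pairwise.nil⟩
      · exact Subsingleton.elim _ _
      · exact Set.disjoint_left.2 fun v => v.elim0
      · exact fun v => v.elim0
      · exact fun v => v.elim0
    refine ⟨fun _ => ⟨[], 0, 0, hyes, ?_, ?_, ?_⟩, fun h =>
      absurd (ThresholdCert.isThreshold_of_isYesCertificate hyes) h⟩
    · exact ThresholdCert.Family.returns (ThresholdCert.thresholdFamily_good hB hM) adj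
        (b := fun _ => true) (q := fun _ => .ret ()) ThresholdCert.thresholdFamily_main_zero
        (ThresholdCert.inputWords_toNat hadj hG) .ret (o := []) .ret
    · rw [ThresholdCert.sortCost]
      push_cast
      positivity
    · rw [ThresholdCert.scanCost]
      push_cast
      positivity
  · obtain ⟨t, s, h1, h2⟩ := ThresholdCert.machine_returns hB hM hn hG hadj
    have h3 := ThresholdCert.le_sortCost hB hM hn h1
    rcases h2 with ⟨β, h4, h5, h6⟩ | ⟨h4, w, h5, h6⟩
    · refine ⟨fun _ => ⟨β, t, s, h4, h6, h3, ?_⟩, fun h =>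
        absurd (ThresholdCert.isThreshold_of_isYesCertificate h4) h⟩
      have h7 : (((β.length + B - 1) / B : ℕ) : ℝ) ≤ ThresholdCert.scanCost B β.length := by
        exact Nat.cast_le.2 (ThresholdCert.div_le_ceil hB β.length)
      have h8 : (0 : ℝ) ≤ (((β.length + B - 1) / B : ℕ) : ℝ) := Nat.cast_nonneg _
      -- Each block of the certificate is read once and emitted once, hence the factor `2`.
      rw [h5]
      push_cast at h7 h8 ⊢
      linarith
    · exact ⟨fun h => absurd h h4, fun _ => ⟨w, t, s, h5, h6, h3⟩⟩
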